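/- Let $d\ge 4$, $\theta\in\mathbb{R}^d$, and observe $x_i=\theta_i+z_i$, $i=1,\dots,d$, with $z_1,\dots,z_d$ i.i.d. $N(0,1)$. The risk of an estimator $\hat\theta=\hat\theta(x)$ is $R(\hat\theta,\theta)=d^{-1}\sum_{i=1}^d E(\hat\theta_i-\theta_i)^2$. For an integer $L\ge1$ cut $\{1,\dots,d\}$ into $\lceil d/L\rceil$ consecutive blocks of length $L$ (the last block is shorter if $L\nmid d$). For a block $b$ let $\underline{x}_b$ be the vector of its observations, $n_b$ its number of coordinates and $S_b^2=\|\underline{x}_b\|_2^2$. The blockwise James–Stein estimator with threshold $\lambda\ge0$ is $\hat\theta_b(\lambda,L)=(1-\lambda/S_b^2)_+\,\underline{x}_b$, and its Stein unbiased risk estimate is $$\mathrm{SURE}(x,\lambda,L)=\sum_b\Big(n_b+\frac{\lambda^2-2\lambda(n_b-2)}{S_b^2}I(S_b^2>\lambda)+(S_b^2-2n_b)I(S_b^2\le\lambda)\Big).$$ Put $T_d=d^{-1}\sum_i(x_i^2-1)$ and $\gamma_d=d^{-1/2}(\log_2 d)^{3/2}$. Let $(\lambda^*,L^*)$ be a minimizer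 of $\mathrm{SURE}(x,\lambda,L)$ over $\max\{L-2,0\}\le\lambda\le 2L\log d$, $1\le L\le d^{1/2}$ ($L$ an integer). The SureBlock estimator $\hat\theta^*$ is given by $\hat\theta^*_b=\hat\theta_b(\lambda^*,L^*)$ for every block $b$ if $T_d>\gamma_d$, and by $\hat\theta^*_i=(1-2\log d/x_i^2)_+\,x_i$ for every $i$ if $T_d\le\gamma_d$. (If the minimizer is not unique, any choice that makes $\hat\theta^*$ measurable is allowed.) Let $\Theta_p(\tau)=\{\theta\in\mathbb{R}^d:\|\theta\|_p\le\tau\}$. **Theorem 2.** (a) (Dense signals.) There is an absolute constant $c>0$ such that for all $d\ge4$, all $2\le p\le\infty$ (with $2/\infty=0$) and all $\tau\ge0$, $$\sup_{\theta\in\Theta_p(\tau)}R(\hat\theta^*,\theta)\le\frac{\tau^2}{\tau^2+d^{2/p}}+c\,d^{-1/4}(\log d)^{5/2}.$$ (b) (Moderately sparse signals.) For every $\eta\in(0,1)$ there is a constant $c>0$, depending only on $\eta$, such that for all $d\ge4$, all $1\le p\le2$ and all $\tau>0$ which, if $p<2$, satisfy $\tau^p\le\eta d$, $$\sup_{\theta\in\Theta_p(\tau)}R(\hat\theta^*,\theta)\le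 c\,d^{-1}\tau^p\big(\log(d\tau^{-p})\big)^{1-p/2}+c\,d^{-1/4}(\log d)^{5/2},$$ where for $p=2$ the factor $(\log(d\tau^{-p}))^{1-p/2}$ is read as $1$. (c) (Very sparse signals.) There is an absolute constant $c>0$ such that for all $d\ge4$, all $0<p\le2$ and all $0\le\tau<\frac{1}{\sqrt3}\,d^{1/4}(\log_2 d)^{3/4}$, $$\sup_{\theta\in\Theta_p(\tau)}R(\hat\theta^*,\theta)\le d^{-1}\tau^2+c\,d^{-1}(\log d)^{-1/2}.$$ -/

import Mathlib

open MeasureTheory ProbabilityTheory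
open scoped ENNReal

noncomputable section

namespace SureBlock

/-- Coordinates of the block number `b` (counted from `0`) when `{0, …, d - 1}` is cut into
consecutive blocks of length `L`.  If `L` does not divide `d`, the last block is shorter. -/
def block (d L b : ℕ) : Finset (Fin d) :=
  Finset.univ.filter fun i => (i : ℕ) / L = b

/-- The number `⌈d / L⌉` of (nonempty) blocks. -/
def numBlocks (d L : ℕ) : ℕ := (d + L - 1) / L

/-- `S_b² = ‖x_b‖₂²`, the energy of the observations in block `b`. -/
def energy {d : ℕ} (x : Fin d → ℝ) (L b : ℕ) : ℝ :=
  ∑ i ∈ block d L b, x i ^ 2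

/-- The blockwise James–Stein estimator with threshold `lam` and block size `L`: in each
block `b`, the observations are multiplied by `(1 - lam / S_b²)₊`. -/
def blockJS {d : ℕ} (lam : ℝ) (L : ℕ) (x : Fin d → ℝ) : Fin d → ℝ :=
  fun i => max (1 - lam / energy x L ((i : ℕ) / L)) 0 * x i

/-- Stein's unbiased risk estimate for one block with `n` coordinates and energy `s`. -/
def sureTerm (n : ℕ) (s lam : ℝ) : ℝ :=
  (n : ℝ) + (if lam < s then (lam ^ 2 - 2 * lam * ((n : ℝ) - 2)) / s else 0)
    + (if s ≤ lam then s - 2 * (n : ℝ) else 0)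

/-- `SURE(x, lam, L)`, the sum over all blocks. -/
def sure {d : ℕ} (x : Fin d → ℝ) (lam : ℝ) (L : ℕ) : ℝ :=
  ∑ b ∈ Finset.range (numBlocks d L), sureTerm (block d L b).card (energy x L b) lam

/-- The search range `max {L - 2, 0} ≤ lam ≤ 2 L log d`, `1 ≤ L ≤ d^{1/2}`. -/
def searchRange (d : ℕ) : Set (ℝ × ℕ) :=
  {q | max ((q.2 : ℝ) - 2) 0 ≤ q.1 ∧ q.1 ≤ 2 * (q.2 : ℝ) * Real.log d ∧
    1 ≤ q.2 ∧ (q.2 : ℝ) ≤ Real.sqrt d}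

/-- `T_d = d⁻¹ ∑ (x_i² - 1)`. -/
def energyStat {d : ℕ} (x : Fin d → ℝ) : ℝ := (d : ℝ)⁻¹ * ∑ i, (x i ^ 2 - 1)

/-- `γ_d = d^{-1/2} (log₂ d)^{3/2}`. -/
def gammaLevel (d : ℕ) : ℝ := (d : ℝ) ^ (-1 / 2 : ℝ) * Real.logb 2 d ^ (3 / 2 : ℝ)

/-- The nonnegative garrote with threshold level `2 log d`. -/
def garrote {d : ℕ} (x : Fin d → ℝ) : Fin d → ℝ :=
  fun i => max (1 - 2 * Real.log d / x i ^ 2) 0 * x i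

/-- `est` is a SureBlock estimator: a measurable function of the data which is the garrote if
`T_d ≤ γ_d`, and otherwise the blockwise James–Stein estimator for some minimizer of `SURE`
over the search range (ties may be broken in any way). -/
structure IsSureBlock {d : ℕ} (est : (Fin d → ℝ) → Fin d → ℝ) : Prop where
  measurable : Measurable est
  sparse : ∀ x, energyStat x ≤ gammaLevel d → est x = garrote x
  dense : ∀ x, gammaLevel d < energyStat x →
    ∃ q ∈ searchRange d, IsMinOn (fun q' : ℝ × ℕ => sure x q'.1 q'.2) (searchRange d) q ∧
      est x = blockJS q.1 q.2 x

/-- The average mean squared error `d⁻¹ ∑ E (est(x)_i - θ_i)²`, where `x = θ + z` and the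
`z_i` are i.i.d. standard normal. -/
def risk {d : ℕ} (est : (Fin d → ℝ) → Fin d → ℝ) (θ : Fin d → ℝ) : ℝ≥0∞ :=
  (d : ℝ≥0∞)⁻¹ * ∑ i, ∫⁻ z, ENNReal.ofReal ((est (θ + z) i - θ i) ^ 2)
    ∂(Measure.pi fun _ : Fin d => gaussianReal 0 1)

/-- The `ℓ_p` ball `{θ ∈ ℝ^d : ‖θ‖_p ≤ τ}` (for `0 < p < 1`, `‖θ‖_p` is the `ℓ_p` quasinorm). -/
def lpBall (d : ℕ) (p : ℝ≥0∞) (τ : ℝ) : Set (Fin d → ℝ) :=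
  {θ | ‖WithLp.toLp p θ‖ ≤ τ}

end SureBlock

end

namespace SureBlock

open Filter Topology

/-! The loss of the block estimator with parameters `(lam, L)` is exactly SURE, plus `‖z‖² - d`,
plus twice a sum of block errors (`loss_blockJS_eq`). The middle term does not depend on the
parameters, so comparing the SURE minimizer with any fixed admissible pair leaves twice the
difference of their total errors. Only an upper bound on the total error, uniform over the search
range, and a lower tail at one fixed pair are needed.

By Stein's identity each block error has mean zero (`integral_sureError`). It is bounded by `√(log
d) (L + ‖z_b‖²)` up to a constant, whatever `θ` is, and different blocks are independent. Since `L ≤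
√d`, the total error has bounded exponential moments at scale `d^{3/4} √(log d)`
(`lintegral_exp_totalError_le`). A soft maximum over a polynomial grid costs a further factor `log
d`. Between grid points a one-sided comparison suffices: the error is discontinuous in the
threshold, but its jumps go up, so rounding a threshold up loses little. Thresholds below `d^{-1/2}`
occur only for `L ≤ 2` and are handled by small ball probabilities. The garrote branch costs little
as well: either `‖θ‖²` is small and the garrote is accurate, or the pretest rarely selects it. The
outcome is an oracle inequality (`risk_le_of_lintegral_loss_blockJS_le`).

For (a) the oracle is James–Stein with `L = ⌊√d⌋`, `lam = L - 2`, nearly as good as the best linear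
estimator; the `ℓ_p` constraint enters through the power mean inequality. For (b) it is the garrote
`L = 1`, `lam = 2 log (d τ^{-p})`.

Part (c) does not use the oracle inequality. There `‖θ‖² ≤ d γ_d / 3`, so the dense branch
contributes only `O(1/d)` to the total loss by a Chernoff bound (`lintegral_denseLoss_le`). The
coefficient one of `θ²` in the garrote risk is obtained in `garroteRisk_le_sharp` by adding a
multiple of a mean-zero Stein function. -/

/-! ### One-dimensional Gaussian integrals and Stein's identity -/

theorem integrable_gaussian_of_growth {f : ℝ → ℝ} (hf : Measurable f) {C : ℝ}
    (h : ∀ u, |f u| ≤ C * (1 + u ^ 4)) : Integrable f (gaussianReal 0 1) := by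
  have h4 : Integrable (fun u : ℝ => u ^ 4) (gaussianReal 0 1) := by
    have := (memLp_id_gaussianReal (μ := 0) (v := 1) 4).integrable_norm_pow (by norm_num)
    refine this.congr (ae_of_all _ fun u => ?_)
    simp only [id, Real.norm_eq_abs]
    rw [show (4 : ℕ) = 2 * 2 from rfl, pow_mul, pow_mul, sq_abs]
  refine (((integrable_const 1).add h4).const_mul C).mono' hf.aestronglyMeasurable
    (ae_of_all _ fun u => ?_)
  simpa using h u

theorem gaussianPDFReal_std (u : ℝ) :
    gaussianPDFReal 0 1 u = (Real.sqrt (2 * Real.pi))⁻¹ * Real.exp (-u ^ 2 / 2) := by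
  simp [gaussianPDFReal]

theorem gaussianPDFReal_std_le_one (u : ℝ) : gaussianPDFReal 0 1 u ≤ 1 := by
  rw [gaussianPDFReal_std]
  have h1 : 1 ≤ Real.sqrt (2 * Real.pi) := by
    rw [Real.one_le_sqrt]; nlinarith [Real.pi_gt_three]
  have h2 : Real.exp (-u ^ 2 / 2) ≤ 1 := Real.exp_le_one_iff.2 (by nlinarith [sq_nonneg u])
  calc _ ≤ 1 * 1 := mul_le_mul (inv_le_one_of_one_le₀ h1) h2 (Real.exp_pos _).le zero_le_one
    _ = 1 := one_mul 1

/-- Makes the boundary terms in Stein's identity vanish: the density times a function of quadratic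
growth is `O(1 / (1 + u²))`. -/
theorem gaussianPDFReal_std_mul_le (u : ℝ) : gaussianPDFReal 0 1 u * (1 + u ^ 2) ^ 2 ≤ 8 := by
  have hp := gaussianPDFReal_std u
  have h1 : 1 ≤ Real.sqrt (2 * Real.pi) := by
    rw [Real.one_le_sqrt]; nlinarith [Real.pi_gt_three]
  have h2 : (1 + u ^ 2) ^ 2 ≤ 8 * Real.exp (u ^ 2 / 2) := by
    have := Real.quadratic_le_exp_of_nonneg (x := u ^ 2 / 2) (by positivity)
    nlinarith [sq_nonneg u]
  have h3 : Real.exp (-u ^ 2 / 2) * Real.exp (u ^ 2 / 2) = 1 := by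
    rw [← Real.exp_add]; simp [neg_div]
  have h4 : gaussianPDFReal 0 1 u ≤ Real.exp (-u ^ 2 / 2) := by
    rw [hp]
    exact mul_le_of_le_one_left (Real.exp_pos _).le (inv_le_one_of_one_le₀ h1)
  calc _ ≤ Real.exp (-u ^ 2 / 2) * (8 * Real.exp (u ^ 2 / 2)) := by gcongr
    _ = 8 * (Real.exp (-u ^ 2 / 2) * Real.exp (u ^ 2 / 2)) := by ring
    _ = 8 := by rw [h3, mul_one]

theorem hasDerivAt_gaussianPDFReal_std (u : ℝ) :
    HasDerivAt (gaussianPDFReal 0 1) (-u * gaussianPDFReal 0 1 u) u := by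
  have h : HasDerivAt (fun u : ℝ => (Real.sqrt (2 * Real.pi))⁻¹ * Real.exp (-u ^ 2 / 2))
      ((Real.sqrt (2 * Real.pi))⁻¹ * (Real.exp (-u ^ 2 / 2) * (-(2 * u) / 2))) u := by
    have h0 : HasDerivAt (fun u : ℝ => -u ^ 2 / 2) (-(2 * u) / 2) u := by
      simpa using ((hasDerivAt_pow 2 u).neg).div_const 2
    exact (h0.exp).const_mul _
  have e : gaussianPDFReal 0 1 =
      fun u : ℝ => (Real.sqrt (2 * Real.pi))⁻¹ * Real.exp (-u ^ 2 / 2) :=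
    funext gaussianPDFReal_std
  rw [e]
  convert h using 1
  ring

/-- **Stein's identity** for a continuous function which is differentiable off a countable set. -/
theorem gaussian_stein {F F' : ℝ → ℝ} {s : Set ℝ} {C : ℝ} (hs : s.Countable) (hF : Continuous F)
    (hF' : Measurable F') (hd : ∀ u ∉ s, HasDerivAt F (F' u) u)
    (hb : ∀ u, |F u| ≤ C * (1 + u ^ 2)) (hb' : ∀ u, |F' u| ≤ C * (1 + u ^ 2)) :
    Integrable F' (gaussianReal 0 1) ∧ Integrable (fun u => u * F u) (gaussianReal 0 1) ∧
      ∫ u, F' u ∂(gaussianReal 0 1) = ∫ u, u * F u ∂(gaussianReal 0 1) := by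
  have hC : 0 ≤ C := by have := (abs_nonneg _).trans (hb 0); simpa using this
  have i1 : Integrable F' (gaussianReal 0 1) := by
    refine integrable_gaussian_of_growth hF' (C := 2 * C) fun u => (hb' u).trans ?_
    nlinarith [mul_nonneg hC (sq_nonneg (u ^ 2 - 1)), mul_nonneg hC (sq_nonneg (u ^ 2))]
  have i2 : Integrable (fun u => u * F u) (gaussianReal 0 1) := by
    refine integrable_gaussian_of_growth (measurable_id.mul hF.measurable) (C := 2 * C)
      fun u => ?_
    rw [abs_mul]
    have h1 : |u| * (1 + u ^ 2) ≤ 2 * (1 + u ^ 4) := by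
      have e2 : u ^ 2 = |u| ^ 2 := (sq_abs u).symm
      have e4 : u ^ 4 = |u| ^ 4 := by rw [show (4 : ℕ) = 2 * 2 from rfl, pow_mul, pow_mul, sq_abs]
      rw [e2, e4]
      nlinarith [sq_nonneg (|u| - 1), sq_nonneg (|u| ^ 2 - 1), sq_nonneg (|u| ^ 2 - |u|)]
    calc |u| * |F u| ≤ |u| * (C * (1 + u ^ 2)) := by gcongr; exact hb u
      _ = C * (|u| * (1 + u ^ 2)) := by ring
      _ ≤ C * (2 * (1 + u ^ 4)) := by gcongr
      _ = _ := by ring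
  refine ⟨i1, i2, ?_⟩
  have i3 := i1.sub i2
  -- `H` has derivative `H'` off `s`, so the identity says that `H'` integrates to zero: integrate
  -- over `[-n, n]` and let the boundary values die out.
  set H : ℝ → ℝ := fun u => gaussianPDFReal 0 1 u * F u with hH
  set H' : ℝ → ℝ := fun u => gaussianPDFReal 0 1 u * (F' u - u * F u) with hH'
  have iH : Integrable H' := by
    rw [gaussianReal_of_var_ne_zero 0 one_ne_zero] at i3
    have := (integrable_withDensity_iff_integrable_smul' (measurable_gaussianPDF 0 1)
      (ae_of_all _ fun _ => gaussianPDF_lt_top)).1 i3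
    simpa only [toReal_gaussianPDF, smul_eq_mul, Pi.sub_apply] using this
  have hcp : Continuous (gaussianPDFReal 0 1) :=
    continuous_iff_continuousAt.2 fun u => (hasDerivAt_gaussianPDFReal_std u).continuousAt
  have key : ∀ n : ℕ, ∫ u in (-(n : ℝ))..n, H' u = H n - H (-n) := fun n => by
    refine integral_eq_of_hasDerivAt_off_countable_of_le H H' (by simp) hs
      (hcp.mul hF).continuousOn (fun x hx => ?_) iH.intervalIntegrable
    refine ((hasDerivAt_gaussianPDFReal_std x).mul (hd x hx.2)).congr_deriv ?_
    simp only [hH']; ring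
  have hHb : ∀ u, |H u| ≤ 8 * C / (1 + u ^ 2) := fun u => by
    have hp := gaussianPDFReal_nonneg 0 1 u
    rw [hH, abs_mul, abs_of_nonneg hp, le_div_iff₀ (by positivity)]
    calc _ ≤ gaussianPDFReal 0 1 u * (C * (1 + u ^ 2)) * (1 + u ^ 2) := by gcongr; exact hb u
      _ = C * (gaussianPDFReal 0 1 u * (1 + u ^ 2) ^ 2) := by ring
      _ ≤ C * 8 := by gcongr; exact gaussianPDFReal_std_mul_le u
      _ = _ := by ring
  have l1 := intervalIntegral_tendsto_integral iH (a := fun n : ℕ => -(n : ℝ)) (b := fun n => (n : ℝ))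
    (tendsto_neg_atTop_atBot.comp tendsto_natCast_atTop_atTop) tendsto_natCast_atTop_atTop
  have l2 : Tendsto (fun n : ℕ => 16 * C / (1 + (n : ℝ) ^ 2)) atTop (𝓝 0) := by
    refine tendsto_const_nhds.div_atTop ?_
    exact tendsto_atTop_add_const_left _ _
      ((tendsto_pow_atTop two_ne_zero).comp tendsto_natCast_atTop_atTop)
  have l3 : Tendsto (fun n : ℕ => ∫ u in (-(n : ℝ))..n, H' u) atTop (𝓝 0) := by
    refine squeeze_zero_norm (fun n => ?_) l2
    rw [key, Real.norm_eq_abs]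
    have a1 := hHb n
    have a2 := hHb (-n)
    rw [neg_sq] at a2
    calc _ ≤ |H n| + |H (-n)| := abs_sub _ _
      _ ≤ 8 * C / (1 + (n : ℝ) ^ 2) + 8 * C / (1 + (n : ℝ) ^ 2) := add_le_add a1 a2
      _ = _ := by ring
  have e := tendsto_nhds_unique l1 l3
  have e2 : ∫ u, (F' u - u * F u) ∂(gaussianReal 0 1) = 0 := by
    rw [integral_gaussianReal_eq_integral_smul one_ne_zero]
    simpa [H'] using e
  rw [integral_sub i1 i2] at e2
  linarith

/-- Exponential moments of `(θ + z) ^ 2 - 1`. -/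
theorem lintegral_exp_sq_le {s θ : ℝ} (hs : |s| ≤ 1 / 4) :
    ∫⁻ z, ENNReal.ofReal (Real.exp (s * ((θ + z) ^ 2 - 1))) ∂(gaussianReal 0 1) ≤
      ENNReal.ofReal (Real.exp (2 * s ^ 2 + s * θ ^ 2 / (1 - 2 * s))) := by
  obtain ⟨hs1, hs2⟩ := abs_le.1 hs
  set w := 1 - 2 * s with hw
  have hw0 : 0 < w := by rw [hw]; linarith
  -- Completing the square turns the integrand into a Gaussian of mean `m` and variance `1 / w`.
  set m := 2 * s * θ / w with hm
  have e1 : ∀ z, gaussianPDFReal 0 1 z * Real.exp (s * ((θ + z) ^ 2 - 1)) =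
      ((Real.sqrt (2 * Real.pi))⁻¹ * Real.exp (s * θ ^ 2 / w - s)) *
        Real.exp (-(w / 2) * (z - m) ^ 2) := fun z => by
    rw [gaussianPDFReal_std, mul_assoc, mul_assoc, ← Real.exp_add, ← Real.exp_add]
    congr 2
    rw [hm]
    field_simp
    rw [hw]; ring
  have iG : Integrable (fun z : ℝ => Real.exp (-(w / 2) * (z - m) ^ 2)) :=
    (integrable_exp_neg_mul_sq (half_pos hw0)).comp_sub_right m
  have e2 : ∫ z : ℝ, Real.exp (-(w / 2) * (z - m) ^ 2) = Real.sqrt (Real.pi / (w / 2)) := by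
    rw [integral_sub_right_eq_self (fun z : ℝ => Real.exp (-(w / 2) * z ^ 2)) m, integral_gaussian]
  rw [gaussianReal_of_var_ne_zero 0 one_ne_zero,
    lintegral_withDensity_eq_lintegral_mul _ (measurable_gaussianPDF 0 1) (by fun_prop)]
  have e3 : ∀ z, (gaussianPDF 0 1 * fun z => ENNReal.ofReal (Real.exp (s * ((θ + z) ^ 2 - 1)))) z =
      ENNReal.ofReal (((Real.sqrt (2 * Real.pi))⁻¹ * Real.exp (s * θ ^ 2 / w - s)) *
        Real.exp (-(w / 2) * (z - m) ^ 2)) := fun z => by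
    rw [← e1, Pi.mul_apply, gaussianPDF, ENNReal.ofReal_mul (gaussianPDFReal_nonneg _ _ _)]
  simp_rw [e3]
  rw [← ofReal_integral_eq_lintegral_ofReal (iG.const_mul _) (ae_of_all _ fun z => by positivity),
    integral_const_mul, e2]
  refine ENNReal.ofReal_le_ofReal ?_
  have e4 : (Real.sqrt (2 * Real.pi))⁻¹ * Real.sqrt (Real.pi / (w / 2)) = Real.sqrt w⁻¹ := by
    rw [← Real.sqrt_inv, ← Real.sqrt_mul (by positivity)]
    congr 1
    field_simp
  have e5 : Real.sqrt w⁻¹ ≤ Real.exp (s + 2 * s ^ 2) := by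
    rw [Real.sqrt_le_left (Real.exp_pos _).le, ← Real.exp_nat_mul]
    rw [inv_le_iff_one_le_mul₀ hw0]
    set v := ((2 : ℕ) : ℝ) * (s + 2 * s ^ 2) with hv
    have hv' : v = 2 * s + (2 * s) ^ 2 := by rw [hv]; push_cast; ring
    have hs3 : (1 + 2 * s) ^ 2 ≥ 0 := sq_nonneg _
    -- The claim is `1 ≤ (1 - y) exp (y + y²)` with `y = 2s`. For `y ≤ 0` the linear bound on `exp`
    -- suffices, as `(1 - y)(1 + y + y²) = 1 - y³`; for `y ≥ 0` the quadratic term is needed.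
    rcases le_total 0 s with h0 | h0
    · have := Real.quadratic_le_exp_of_nonneg (x := v) (by rw [hv']; positivity)
      have h7 : 0 ≤ (1 - 2 * s) * (1 + 2 * s) ^ 2 / 2 - 2 * s := by nlinarith [mul_nonneg h0 h0]
      calc (1 : ℝ) ≤ 1 + (2 * s) ^ 2 * ((1 - 2 * s) * (1 + 2 * s) ^ 2 / 2 - 2 * s) := by
            nlinarith [mul_nonneg (sq_nonneg (2 * s)) h7]
        _ = (1 + v + v ^ 2 / 2) * w := by rw [hv', hw]; ring
        _ ≤ _ := by gcongr
    · have := Real.add_one_le_exp v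
      calc (1 : ℝ) ≤ 1 - (2 * s) ^ 3 := by
            have : s ^ 3 ≤ 0 := by nlinarith [mul_nonneg_of_nonpos_of_nonpos h0 h0]
            nlinarith
        _ = (v + 1) * w := by rw [hv', hw]; ring
        _ ≤ _ := by gcongr
  calc _ = Real.exp (s * θ ^ 2 / w - s) * ((Real.sqrt (2 * Real.pi))⁻¹ * Real.sqrt (Real.pi / (w / 2))) := by ring
    _ ≤ Real.exp (s * θ ^ 2 / w - s) * Real.exp (s + 2 * s ^ 2) := by rw [e4]; gcongr
    _ = _ := by rw [← Real.exp_add]; congr 1; ring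

theorem integrable_sq_gaussian : Integrable (fun z : ℝ => z ^ 2) (gaussianReal 0 1) :=
  integrable_gaussian_of_growth (by fun_prop) (C := 1) fun u => by
    rw [abs_of_nonneg (sq_nonneg u)]; nlinarith [sq_nonneg (u ^ 2 - 1)]

theorem integral_sq_gaussian : ∫ z : ℝ, z ^ 2 ∂(gaussianReal 0 1) = 1 := by
  obtain ⟨-, -, h⟩ := gaussian_stein (F := fun u => u) (F' := fun _ => 1) (s := ∅) (C := 1)
    (by simp) continuous_id measurable_const (fun u _ => hasDerivAt_id u)
    (fun u => by rw [one_mul, ← sq_abs u]; nlinarith [sq_nonneg (|u| - 1), abs_nonneg u])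
    (fun u => by rw [abs_one]; nlinarith [sq_nonneg u])
  simp only [integral_const, probReal_univ, smul_eq_mul, mul_one] at h
  rw [h]
  simp_rw [pow_two]

theorem integral_exp_gaussian (k : ℝ) :
    ∫ z, Real.exp (k * z) ∂(gaussianReal 0 1) = Real.exp (k ^ 2 / 2) := by
  have := congrFun (mgf_fun_id_gaussianReal (μ := 0) (v := 1)) k
  simpa [mgf] using this

theorem integrable_posPart_sq (b : ℝ) :
    Integrable (fun z : ℝ => max (z - b) 0 ^ 2) (gaussianReal 0 1) := by
  refine integrable_gaussian_of_growth (by fun_prop) (C := 2 * (1 + b ^ 2)) fun u => ?_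
  have : max (u - b) 0 ^ 2 ≤ (u - b) ^ 2 := by
    rcases max_cases (u - b) 0 with h | h <;> rw [h.1]
    nlinarith [sq_nonneg (u - b)]
  rw [abs_of_nonneg (sq_nonneg _)]
  nlinarith [sq_nonneg (u + b), sq_nonneg (u ^ 2 - 1), sq_nonneg (b * u ^ 2), sq_nonneg (u ^ 2)]

theorem integrable_posPart (b : ℝ) :
    Integrable (fun z : ℝ => max (z - b) 0) (gaussianReal 0 1) := by
  refine ((integrable_posPart_sq b).add (integrable_const 1)).mono' (by fun_prop)
    (ae_of_all _ fun u => ?_)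
  rw [Real.norm_eq_abs, Pi.add_apply, abs_of_nonneg (le_max_right _ _)]
  nlinarith [sq_nonneg (max (u - b) 0 - 1)]

/-- Chernoff bound from `x² / 2 ≤ exp x` at `x = k (z - b)`; the rate `k` stays free for the
applications. -/
theorem integral_posPart_sq_le (b : ℝ) {k : ℝ} (hk : 0 < k) :
    ∫ z, max (z - b) 0 ^ 2 ∂(gaussianReal 0 1) ≤ 2 / k ^ 2 * Real.exp (k ^ 2 / 2 - k * b) := by
  have h : ∀ z, max (z - b) 0 ^ 2 ≤ 2 / k ^ 2 * Real.exp (-(k * b)) * Real.exp (k * z) := by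
    intro z
    rw [mul_assoc, ← Real.exp_add, div_mul_eq_mul_div, le_div_iff₀ (by positivity)]
    rcases le_total (z - b) 0 with h | h
    · rw [max_eq_right h, zero_pow two_ne_zero, zero_mul]; positivity
    · rw [max_eq_left h]
      have := Real.quadratic_le_exp_of_nonneg (x := -(k * b) + k * z) (by nlinarith)
      nlinarith
  calc _ ≤ ∫ z, 2 / k ^ 2 * Real.exp (-(k * b)) * Real.exp (k * z) ∂(gaussianReal 0 1) :=
        integral_mono (integrable_posPart_sq b) ((integrable_exp_mul_gaussianReal k).const_mul _) h
    _ = _ := by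
        rw [integral_const_mul, integral_exp_gaussian, mul_assoc, ← Real.exp_add]
        congr 2; ring

theorem integral_posPart_le (b : ℝ) {k : ℝ} (hk : 0 < k) :
    ∫ z, max (z - b) 0 ∂(gaussianReal 0 1) ≤ 1 / k * Real.exp (k ^ 2 / 2 - k * b) := by
  have h : ∀ z, max (z - b) 0 ≤ 1 / k * Real.exp (-(k * b)) * Real.exp (k * z) := by
    intro z
    rw [mul_assoc, ← Real.exp_add, div_mul_eq_mul_div, one_mul, le_div_iff₀ hk]
    rcases le_total (z - b) 0 with h | h
    · rw [max_eq_right h, zero_mul]; positivity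
    · rw [max_eq_left h]
      have := Real.add_one_le_exp (-(k * b) + k * z)
      nlinarith
  calc _ ≤ ∫ z, 1 / k * Real.exp (-(k * b)) * Real.exp (k * z) ∂(gaussianReal 0 1) :=
        integral_mono (integrable_posPart b) ((integrable_exp_mul_gaussianReal k).const_mul _) h
    _ = _ := by
        rw [integral_const_mul, integral_exp_gaussian, mul_assoc, ← Real.exp_add]
        congr 2; ring

/-- The Stein identity for the function `(z - b)₊ ^ 2`. -/
theorem integral_posPart_stein (b : ℝ) :
    Integrable (fun z : ℝ => 2 * max (z - b) 0 - z * max (z - b) 0 ^ 2) (gaussianReal 0 1) ∧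
    ∫ z, (2 * max (z - b) 0 - z * max (z - b) 0 ^ 2) ∂(gaussianReal 0 1) = 0 := by
  obtain ⟨h1, h2, h3⟩ := gaussian_stein (F := fun z => max (z - b) 0 ^ 2)
    (F' := fun z => 2 * max (z - b) 0) (s := {b}) (C := 2 * (1 + b ^ 2))
    (Set.countable_singleton b) (by fun_prop) (by fun_prop)
    (fun u hu => by
      rcases lt_or_gt_of_ne (show u ≠ b from hu) with h | h
      · have e : (fun z => max (z - b) 0 ^ 2) =ᶠ[nhds u] fun _ => (0 : ℝ) := by
          filter_upwards [gt_mem_nhds h] with z hz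
          rw [max_eq_right (by linarith)]; simp
        rw [max_eq_right (by linarith), mul_zero]
        exact (hasDerivAt_const u (0 : ℝ)).congr_of_eventuallyEq e
      · have e : (fun z => max (z - b) 0 ^ 2) =ᶠ[nhds u] fun z => (z - b) ^ 2 := by
          filter_upwards [lt_mem_nhds h] with z hz
          rw [max_eq_left (by linarith)]
        rw [max_eq_left (by linarith)]
        refine HasDerivAt.congr_of_eventuallyEq ?_ e
        simpa using ((hasDerivAt_id u).sub_const b).fun_pow 2)
    (fun u => by
      have : max (u - b) 0 ^ 2 ≤ (u - b) ^ 2 := by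
        rcases max_cases (u - b) 0 with h | h <;> rw [h.1]
        nlinarith [sq_nonneg (u - b)]
      rw [abs_of_nonneg (sq_nonneg _)]
      nlinarith [sq_nonneg (u + b), sq_nonneg (b * u)])
    (fun u => by
      have : max (u - b) 0 ≤ |u - b| := max_le (le_abs_self _) (abs_nonneg _)
      rw [abs_of_nonneg (by positivity)]
      have h2 := sq_abs (u - b)
      nlinarith [sq_nonneg (u + b), sq_nonneg (b * u), sq_nonneg (|u - b| - 1), sq_nonneg b])
  refine ⟨h1.sub h2, ?_⟩
  rw [integral_sub h1 h2, h3, sub_self]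

/-! ### Risk of the one-dimensional garrote -/

/-- The nonnegative garrote with threshold `lam` in one dimension. -/
noncomputable def garrote1 (lam x : ℝ) : ℝ := max (1 - lam / x ^ 2) 0 * x

theorem measurable_garrote1 (lam : ℝ) : Measurable (garrote1 lam) := by
  unfold garrote1; fun_prop

theorem aestronglyMeasurable_garrote1_loss (lam θ : ℝ) :
    AEStronglyMeasurable (fun z => (garrote1 lam (θ + z) - θ) ^ 2) (gaussianReal 0 1) :=
  ((((measurable_garrote1 lam).comp (measurable_const_add θ)).sub_const θ).pow_const
    2).aestronglyMeasurable

theorem garrote1_neg (lam x : ℝ) : garrote1 lam (-x) = -garrote1 lam x := by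
  simp [garrote1]

theorem garrote1_of_abs_le {s x : ℝ} (h : |x| ≤ s) : garrote1 (s ^ 2) x = 0 := by
  rcases eq_or_ne x 0 with rfl | hx
  · simp [garrote1]
  · have hx2 : 0 < x ^ 2 := by positivity
    have : x ^ 2 ≤ s ^ 2 := by rw [← sq_abs x]; gcongr
    rw [garrote1, max_eq_right, zero_mul]
    rw [sub_nonpos, one_le_div hx2]; exact this

/-- The value is `(x - s)(x + s) / x`, whose second factor over `x` lies between 1 and 2. -/
theorem garrote1_of_lt {s x : ℝ} (hs : 0 ≤ s) (h : s < x) :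
    garrote1 (s ^ 2) x = x - s ^ 2 / x ∧ x - s ≤ garrote1 (s ^ 2) x ∧
      garrote1 (s ^ 2) x ≤ 2 * (x - s) := by
  have hx : 0 < x := hs.trans_lt h
  have e : garrote1 (s ^ 2) x = x - s ^ 2 / x := by
    rw [garrote1, max_eq_left]
    · field_simp
    · rw [sub_nonneg, div_le_one (by positivity)]; gcongr
  rw [e]
  have hq : s ^ 2 / x * x = s ^ 2 := by field_simp
  refine ⟨rfl, ?_, ?_⟩
  · have : s ^ 2 / x ≤ s := by rw [div_le_iff₀ hx]; nlinarith
    linarith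
  · nlinarith [sq_nonneg (x - s)]

theorem abs_garrote1_sub_le {s : ℝ} (hs : 0 ≤ s) (x : ℝ) : |garrote1 (s ^ 2) x - x| ≤ s := by
  have pos : ∀ x, s < x → |garrote1 (s ^ 2) x - x| ≤ s := fun x h => by
    obtain ⟨e, h1, -⟩ := garrote1_of_lt hs h
    rw [abs_le]
    constructor
    · linarith
    · rw [e]; have : 0 ≤ s ^ 2 / x := div_nonneg (sq_nonneg s) (hs.trans h.le); linarith
  rcases le_or_gt |x| s with h | h
  · rw [garrote1_of_abs_le h, zero_sub, abs_neg]; exact h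
  · rcases lt_abs.1 h with h | h
    · exact pos x h
    · have := pos (-x) h
      rw [garrote1_neg, ← abs_neg] at this
      simpa [add_comm, sub_eq_add_neg] using this

theorem sq_garrote1_le {s : ℝ} (hs : 0 ≤ s) (x : ℝ) :
    garrote1 (s ^ 2) x ^ 2 ≤ 4 * (max (x - s) 0 ^ 2 + max (-x - s) 0 ^ 2) := by
  rcases le_or_gt |x| s with h | h
  · rw [garrote1_of_abs_le h, zero_pow two_ne_zero]; positivity
  · rcases lt_abs.1 h with h | h
    · obtain ⟨-, h1, h2⟩ := garrote1_of_lt hs h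
      rw [max_eq_left (by linarith)]
      nlinarith [sq_nonneg (max (-x - s) 0)]
    · obtain ⟨-, h1, h2⟩ := garrote1_of_lt hs h
      rw [garrote1_neg] at h1 h2
      rw [max_eq_left (a := -x - s) (by linarith)]
      nlinarith [sq_nonneg (max (x - s) 0)]

/-- The quadratic risk of the one-dimensional garrote. -/
noncomputable def garroteRisk (lam θ : ℝ) : ℝ :=
  ∫ z, (garrote1 lam (θ + z) - θ) ^ 2 ∂(gaussianReal 0 1)

theorem garrote1_loss_le {s : ℝ} (hs : 0 ≤ s) (θ z : ℝ) :
    (garrote1 (s ^ 2) (θ + z) - θ) ^ 2 ≤ z ^ 2 + s * (1 + z ^ 2) + s ^ 2 := by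
  have h := abs_garrote1_sub_le hs (θ + z)
  have h2 : |garrote1 (s ^ 2) (θ + z) - θ| ≤ s + |z| := by
    have := abs_add_le (garrote1 (s ^ 2) (θ + z) - (θ + z)) z
    rw [show garrote1 (s ^ 2) (θ + z) - (θ + z) + z = garrote1 (s ^ 2) (θ + z) - θ by ring] at this
    linarith
  rw [← sq_abs, ← sq_abs z]
  calc _ ≤ (s + |z|) ^ 2 := by gcongr
    _ ≤ _ := by nlinarith [mul_nonneg hs (sq_nonneg (|z| - 1))]

theorem integrable_garrote1_loss {s : ℝ} (hs : 0 ≤ s) (θ : ℝ) :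
    Integrable (fun z => (garrote1 (s ^ 2) (θ + z) - θ) ^ 2) (gaussianReal 0 1) := by
  have i : Integrable (fun z : ℝ => (1 + s) * z ^ 2 + (s + s ^ 2)) (gaussianReal 0 1) :=
    (integrable_sq_gaussian.const_mul (1 + s)).add (integrable_const _)
  refine i.mono' (aestronglyMeasurable_garrote1_loss _ _) (ae_of_all _ fun z => ?_)
  rw [Real.norm_eq_abs, abs_of_nonneg (sq_nonneg _)]
  linarith [garrote1_loss_le hs θ z]

theorem garroteRisk_le {s : ℝ} (hs : 0 ≤ s) (θ : ℝ) : garroteRisk (s ^ 2) θ ≤ (1 + s) ^ 2 := by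
  have i : Integrable (fun z : ℝ => (1 + s) * z ^ 2 + (s + s ^ 2)) (gaussianReal 0 1) :=
    (integrable_sq_gaussian.const_mul (1 + s)).add (integrable_const _)
  refine (integral_mono (integrable_garrote1_loss hs θ) i fun z => ?_).trans_eq ?_
  · linarith [garrote1_loss_le hs θ z]
  · rw [integral_add (integrable_sq_gaussian.const_mul (1 + s)) (integrable_const _),
      integral_const_mul, integral_sq_gaussian]
    simp
    ring

theorem integral_comp_neg_gaussian (f : ℝ → ℝ) :
    ∫ z, f (-z) ∂(gaussianReal 0 1) = ∫ z, f z ∂(gaussianReal 0 1) := by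
  have h : (gaussianReal 0 1).map (fun x : ℝ => -x) = gaussianReal 0 1 := by
    rw [gaussianReal_map_neg, neg_zero]
  have := (MeasurableEquiv.neg ℝ).measurableEmbedding.integral_map (μ := gaussianReal 0 1) f
  change ∫ y, f y ∂((gaussianReal 0 1).map (fun x : ℝ => -x)) = ∫ z, f (-z) ∂_ at this
  rw [← this, h]

theorem integrable_comp_neg_gaussian {f : ℝ → ℝ} (hf : Integrable f (gaussianReal 0 1)) :
    Integrable (fun z => f (-z)) (gaussianReal 0 1) := by
  have h : (gaussianReal 0 1).map (fun x : ℝ => -x) = gaussianReal 0 1 := by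
    rw [gaussianReal_map_neg, neg_zero]
  rw [← h] at hf
  exact hf.comp_measurable (by fun_prop)

theorem garroteRisk_neg (lam θ : ℝ) : garroteRisk lam (-θ) = garroteRisk lam θ := by
  rw [garroteRisk, ← integral_comp_neg_gaussian, garroteRisk]
  congr 1; ext z
  rw [show -θ + -z = -(θ + z) by ring, garrote1_neg]; ring

/-- The estimate vanishes unless `|θ + z| > s`, and its excess over `s` is at most `|θ|` plus the
excess of `|z|`. Moving the shift outside the tail gives the crude factor 18 but a remainder free of
`θ`. -/
theorem garroteRisk_le_sq_add {s : ℝ} (hs : 0 ≤ s) (θ : ℝ) :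
    garroteRisk (s ^ 2) θ ≤ 18 * θ ^ 2 + 128 * Real.exp (-s ^ 2 / 2) := by
  have i1 := (integrable_posPart_sq s).const_mul 16
  have i2 := (integrable_comp_neg_gaussian (integrable_posPart_sq s)).const_mul 16
  have i3 : Integrable (fun _ : ℝ => 18 * θ ^ 2) (gaussianReal 0 1) := integrable_const _
  have hp : ∀ z, (garrote1 (s ^ 2) (θ + z) - θ) ^ 2 ≤
      18 * θ ^ 2 + 16 * max (z - s) 0 ^ 2 + 16 * max (-z - s) 0 ^ 2 := fun z => by
    have h1 := sq_garrote1_le hs (θ + z)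
    have hm : ∀ y : ℝ, |y| = |θ| → max (y + (|z| - s)) 0 ^ 2 ≤
        2 * θ ^ 2 + 2 * (max (|z| - s) 0) ^ 2 := fun y hy => by
      have : max (y + (|z| - s)) 0 ≤ |θ| + max (|z| - s) 0 :=
        max_le (add_le_add (hy ▸ le_abs_self y) (le_max_left _ _)) (by positivity)
      have h3 : 0 ≤ max (y + (|z| - s)) 0 := le_max_right _ _
      rw [← sq_abs θ]
      nlinarith [sq_nonneg (|θ| - max (|z| - s) 0)]
    have hsplit : max (θ + z - s) 0 ^ 2 + max (-(θ + z) - s) 0 ^ 2 ≤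
        2 * θ ^ 2 + 2 * (max (|z| - s) 0) ^ 2 := by
      rcases le_or_gt 0 (θ + z) with h | h
      · rw [max_eq_right (a := -(θ + z) - s) (by linarith)]
        have : max (θ + z - s) 0 ≤ max (θ + (|z| - s)) 0 :=
          max_le_max (by linarith [le_abs_self z]) le_rfl
        have h0 : 0 ≤ max (θ + z - s) 0 := le_max_right _ _
        have := hm θ rfl
        nlinarith
      · rw [max_eq_right (a := θ + z - s) (by linarith)]
        have : max (-(θ + z) - s) 0 ≤ max (-θ + (|z| - s)) 0 :=
          max_le_max (by linarith [neg_le_abs z]) le_rfl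
        have h0 : 0 ≤ max (-(θ + z) - s) 0 := le_max_right _ _
        have := hm (-θ) (abs_neg θ)
        nlinarith
    have hz : (max (|z| - s) 0) ^ 2 ≤ max (z - s) 0 ^ 2 + max (-z - s) 0 ^ 2 := by
      rcases abs_cases z with h | h <;> rw [h.1]
      · nlinarith [sq_nonneg (max (-z - s) 0)]
      · nlinarith [sq_nonneg (max (z - s) 0)]
    nlinarith [sq_nonneg (garrote1 (s ^ 2) (θ + z) + θ)]
  have hc : ∫ z, max (z - s) 0 ^ 2 ∂(gaussianReal 0 1) ≤ 4 * Real.exp (-s ^ 2 / 2) := by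
    -- The rate `s + 1` instead of `s` costs only `exp (1/2)` and keeps `2 / k²` bounded down to `s
    -- = 0`.
    refine (integral_posPart_sq_le s (k := s + 1) (by linarith)).trans ?_
    have e1 : (s + 1) ^ 2 / 2 - (s + 1) * s = 1 / 2 + -s ^ 2 / 2 := by ring
    rw [e1, Real.exp_add, ← mul_assoc]
    have h1 : 2 / (s + 1) ^ 2 ≤ 2 := div_le_self (by norm_num) (by nlinarith)
    have h2 : Real.exp (1 / 2) ≤ 2 := by
      have := Real.exp_bound_div_one_sub_of_interval (x := 1 / 2) (by norm_num) (by norm_num)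
      norm_num at this; linarith
    gcongr
    calc _ ≤ (2 : ℝ) * 2 := mul_le_mul h1 h2 (Real.exp_pos _).le (by norm_num)
      _ = 4 := by norm_num
  have i31 : Integrable (fun z : ℝ => 18 * θ ^ 2 + 16 * max (z - s) 0 ^ 2) (gaussianReal 0 1) :=
    i3.add i1
  calc garroteRisk (s ^ 2) θ
      ≤ ∫ z, (18 * θ ^ 2 + 16 * max (z - s) 0 ^ 2 + 16 * max (-z - s) 0 ^ 2)
        ∂(gaussianReal 0 1) :=
        integral_mono (integrable_garrote1_loss hs θ) (i31.add i2) hp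
    _ = 18 * θ ^ 2 + 16 * ∫ z, max (z - s) 0 ^ 2 ∂(gaussianReal 0 1) +
        16 * ∫ z, max (z - s) 0 ^ 2 ∂(gaussianReal 0 1) := by
        rw [integral_add i31 i2, integral_add i3 i1,
          integral_comp_neg_gaussian (fun z => 16 * max (z - s) 0 ^ 2), integral_const_mul 16]
        simp
    _ ≤ _ := by linarith

/-- Expand `(g - θ)² = θ² + g² - 2θg`, with `|g|` between the excess and twice the excess over the
threshold. Exceeding on the side of `θ` gains `-2θg`; only the opposite tail has a harmful cross
term. -/
theorem garrote1_loss_sub_le {s θ : ℝ} (hs : 0 ≤ s) (hθ : 0 ≤ θ) (z : ℝ) :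
    (garrote1 (s ^ 2) (θ + z) - θ) ^ 2 ≤ θ ^ 2 +
      (4 * max (z - (s - θ)) 0 ^ 2 - 2 * θ * max (z - (s - θ)) 0) +
      (4 * max (-z - (s + θ)) 0 ^ 2 + 4 * θ * max (-z - (s + θ)) 0) := by
  rcases le_or_gt |θ + z| s with h | h
  · obtain ⟨h1, h2⟩ := abs_le.1 h
    rw [garrote1_of_abs_le h, max_eq_right (by linarith), max_eq_right (by linarith)]
    simp
  · rcases lt_abs.1 h with h | h
    · obtain ⟨-, h1, h2⟩ := garrote1_of_lt hs h
      rw [max_eq_left (by linarith), max_eq_right (by linarith)]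
      nlinarith
    · obtain ⟨-, h1, h2⟩ := garrote1_of_lt hs h
      rw [garrote1_neg] at h1 h2
      rw [max_eq_right (by linarith), max_eq_left (by linarith)]
      nlinarith

/-- Adding `K` times the mean-zero Stein function of `integral_posPart_stein` does not change the
integral. With `t = z - (s - θ)`, it then suffices that the corrected integrand is pointwise
nonpositive for `t ≥ 0`. -/
theorem right_part_nonpos {s θ K : ℝ}
    (h : ∀ t, 0 ≤ t → 4 * t ^ 2 - 2 * θ * t + K * (2 * t - (s - θ + t) * t ^ 2) ≤ 0) :
    ∫ z, (4 * max (z - (s - θ)) 0 ^ 2 - 2 * θ * max (z - (s - θ)) 0) ∂(gaussianReal 0 1) ≤ 0 := by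
  obtain ⟨i1, h1⟩ := integral_posPart_stein (s - θ)
  have i2 : Integrable (fun z => 4 * max (z - (s - θ)) 0 ^ 2 - 2 * θ * max (z - (s - θ)) 0)
      (gaussianReal 0 1) :=
    ((integrable_posPart_sq _).const_mul 4).sub ((integrable_posPart _).const_mul (2 * θ))
  have e : ∫ z, (4 * max (z - (s - θ)) 0 ^ 2 - 2 * θ * max (z - (s - θ)) 0) ∂(gaussianReal 0 1) =
      ∫ z, (4 * max (z - (s - θ)) 0 ^ 2 - 2 * θ * max (z - (s - θ)) 0 +
        K * (2 * max (z - (s - θ)) 0 - z * max (z - (s - θ)) 0 ^ 2)) ∂(gaussianReal 0 1) := by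
    rw [integral_add i2 (i1.const_mul K), integral_const_mul, h1, mul_zero, add_zero]
  rw [e]
  refine integral_nonpos fun z => ?_
  rcases le_total (z - (s - θ)) 0 with hz | hz
  · simp [max_eq_right hz]
  · have := h _ hz
    simp only [max_eq_left hz, Pi.zero_apply]
    rw [show s - θ + (z - (s - θ)) = z by ring] at this
    exact this

/-- The coefficient of `θ²` must be exactly one for part (c). For `θ ≥ s + 1` the uniform bound `(1
+ s)²` is enough; otherwise the tail on the side of `θ` is compensated by its cross term unless `sθ`
is bounded, when the tail itself is small. -/
theorem garroteRisk_le_sharp {s : ℝ} (hs : 6 ≤ s) (θ : ℝ) :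
    garroteRisk (s ^ 2) θ ≤ θ ^ 2 + 100000 * Real.exp (-s ^ 2 / 2) / s := by
  wlog hθ : 0 ≤ θ generalizing θ
  · have := this (-θ) (by linarith)
    rwa [garroteRisk_neg, neg_sq] at this
  have hs0 : 0 < s := by linarith
  rcases le_or_gt (s + 1) θ with h1 | h1
  · have := garroteRisk_le hs0.le θ
    have h2 : 0 ≤ 100000 * Real.exp (-s ^ 2 / 2) / s := by positivity
    nlinarith
  have iR : Integrable (fun z => 4 * max (z - (s - θ)) 0 ^ 2 - 2 * θ * max (z - (s - θ)) 0)
      (gaussianReal 0 1) :=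
    ((integrable_posPart_sq _).const_mul 4).sub ((integrable_posPart _).const_mul (2 * θ))
  have iL : Integrable (fun z => 4 * max (z - (s + θ)) 0 ^ 2 + 4 * θ * max (z - (s + θ)) 0)
      (gaussianReal 0 1) :=
    ((integrable_posPart_sq _).const_mul 4).add ((integrable_posPart _).const_mul (4 * θ))
  have iR' : Integrable (fun z => θ ^ 2 +
      (4 * max (z - (s - θ)) 0 ^ 2 - 2 * θ * max (z - (s - θ)) 0)) (gaussianReal 0 1) :=
    (integrable_const _).add iR
  have main : garroteRisk (s ^ 2) θ ≤ θ ^ 2 +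
      ∫ z, (4 * max (z - (s - θ)) 0 ^ 2 - 2 * θ * max (z - (s - θ)) 0) ∂(gaussianReal 0 1) +
      ∫ z, (4 * max (z - (s + θ)) 0 ^ 2 + 4 * θ * max (z - (s + θ)) 0) ∂(gaussianReal 0 1) := by
    rw [← integral_comp_neg_gaussian
      (fun z => 4 * max (z - (s + θ)) 0 ^ 2 + 4 * θ * max (z - (s + θ)) 0)]
    refine (integral_mono (integrable_garrote1_loss hs0.le θ)
      (iR'.add (integrable_comp_neg_gaussian iL))
      (garrote1_loss_sub_le hs0.le hθ)).trans_eq ?_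
    simp only [Pi.add_apply]
    rw [integral_add iR' (integrable_comp_neg_gaussian iL), integral_add (integrable_const _) iR]
    simp
  set E := Real.exp (-s ^ 2 / 2) with hE
  have hE0 : 0 < E := Real.exp_pos _
  have hL : ∫ z, (4 * max (z - (s + θ)) 0 ^ 2 + 4 * θ * max (z - (s + θ)) 0) ∂(gaussianReal 0 1)
      ≤ 12 * E / s := by
    rw [integral_add ((integrable_posPart_sq _).const_mul 4)
      ((integrable_posPart _).const_mul (4 * θ)), integral_const_mul, integral_const_mul]
    have a1 := integral_posPart_sq_le (s + θ) (k := s + θ) (by linarith)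
    have a2 := integral_posPart_le (s + θ) (k := s + θ) (by linarith)
    have e1 : Real.exp ((s + θ) ^ 2 / 2 - (s + θ) * (s + θ)) ≤ E * Real.exp (-(s * θ)) := by
      rw [hE, ← Real.exp_add]; exact Real.exp_le_exp.2 (by nlinarith [sq_nonneg θ])
    have e2 : Real.exp (-(s * θ)) ≤ 1 := Real.exp_le_one_iff.2 (by nlinarith)
    have e3 : θ * Real.exp (-(s * θ)) ≤ 1 / s := by
      rw [le_div_iff₀ hs0]
      have := Real.add_one_le_exp (s * θ)
      have h3 : Real.exp (s * θ) * Real.exp (-(s * θ)) = 1 := by rw [← Real.exp_add]; simp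
      nlinarith [Real.exp_pos (-(s * θ))]
    have b1 : 2 / (s + θ) ^ 2 ≤ 2 / s := by
      apply div_le_div_of_nonneg_left (by norm_num) hs0; nlinarith
    have b2 : 1 / (s + θ) ≤ 1 := by rw [div_le_one (by linarith)]; linarith
    calc _ ≤ 4 * (2 / s * (E * 1)) + 4 * θ * (1 * (E * Real.exp (-(s * θ)))) := by
          refine add_le_add (mul_le_mul_of_nonneg_left (a1.trans ?_) (by norm_num))
            (mul_le_mul_of_nonneg_left (a2.trans ?_) (by linarith))
          · exact mul_le_mul b1 (e1.trans (by gcongr)) (Real.exp_pos _).le (by positivity)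
          · exact mul_le_mul b2 e1 (Real.exp_pos _).le zero_le_one
      _ = 8 * E / s + 4 * E * (θ * Real.exp (-(s * θ))) := by ring
      _ ≤ 8 * E / s + 4 * E * (1 / s) := by gcongr
      _ = _ := by ring
  have hR : ∫ z, (4 * max (z - (s - θ)) 0 ^ 2 - 2 * θ * max (z - (s - θ)) 0) ∂(gaussianReal 0 1)
      ≤ 90000 * E / s := by
    have h0 : 0 ≤ 90000 * E / s := by positivity
    rcases le_or_gt 3 θ with h3 | h3
    -- With `K = 1` the integrand is `-t` times a quadratic in `t`, nonnegative on `t ≥ 0` because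
    -- `3 ≤ θ < s + 1` and `s ≥ 6`.
    · refine (right_part_nonpos (K := 1) fun t ht => ?_).trans h0
      have : 0 ≤ t ^ 2 - (4 + (θ - s)) * t + (2 * θ - 2) := by
        nlinarith [sq_nonneg (2 * t - (4 + (θ - s)))]
      nlinarith
    rcases le_or_gt 4 ((s - θ) * θ) with h4 | h4
    -- With `K = θ` the linear terms cancel, leaving `(4 - θ(s - θ)) t² - θ t³`.
    · refine (right_part_nonpos (K := θ) fun t ht => ?_).trans h0
      nlinarith [mul_nonneg (sq_nonneg t) (sub_nonneg.2 h4), mul_nonneg hθ (pow_nonneg ht 3)]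
    -- Here `θ < 3 ≤ s / 2`, so `s - θ ≥ s / 2`; shifting the tail by `θ` costs at most `exp 8`.
    have h5 : s * θ ≤ 8 := by nlinarith
    have a1 := integral_posPart_sq_le (s - θ) (k := s - θ) (by linarith)
    have i1 : Integrable (fun z => 4 * max (z - (s - θ)) 0 ^ 2) (gaussianReal 0 1) :=
      (integrable_posPart_sq _).const_mul 4
    have e1 : Real.exp ((s - θ) ^ 2 / 2 - (s - θ) * (s - θ)) ≤ E * Real.exp 8 := by
      rw [hE, ← Real.exp_add]; exact Real.exp_le_exp.2 (by nlinarith [sq_nonneg θ])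
    have e8 : Real.exp 8 ≤ 6561 := by
      have := Real.exp_one_lt_d9
      calc Real.exp 8 = Real.exp 1 ^ 8 := by rw [← Real.exp_nat_mul]; norm_num
        _ ≤ 3 ^ 8 := by gcongr; linarith
        _ = _ := by norm_num
    have b1 : 2 / (s - θ) ^ 2 ≤ 2 / s := by
      apply div_le_div_of_nonneg_left (by norm_num) hs0; nlinarith
    calc _ ≤ ∫ z, 4 * max (z - (s - θ)) 0 ^ 2 ∂(gaussianReal 0 1) := by
          refine integral_mono iR i1 fun z => ?_
          have : 0 ≤ max (z - (s - θ)) 0 := le_max_right _ _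
          simp only
          nlinarith
      _ ≤ 4 * (2 / s * (E * 6561)) := by
          rw [integral_const_mul]
          refine mul_le_mul_of_nonneg_left (a1.trans ?_) (by norm_num)
          exact mul_le_mul b1 (e1.trans (by gcongr)) (Real.exp_pos _).le (by positivity)
      _ = 52488 * E / s := by ring
      _ ≤ _ := by gcongr; norm_num
  have : 90000 * E / s + 12 * E / s ≤ 100000 * E / s := by
    rw [← add_div]; gcongr; linarith
  linarith

/-! ### The noise vector: coordinates, conditioning, independence -/

/-- The law of the noise vector. -/
noncomputable abbrev noise (d : ℕ) : Measure (Fin d → ℝ) :=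
  Measure.pi fun _ : Fin d => gaussianReal 0 1

theorem integrable_comp_apply_noise {d : ℕ} (i : Fin d) {f : ℝ → ℝ}
    (hf : Integrable f (gaussianReal 0 1)) : Integrable (fun z => f (z i)) (noise d) :=
  (measurePreserving_eval (fun _ : Fin d => gaussianReal 0 1) i).integrable_comp_of_integrable hf

theorem integral_comp_apply_noise {d : ℕ} (i : Fin d) {f : ℝ → ℝ}
    (hf : AEStronglyMeasurable f (gaussianReal 0 1)) :
    ∫ z, f (z i) ∂(noise d) = ∫ u, f u ∂(gaussianReal 0 1) :=
  integral_comp_eval (μ := fun _ : Fin d => gaussianReal 0 1) (i := i) hf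

theorem lintegral_comp_apply_noise {d : ℕ} (i : Fin d) {f : ℝ → ℝ≥0∞} (hf : Measurable f) :
    ∫⁻ z, f (z i) ∂(noise d) = ∫⁻ u, f u ∂(gaussianReal 0 1) :=
  (measurePreserving_eval (fun _ : Fin d => gaussianReal 0 1) i).lintegral_comp hf

/-- A function whose conditional means given all coordinates but one vanish has mean zero. -/
theorem integral_noise_eq_zero {d : ℕ} (i : Fin d) {f : (Fin d → ℝ) → ℝ}
    (hf : Integrable f (noise d))
    (h : ∀ z, ∫ u, f (Function.update z i u) ∂(gaussianReal 0 1) = 0) :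
    ∫ z, f z ∂(noise d) = 0 := by
  obtain ⟨n, rfl⟩ : ∃ n, d = n + 1 := ⟨d - 1, by have := i.2; omega⟩
  have mp := (measurePreserving_piFinSuccAbove (fun _ : Fin (n + 1) => gaussianReal 0 1) i).symm
  rw [← mp.integral_comp' (g := f), integral_prod_symm]
  · refine integral_eq_zero_of_ae (ae_of_all _ fun y => ?_)
    have := h (i.insertNth 0 y)
    simpa [MeasurableEquiv.piFinSuccAbove, Fin.insertNthEquiv] using this
  · exact mp.integrable_comp_of_integrable hf

/-- Functions of disjoint sets of coordinates are independent. -/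
theorem indepFun_of_disjoint {d : ℕ} {S T : Finset (Fin d)} (hST : Disjoint S T)
    {f g : (Fin d → ℝ) → ℝ} (hf : Measurable f) (hg : Measurable g)
    (hfS : ∀ z w, (∀ i ∈ S, z i = w i) → f z = f w)
    (hgT : ∀ z w, (∀ i ∈ T, z i = w i) → g z = g w) : IndepFun f g (noise d) := by
  have hi : iIndepFun (fun (i : Fin d) (z : Fin d → ℝ) => z i) (noise d) :=
    iIndepFun_pi (X := fun _ => id) fun _ => aemeasurable_id
  have h := hi.indepFun_finset S T hST fun i => measurable_pi_apply i
  -- Extension by zero off `U` exhibits `f` and `g` as measurable functions of their own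
  -- coordinates.
  have hm : ∀ U : Finset (Fin d), Measurable fun (y : U → ℝ) (i : Fin d) =>
      if hU : i ∈ U then y ⟨i, hU⟩ else 0 := fun U => measurable_pi_lambda _ fun i => by
    by_cases hU : i ∈ U
    · simp only [hU, dite_true]; exact measurable_pi_apply _
    · simp only [hU, dite_false]; exact measurable_const
  have h2 := h.comp (hf.comp (hm S)) (hg.comp (hm T))
  convert h2 using 1
  · ext z; exact hfS _ _ fun _ hiS => by simp [hiS]
  · ext z; exact hgT _ _ fun _ hiT => by simp [hiT]

/-! ### Combinatorics of the blocks -/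

section blocks

variable {d L : ℕ}

theorem mem_block {b : ℕ} {i : Fin d} : i ∈ block d L b ↔ (i : ℕ) / L = b := by simp [block]

theorem block_disjoint {b b' : ℕ} (h : b ≠ b') : Disjoint (block d L b) (block d L b') :=
  Finset.disjoint_left.2 fun _ hi hi' => h ((mem_block.1 hi).symm.trans (mem_block.1 hi'))

theorem div_lt_numBlocks (hL : 1 ≤ L) (i : Fin d) : (i : ℕ) / L < numBlocks d L := by
  have hi := i.2
  rw [numBlocks, Nat.lt_div_iff_mul_lt (by omega)]
  have := Nat.div_mul_le_self (i : ℕ) L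
  omega

theorem sum_blocks {M : Type*} [AddCommMonoid M] (hL : 1 ≤ L) (f : Fin d → M) :
    ∑ b ∈ Finset.range (numBlocks d L), ∑ i ∈ block d L b, f i = ∑ i, f i :=
  Finset.sum_fiberwise_of_maps_to (fun i _ => Finset.mem_range.2 (div_lt_numBlocks hL i)) f

theorem card_block_le (hL : 1 ≤ L) (b : ℕ) : (block d L b).card ≤ L := by
  have h : ((block d L b).map Fin.valEmbedding) ⊆ Finset.Ico (b * L) (b * L + L) := by
    intro j hj
    obtain ⟨i, hi, rfl⟩ := Finset.mem_map.1 hj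
    rw [mem_block] at hi
    have h1 := Nat.div_add_mod (i : ℕ) L
    have h2 := Nat.mod_lt (i : ℕ) (show L > 0 by omega)
    rw [hi, mul_comm] at h1
    rw [Finset.mem_Ico, Fin.valEmbedding_apply]
    omega
  have := Finset.card_le_card h
  simpa using this

theorem card_block_eq {b : ℕ} (hL : 1 ≤ L) (hb : (b + 1) * L ≤ d) : (block d L b).card = L := by
  refine le_antisymm (card_block_le hL b) ?_
  have h : Finset.Ico (b * L) (b * L + L) ⊆ ((block d L b).map Fin.valEmbedding) := by
    intro j hj
    rw [Finset.mem_Ico] at hj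
    rw [add_mul, one_mul] at hb
    refine Finset.mem_map.2 ⟨⟨j, by omega⟩, ?_, rfl⟩
    rw [mem_block]
    change j / L = b
    exact Nat.div_eq_of_lt_le (by omega) (by rw [Nat.add_mul, one_mul]; omega)
  have := Finset.card_le_card h
  simpa using this

theorem numBlocks_mul_le (hL : 1 ≤ L) (hLd : L ≤ d) : numBlocks d L * L ≤ 2 * d := by
  have := Nat.div_mul_le_self (d + L - 1) L
  rw [numBlocks]; omega

theorem numBlocks_le (hL : 1 ≤ L) (hd : 1 ≤ d) : numBlocks d L ≤ d := by
  rw [numBlocks]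
  refine Nat.div_le_of_le_mul ?_
  nlinarith [Nat.sub_le (d + L) 1, mul_le_mul (Nat.sub_le 1 0) hd (by simp) (by simp),
    show d + L - 1 ≤ L * d by
      obtain ⟨a, rfl⟩ := Nat.exists_eq_add_of_le hL
      obtain ⟨c, rfl⟩ := Nat.exists_eq_add_of_le hd
      have : (1 + a) * (1 + c) = 1 + a + c + a * c := by ring
      rw [this]; omega]

end blocks

/-! ### Shrinkage factors and the mean-zero block errors -/

theorem energy_nonneg {d : ℕ} (x : Fin d → ℝ) (L b : ℕ) : 0 ≤ energy x L b :=
  Finset.sum_nonneg fun _ _ => sq_nonneg _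

theorem sum_energy {d L : ℕ} (hL : 1 ≤ L) (x : Fin d → ℝ) :
    ∑ b ∈ Finset.range (numBlocks d L), energy x L b = ∑ i, x i ^ 2 :=
  sum_blocks hL fun i => x i ^ 2

theorem measurable_energy {d : ℕ} (θ : Fin d → ℝ) (L b : ℕ) :
    Measurable fun z : Fin d → ℝ => energy (θ + z) L b := by
  unfold energy
  simp only [Pi.add_apply]
  fun_prop

/-- The shrinkage factor of a block with energy `s`. -/
noncomputable def shrink (lam s : ℝ) : ℝ := lam / max s lam

/-- The inner product of noise and observation on a block. -/
noncomputable def cross {d : ℕ} (θ : Fin d → ℝ) (L b : ℕ) (z : Fin d → ℝ) : ℝ :=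
  ∑ i ∈ block d L b, z i * (θ i + z i)

/-- Up to the noise energy, half of the difference of loss and risk estimate on a block. -/
noncomputable def sureError {d : ℕ} (θ : Fin d → ℝ) (L b : ℕ) (lam : ℝ) (z : Fin d → ℝ) : ℝ :=
  -(shrink lam (energy (θ + z) L b) * cross θ L b z) +
    if lam < energy (θ + z) L b then
      lam * (((block d L b).card : ℝ) - 2) / energy (θ + z) L b
    else ((block d L b).card : ℝ)

theorem measurable_cross {d : ℕ} (θ : Fin d → ℝ) (L b : ℕ) : Measurable (cross θ L b) := by
  unfold cross; fun_prop

theorem measurable_sureError {d : ℕ} (θ : Fin d → ℝ) (L b : ℕ) (lam : ℝ) :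
    Measurable (sureError θ L b lam) := by
  have h1 := measurable_energy θ L b
  have h2 := measurable_cross θ L b
  refine Measurable.add ?_ (Measurable.ite (measurableSet_lt measurable_const h1) ?_
    measurable_const)
  · unfold shrink
    exact ((measurable_const.div (h1.max measurable_const)).mul h2).neg
  · exact measurable_const.div h1

theorem shrink_nonneg {lam : ℝ} (h : 0 ≤ lam) (s : ℝ) : 0 ≤ shrink lam s :=
  div_nonneg h (h.trans (le_max_right _ _))

/-- By AM-GM, `√lam * y ≤ (lam + y²) / 2 ≤ max s lam`. So the estimator never moves a block by more
than `√lam`. -/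
theorem shrink_mul_le {lam s y : ℝ} (h : 0 ≤ lam) (hy : 0 ≤ y) (hys : y ^ 2 ≤ s) :
    shrink lam s * y ≤ Real.sqrt lam := by
  rcases h.eq_or_lt with rfl | h
  · simp [shrink]
  have hM : 0 < max s lam := h.trans_le (le_max_right _ _)
  rw [shrink, div_mul_eq_mul_div, div_le_iff₀ hM]
  have h1 := Real.sq_sqrt h.le
  have h0 := Real.sqrt_pos.2 h
  have h2 : Real.sqrt lam * y ≤ max s lam := by
    have := hys.trans (le_max_left s lam)
    have := le_max_right s lam
    nlinarith [sq_nonneg (Real.sqrt lam - y)]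
  nlinarith

theorem abs_cross_le {d : ℕ} (θ : Fin d → ℝ) (L b : ℕ) (z : Fin d → ℝ) :
    |cross θ L b z| ≤ Real.sqrt (energy z L b) * Real.sqrt (energy (θ + z) L b) := by
  rw [← Real.sqrt_mul (energy_nonneg _ _ _)]
  refine Real.abs_le_sqrt ?_
  exact Finset.sum_mul_sq_le_sq_mul_sq _ _ _

/-- Cauchy–Schwarz on the cross term leaves a factor `shrink * S ≤ √lam`, so the bound is uniform in
`θ`; this makes all later deviation bounds uniform in the signal. -/
theorem abs_sureError_le {d : ℕ} (θ : Fin d → ℝ) {L b : ℕ} {lam : ℝ} (hlam : 0 ≤ lam)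
    (z : Fin d → ℝ) : |sureError θ L b lam z| ≤
      Real.sqrt lam * Real.sqrt (energy z L b) + (block d L b).card := by
  have h1 : |shrink lam (energy (θ + z) L b) * cross θ L b z| ≤
      Real.sqrt lam * Real.sqrt (energy z L b) := by
    rw [abs_mul, abs_of_nonneg (shrink_nonneg hlam _)]
    have h2 := shrink_mul_le hlam (Real.sqrt_nonneg (energy (θ + z) L b))
      (Real.sq_sqrt (energy_nonneg _ _ _)).le
    calc _ ≤ shrink lam (energy (θ + z) L b) *
          (Real.sqrt (energy z L b) * Real.sqrt (energy (θ + z) L b)) := by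
          gcongr
          · exact shrink_nonneg hlam _
          · exact abs_cross_le θ L b z
      _ = (shrink lam (energy (θ + z) L b) * Real.sqrt (energy (θ + z) L b)) *
          Real.sqrt (energy z L b) := by ring
      _ ≤ _ := by gcongr
  have h3 : |if lam < energy (θ + z) L b then
      lam * (((block d L b).card : ℝ) - 2) / energy (θ + z) L b
    else ((block d L b).card : ℝ)| ≤ (block d L b).card := by
    split_ifs with h
    · have hE : 0 < energy (θ + z) L b := hlam.trans_lt h
      -- `|n - 2| ≤ n` fails for an empty block, but that has energy zero and cannot exceed the
      -- threshold.
      rcases Nat.eq_zero_or_pos (block d L b).card with h0 | h0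
      · rw [Finset.card_eq_zero] at h0
        rw [energy, h0] at hE
        simp at hE
      · rw [abs_div, abs_mul, abs_of_nonneg hlam, abs_of_pos hE, div_le_iff₀ hE]
        have h1 : (1 : ℝ) ≤ (block d L b).card := by exact_mod_cast h0
        have h2 : |((block d L b).card : ℝ) - 2| ≤ (block d L b).card :=
          abs_le.2 ⟨by linarith, by linarith⟩
        nlinarith [abs_nonneg (((block d L b).card : ℝ) - 2)]
    · exact (abs_of_nonneg (Nat.cast_nonneg _)).le
  refine (abs_add_le _ _).trans ?_
  rw [abs_neg]
  exact add_le_add h1 h3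

theorem sureError_congr {d : ℕ} (θ : Fin d → ℝ) (L b : ℕ) (lam : ℝ) {z w : Fin d → ℝ}
    (h : ∀ i ∈ block d L b, z i = w i) : sureError θ L b lam z = sureError θ L b lam w := by
  have h1 : energy (θ + z) L b = energy (θ + w) L b :=
    Finset.sum_congr rfl fun i hi => by simp [h i hi]
  have h2 : cross θ L b z = cross θ L b w := Finset.sum_congr rfl fun i hi => by simp [h i hi]
  rw [sureError, sureError, h1, h2]

/-- The partial derivative of `shrink lam (S²) * xᵢ` in `xᵢ`. -/
noncomputable def shrinkDeriv (lam s y : ℝ) : ℝ :=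
  if lam < s then lam / s - 2 * lam * y ^ 2 / s ^ 2 else 1

theorem abs_shrinkDeriv_le {lam s y : ℝ} (h : 0 < lam) (hys : y ^ 2 ≤ s) :
    |shrinkDeriv lam s y| ≤ 3 := by
  rw [shrinkDeriv]
  split_ifs with h1
  · have hs : 0 < s := h.trans h1
    have a1 : lam / s ≤ 1 := (div_le_one hs).2 h1.le
    have a0 : 0 ≤ lam / s := by positivity
    have b0 : 0 ≤ 2 * lam * y ^ 2 / s ^ 2 := by positivity
    have b1 : 2 * lam * y ^ 2 / s ^ 2 ≤ 2 := by
      rw [div_le_iff₀ (by positivity)]; nlinarith [sq_nonneg y]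
    exact abs_le.2 ⟨by linarith, by linarith⟩
  · norm_num

theorem shrink_stein {lam r : ℝ} (t : ℝ) (hlam : 0 < lam) (hr : 0 ≤ r) :
    ∫ u, (u * (shrink lam ((t + u) ^ 2 + r) * (t + u)) - shrinkDeriv lam ((t + u) ^ 2 + r) (t + u))
      ∂(gaussianReal 0 1) = 0 := by
  have hM : ∀ u, 0 < max ((t + u) ^ 2 + r) lam := fun u => hlam.trans_le (le_max_right _ _)
  obtain ⟨h1, h2, h3⟩ := gaussian_stein
    (F := fun u => shrink lam ((t + u) ^ 2 + r) * (t + u))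
    (F' := fun u => shrinkDeriv lam ((t + u) ^ 2 + r) (t + u))
    -- The derivative can fail only where the energy equals `lam`. For `lam < r` this never happens,
    -- and the square root takes the harmless value 0.
    (s := {Real.sqrt (lam - r) - t, -Real.sqrt (lam - r) - t}) (C := |t| + 3)
    ((Set.countable_singleton _).insert _)
    (by
      unfold shrink
      refine Continuous.mul (Continuous.div (by fun_prop) (by fun_prop) fun u => (hM u).ne')
        (by fun_prop))
    (by
      unfold shrinkDeriv
      refine Measurable.ite (measurableSet_lt (by fun_prop) (by fun_prop)) ?_ measurable_const
      fun_prop)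
    (fun u hu => by
      have hne : (t + u) ^ 2 + r ≠ lam := fun he => by
        have h4 : (t + u) ^ 2 = Real.sqrt (lam - r) ^ 2 := by
          rw [Real.sq_sqrt (by nlinarith [sq_nonneg (t + u)])]; linarith
        rcases sq_eq_sq_iff_eq_or_eq_neg.1 h4 with h5 | h5
        · exact hu (Or.inl (by linarith))
        · exact hu (Or.inr (by simp only [Set.mem_singleton_iff]; linarith))
      have hc : Continuous fun u : ℝ => (t + u) ^ 2 + r := by fun_prop
      have hsum : HasDerivAt (fun u : ℝ => t + u) 1 u := (hasDerivAt_id u).const_add t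
      rcases lt_or_gt_of_ne hne with h | h
      · have e : (fun u => shrink lam ((t + u) ^ 2 + r) * (t + u)) =ᶠ[nhds u] fun u => t + u := by
          filter_upwards [hc.continuousAt.eventually (gt_mem_nhds h)] with w hw
          rw [shrink, max_eq_right hw.le, div_self hlam.ne', one_mul]
        rw [shrinkDeriv, if_neg h.le.not_gt]
        exact hsum.congr_of_eventuallyEq e
      · have e : (fun u => shrink lam ((t + u) ^ 2 + r) * (t + u)) =ᶠ[nhds u]
            fun u => lam / ((t + u) ^ 2 + r) * (t + u) := by
          filter_upwards [hc.continuousAt.eventually (lt_mem_nhds h)] with w hw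
          rw [shrink, max_eq_left hw.le]
        rw [shrinkDeriv, if_pos h]
        refine HasDerivAt.congr_of_eventuallyEq ?_ e
        have hpos : 0 < (t + u) ^ 2 + r := hlam.trans h
        have hq : HasDerivAt (fun u : ℝ => (t + u) ^ 2 + r) (2 * (t + u)) u := by
          simpa using (hsum.fun_pow 2).add_const r
        refine (((hasDerivAt_const u lam).fun_div hq hpos.ne').fun_mul hsum).congr_deriv ?_
        field_simp
        ring)
    (fun u => by
      have a1 : shrink lam ((t + u) ^ 2 + r) ≤ 1 := (div_le_one (hM u)).2 (le_max_right _ _)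
      have a0 := shrink_nonneg hlam.le ((t + u) ^ 2 + r)
      rw [abs_mul, abs_of_nonneg a0]
      have := abs_add_le t u
      have h5 := sq_abs u
      nlinarith [abs_nonneg (t + u), abs_nonneg t, sq_nonneg (|u| - 1), mul_nonneg (abs_nonneg t) (sq_nonneg u)])
    (fun u => by
      have := abs_shrinkDeriv_le hlam (show (t + u) ^ 2 ≤ (t + u) ^ 2 + r by linarith)
      nlinarith [abs_nonneg t, sq_nonneg u, mul_nonneg (abs_nonneg t) (sq_nonneg u)])
  rw [integral_sub h2 h1, h3, sub_self]

theorem energy_add_update {d : ℕ} (θ z : Fin d → ℝ) {L b : ℕ} {i : Fin d} (hi : i ∈ block d L b)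
    (u : ℝ) : energy (θ + Function.update z i u) L b =
      (θ i + u) ^ 2 + ∑ j ∈ (block d L b).erase i, (θ j + z j) ^ 2 := by
  rw [energy, ← Finset.add_sum_erase _ _ hi]
  congr 1
  · simp
  · refine Finset.sum_congr rfl fun j hj => ?_
    simp [Function.update_of_ne (Finset.ne_of_mem_erase hj)]

theorem sq_le_energy {d : ℕ} (x : Fin d → ℝ) {L b : ℕ} {i : Fin d} (hi : i ∈ block d L b) :
    x i ^ 2 ≤ energy x L b :=
  Finset.single_le_sum (f := fun i => x i ^ 2) (fun _ _ => sq_nonneg _) hi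

/-- With the other coordinates fixed, the block energy is `(θ i + u)² + r`, and `shrink_stein`
applies conditionally. Integrability comes from the bounds `√lam` on the shrunken coordinate and 3
on its derivative. -/
theorem shrink_coord_mean_zero {d : ℕ} (θ : Fin d → ℝ) {L b : ℕ} {lam : ℝ} (hlam : 0 < lam)
    {i : Fin d} (hi : i ∈ block d L b) :
    Integrable (fun z => z i * (shrink lam (energy (θ + z) L b) * (θ i + z i)) -
      shrinkDeriv lam (energy (θ + z) L b) (θ i + z i)) (noise d) ∧
    ∫ z, (z i * (shrink lam (energy (θ + z) L b) * (θ i + z i)) -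
      shrinkDeriv lam (energy (θ + z) L b) (θ i + z i)) ∂(noise d) = 0 := by
  have hE := measurable_energy θ L b
  have hi1 : Integrable (fun z : Fin d → ℝ => z i * (shrink lam (energy (θ + z) L b) * (θ i + z i)) -
      shrinkDeriv lam (energy (θ + z) L b) (θ i + z i)) (noise d) := by
    have i0 : Integrable (fun z : Fin d → ℝ => Real.sqrt lam * (1 + z i ^ 2) + 3) (noise d) :=
      ((((integrable_const 1).add (integrable_comp_apply_noise i integrable_sq_gaussian)).const_mul
        _).add (integrable_const 3))
    refine i0.mono' (Measurable.aestronglyMeasurable ?_) (ae_of_all _ fun z => ?_)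
    · unfold shrink shrinkDeriv
      refine Measurable.sub (by fun_prop) ?_
      exact Measurable.ite (measurableSet_lt measurable_const hE) (by fun_prop) measurable_const
    · have hs : (θ i + z i) ^ 2 ≤ energy (θ + z) L b := sq_le_energy (θ + z) hi
      have a1 := abs_shrinkDeriv_le hlam hs
      have a2 := shrink_mul_le hlam.le (abs_nonneg (θ i + z i)) (s := energy (θ + z) L b)
        (by rwa [sq_abs])
      have a3 : |z i * (shrink lam (energy (θ + z) L b) * (θ i + z i))| ≤
          Real.sqrt lam * (1 + z i ^ 2) := by
        rw [abs_mul, abs_mul, abs_of_nonneg (shrink_nonneg hlam.le _), mul_comm]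
        have h4 : |z i| ≤ 1 + z i ^ 2 := by
          rw [← sq_abs]; nlinarith [sq_nonneg (|z i| - 1), abs_nonneg (z i)]
        exact mul_le_mul a2 h4 (abs_nonneg _) (Real.sqrt_nonneg _)
      rw [Real.norm_eq_abs]
      exact (abs_sub _ _).trans (add_le_add a3 a1)
  refine ⟨hi1, integral_noise_eq_zero i hi1 fun z => ?_⟩
  have := shrink_stein (r := ∑ j ∈ (block d L b).erase i, (θ j + z j) ^ 2) (θ i) hlam
    (Finset.sum_nonneg fun _ _ => sq_nonneg _)
  simpa only [energy_add_update θ z hi, Function.update_self] using this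

/-- The second summand of the error is the divergence of `x ↦ shrink * x`: above the threshold it is
`n lam / S - 2 lam S / S²`, with `S` the energy, hence the `n - 2`. -/
theorem sureError_eq_neg_sum {d : ℕ} (θ : Fin d → ℝ) {L b : ℕ} {lam : ℝ} (hlam : 0 < lam)
    (z : Fin d → ℝ) : sureError θ L b lam z = -∑ i ∈ block d L b,
      (z i * (shrink lam (energy (θ + z) L b) * (θ i + z i)) -
      shrinkDeriv lam (energy (θ + z) L b) (θ i + z i)) := by
  have h1 : ∑ i ∈ block d L b, z i * (shrink lam (energy (θ + z) L b) * (θ i + z i)) =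
      shrink lam (energy (θ + z) L b) * cross θ L b z := by
    rw [cross, Finset.mul_sum]
    exact Finset.sum_congr rfl fun i _ => by ring
  have h2 : ∑ i ∈ block d L b, shrinkDeriv lam (energy (θ + z) L b) (θ i + z i) =
      if lam < energy (θ + z) L b then
        lam * (((block d L b).card : ℝ) - 2) / energy (θ + z) L b
      else ((block d L b).card : ℝ) := by
    unfold shrinkDeriv
    split_ifs with h
    · have hE : 0 < energy (θ + z) L b := hlam.trans h
      rw [Finset.sum_sub_distrib, Finset.sum_const, ← Finset.sum_div, ← Finset.mul_sum,
        show ∑ i ∈ block d L b, (θ i + z i) ^ 2 = energy (θ + z) L b from rfl]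
      rw [nsmul_eq_mul]
      field_simp
    · simp
  rw [Finset.sum_sub_distrib, h1, h2, sureError]
  ring

/-- Stein's unbiased risk estimate is unbiased. -/
theorem integral_sureError {d : ℕ} (θ : Fin d → ℝ) (L b : ℕ) {lam : ℝ} (hlam : 0 < lam) :
    Integrable (sureError θ L b lam) (noise d) ∧ ∫ z, sureError θ L b lam z ∂(noise d) = 0 := by
  have h := fun i (hi : i ∈ block d L b) => shrink_coord_mean_zero θ hlam hi
  have e : sureError θ L b lam = fun z => -∑ i ∈ block d L b,
      (z i * (shrink lam (energy (θ + z) L b) * (θ i + z i)) -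
      shrinkDeriv lam (energy (θ + z) L b) (θ i + z i)) :=
    funext fun z => sureError_eq_neg_sum θ hlam z
  rw [e]
  refine ⟨(integrable_finsetSum _ fun i hi => (h i hi).1).neg, ?_⟩
  rw [integral_neg, integral_finsetSum _ fun i hi => (h i hi).1,
    Finset.sum_eq_zero fun i hi => (h i hi).2, neg_zero]

/-! ### Exponential moments of the total error -/

theorem lintegral_exp_sum_sq_le {d : ℕ} (θ : Fin d → ℝ) (B : Finset (Fin d)) {s : ℝ}
    (hs : |s| ≤ 1 / 4) :
    ∫⁻ z, ENNReal.ofReal (Real.exp (s * ∑ i ∈ B, ((θ i + z i) ^ 2 - 1))) ∂(noise d) ≤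
      ENNReal.ofReal (Real.exp (∑ i ∈ B, (2 * s ^ 2 + s * θ i ^ 2 / (1 - 2 * s)))) := by
  have hm : ∀ i, Measurable fun u : ℝ =>
      ENNReal.ofReal (Real.exp (s * ((θ i + u) ^ 2 - 1))) := fun i => by fun_prop
  have hi : iIndepFun (fun (i : Fin d) (z : Fin d → ℝ) =>
      ENNReal.ofReal (Real.exp (s * ((θ i + z i) ^ 2 - 1)))) (noise d) :=
    iIndepFun_pi (X := fun i (u : ℝ) => ENNReal.ofReal (Real.exp (s * ((θ i + u) ^ 2 - 1))))
      fun i => (hm i).aemeasurable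
  simp_rw [Finset.mul_sum, Real.exp_sum, ENNReal.ofReal_prod_of_nonneg fun _ _ =>
    (Real.exp_pos _).le]
  rw [lintegral_prod_eq_prod_lintegral_of_indepFun B _ hi fun i => by fun_prop]
  refine Finset.prod_le_prod' fun i _ => ?_
  exact (lintegral_comp_apply_noise i (hm i)).trans_le (lintegral_exp_sq_le hs)

/-- A second-order bound valid for all `y`; after integration the linear term of a centred variable
disappears. -/
theorem exp_le_one_add_self_add (y : ℝ) :
    Real.exp y ≤ 1 + y + y ^ 2 * Real.exp |y| := by
  rcases le_or_gt |y| 1 with h | h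
  · have h1 := (abs_le.1 (Real.abs_exp_sub_one_sub_id_le h)).2
    nlinarith [Real.one_le_exp (abs_nonneg y), sq_nonneg y]
  · rcases lt_abs.1 h with h1 | h1
    · rw [abs_of_pos (by linarith)]
      nlinarith [mul_le_mul_of_nonneg_right (show 1 ≤ y ^ 2 by nlinarith) (Real.exp_pos y).le]
    · have h2 : Real.exp y ≤ 1 := Real.exp_le_one_iff.2 (by linarith)
      nlinarith [Real.one_le_exp (abs_nonneg y), sq_nonneg y]

/-- At rate `1 / (4L)` the chi-square moment of a block is bounded in `L`: the mean gives at most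
`1/4` and the quadratic term at most `1/8` in the exponent. -/
theorem exp_energy_noise {d L b : ℕ} (hL : 1 ≤ L) :
    Integrable (fun z : Fin d → ℝ => Real.exp (energy z L b / (4 * L))) (noise d) ∧
      ∫ z, Real.exp (energy z L b / (4 * L)) ∂(noise d) ≤ Real.exp (3 / 8) := by
  have hL' : (1 : ℝ) ≤ L := by exact_mod_cast hL
  have hn : ((block d L b).card : ℝ) ≤ L := by exact_mod_cast card_block_le hL b
  set n : ℝ := ((block d L b).card : ℝ) with hn'
  have hs : |1 / (4 * (L : ℝ))| ≤ 1 / 4 := by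
    rw [abs_of_nonneg (by positivity)]
    exact one_div_le_one_div_of_le (by norm_num) (by linarith)
  have h := lintegral_exp_sum_sq_le (0 : Fin d → ℝ) (block d L b) hs
  have hm : Measurable fun z : Fin d → ℝ => energy z L b := by
    have := measurable_energy (0 : Fin d → ℝ) L b
    simpa using this
  have e : ∀ z : Fin d → ℝ, ENNReal.ofReal (Real.exp (energy z L b / (4 * L))) =
      ENNReal.ofReal (Real.exp (n / (4 * L))) * ENNReal.ofReal (Real.exp (1 / (4 * (L : ℝ)) *
        ∑ i ∈ block d L b, (((0 : Fin d → ℝ) i + z i) ^ 2 - 1))) := fun z => by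
    rw [← ENNReal.ofReal_mul (Real.exp_pos _).le, ← Real.exp_add]
    congr 2
    simp only [Pi.zero_apply, zero_add, Finset.sum_sub_distrib, energy, Finset.sum_const,
      nsmul_eq_mul, mul_one, ← hn']
    ring
  have hb : ∫⁻ z : Fin d → ℝ, ENNReal.ofReal (Real.exp (energy z L b / (4 * L))) ∂(noise d) ≤
      ENNReal.ofReal (Real.exp (3 / 8)) := by
    simp_rw [e]
    rw [lintegral_const_mul' _ _ ENNReal.ofReal_ne_top]
    refine (mul_le_mul_right h _).trans ?_
    rw [← ENNReal.ofReal_mul (Real.exp_pos _).le, ← Real.exp_add]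
    refine ENNReal.ofReal_le_ofReal (Real.exp_le_exp.2 ?_)
    simp only [Pi.zero_apply, Finset.sum_const, nsmul_eq_mul, ← hn']
    have h1 : n / (4 * L) ≤ 1 / 4 := by rw [div_le_div_iff₀ (by positivity) (by norm_num)]; linarith
    have h2 : n * (2 * (1 / (4 * (L : ℝ))) ^ 2) ≤ 1 / 8 := by
      rw [show n * (2 * (1 / (4 * (L : ℝ))) ^ 2) = n / (8 * (L : ℝ) ^ 2) by field_simp; ring,
        div_le_div_iff₀ (by positivity) (by norm_num)]
      nlinarith
    simp only [ne_eq, OfNat.ofNat_ne_zero, not_false_eq_true, zero_pow, mul_zero, zero_div, add_zero]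
    linarith
  have hi : Integrable (fun z : Fin d → ℝ => Real.exp (energy z L b / (4 * L))) (noise d) := by
    refine ⟨(by fun_prop : Measurable _).aestronglyMeasurable, ?_⟩
    rw [hasFiniteIntegral_iff_ofReal (ae_of_all _ fun _ => (Real.exp_pos _).le)]
    exact hb.trans_lt ENNReal.ofReal_lt_top
  refine ⟨hi, ?_⟩
  rw [← ofReal_integral_eq_lintegral_ofReal hi (ae_of_all _ fun _ => (Real.exp_pos _).le)] at hb
  exact (ENNReal.ofReal_le_ofReal_iff (Real.exp_pos _).le).1 hb

theorem exp_five_eighths_le : Real.exp (5 / 8) ≤ 2 := by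
  have h := Real.exp_one_lt_d9
  have h1 : Real.exp (5 / 8) ^ 8 ≤ 2 ^ 8 := by
    rw [← Real.exp_nat_mul]
    calc Real.exp (((8 : ℕ) : ℝ) * (5 / 8)) = Real.exp 1 ^ 5 := by
          rw [← Real.exp_nat_mul]; norm_num
      _ ≤ 2.72 ^ 5 := by gcongr; linarith
      _ ≤ _ := by norm_num
  exact le_of_pow_le_pow_left₀ (by norm_num) (by norm_num) h1

/-- Exponential moments of a centred variable dominated by the noise energy of a block. -/
theorem lintegral_exp_le_of_dominated {d L b : ℕ} (hL : 1 ≤ L) {Y : (Fin d → ℝ) → ℝ} {s : ℝ}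
    (hs : s ≤ 1 / (8 * L)) (hY : Integrable Y (noise d))
    (hY0 : ∫ z, Y z ∂(noise d) = 0) (hb : ∀ z, |Y z| ≤ s * (L + energy z L b)) :
    ∫⁻ z, ENNReal.ofReal (Real.exp (Y z)) ∂(noise d) ≤
      ENNReal.ofReal (Real.exp (256 * s ^ 2 * L ^ 2)) := by
  have hL' : (1 : ℝ) ≤ L := by exact_mod_cast hL
  obtain ⟨hi, hle⟩ := exp_energy_noise (d := d) (b := b) hL
  set c : ℝ := 128 * s ^ 2 * L ^ 2 * Real.exp (1 / 4) with hc
  have hp : ∀ z, Real.exp (Y z) ≤ 1 + Y z + c * Real.exp (energy z L b / (4 * L)) := fun z => by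
    refine (exp_le_one_add_self_add (Y z)).trans ?_
    have hQ := energy_nonneg z L b
    -- The rate `1 / (8L)` is chosen so that `exp v`, used once for `exp |Y|` and once for `v² ≤ 2
    -- exp v`, squares to the moment of `exp_energy_noise`.
    set v := (L + energy z L b) / (8 * (L : ℝ)) with hv
    have hv0 : 0 ≤ v := by positivity
    have h1 : |Y z| ≤ v := (hb z).trans (by
      rw [hv, div_eq_inv_mul, ← one_div]; gcongr)
    have h2 : Y z ^ 2 ≤ s ^ 2 * (64 * L ^ 2 * v ^ 2) := by
      rw [← sq_abs]
      calc |Y z| ^ 2 ≤ (s * (L + energy z L b)) ^ 2 := by gcongr; exact hb z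
        _ = _ := by rw [hv]; field_simp; norm_num
    have h3 : v ^ 2 ≤ 2 * Real.exp v := by
      have := Real.quadratic_le_exp_of_nonneg hv0
      nlinarith
    have h4 : Real.exp v * Real.exp v = Real.exp (1 / 4) * Real.exp (energy z L b / (4 * L)) := by
      rw [← Real.exp_add, ← Real.exp_add, hv]
      congr 1
      field_simp
      ring
    have h5 : Y z ^ 2 * Real.exp |Y z| ≤ c * Real.exp (energy z L b / (4 * L)) := by
      calc _ ≤ s ^ 2 * (64 * L ^ 2 * (2 * Real.exp v)) * Real.exp v := by
            refine mul_le_mul (h2.trans (by gcongr)) (Real.exp_le_exp.2 h1) (Real.exp_pos _).le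
              (by positivity)
        _ = 128 * s ^ 2 * L ^ 2 * (Real.exp v * Real.exp v) := by ring
        _ = _ := by rw [h4, hc]; ring
    linarith
  have hi1 : Integrable (fun z => 1 + Y z) (noise d) := (integrable_const 1).add hY
  calc _ ≤ ∫⁻ z, ENNReal.ofReal (1 + Y z + c * Real.exp (energy z L b / (4 * L))) ∂(noise d) :=
        lintegral_mono fun z => ENNReal.ofReal_le_ofReal (hp z)
    _ = ENNReal.ofReal (∫ z, (1 + Y z + c * Real.exp (energy z L b / (4 * L))) ∂(noise d)) :=
        (ofReal_integral_eq_lintegral_ofReal (hi1.add (hi.const_mul c))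
          (ae_of_all _ fun z => (Real.exp_pos _).le.trans (hp z))).symm
    _ ≤ _ := by
        refine ENNReal.ofReal_le_ofReal ?_
        rw [integral_add hi1 (hi.const_mul c), integral_add (integrable_const 1) hY, hY0,
          integral_const_mul]
        simp only [integral_const, probReal_univ, smul_eq_mul, mul_one, add_zero]
        have h6 : Real.exp (1 / 4) * Real.exp (3 / 8) ≤ 2 := by
          rw [← Real.exp_add]; norm_num; exact exp_five_eighths_le
        have h7 : c * Real.exp (3 / 8) ≤ 256 * s ^ 2 * L ^ 2 := by
          rw [hc, mul_assoc]
          nlinarith [mul_le_mul_of_nonneg_left h6 (show 0 ≤ 128 * s ^ 2 * (L : ℝ) ^ 2 by positivity)]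
        have h8 : c * ∫ z, Real.exp (energy z L b / (4 * L)) ∂(noise d) ≤ c * Real.exp (3 / 8) :=
          mul_le_mul_of_nonneg_left hle (by positivity)
        linarith [Real.add_one_le_exp (256 * s ^ 2 * (L : ℝ) ^ 2)]

/-- Induction on the number of blocks: the next block shares no coordinate with the earlier ones, so
the exponential moments multiply. -/
theorem lintegral_exp_sum_blocks_le {d L : ℕ} (θ : Fin d → ℝ) (lam t : ℝ) {M : ℝ}
    (h : ∀ b, ∫⁻ z, ENNReal.ofReal (Real.exp (t * sureError θ L b lam z)) ∂(noise d) ≤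
      ENNReal.ofReal (Real.exp M)) (k : ℕ) :
    ∫⁻ z, ENNReal.ofReal (Real.exp (t * ∑ b ∈ Finset.range k, sureError θ L b lam z))
      ∂(noise d) ≤ ENNReal.ofReal (Real.exp (k * M)) := by
  have hm := fun b => measurable_sureError θ L b lam
  have hc := fun b z w => sureError_congr θ L b lam (z := z) (w := w)
  induction k with
  | zero => simp
  | succ k ih =>
    set f : (Fin d → ℝ) → ℝ := fun z => ∑ b ∈ Finset.range k, sureError θ L b lam z with hf
    have hfm : Measurable f := by fun_prop
    have hind : IndepFun f (sureError θ L k lam) (noise d) := by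
      refine indepFun_of_disjoint (S := (Finset.range k).biUnion (block d L)) (T := block d L k)
        ?_ hfm (hm k) (fun z w hzw => ?_) (hc k)
      · rw [Finset.disjoint_biUnion_left]
        exact fun b hb => block_disjoint (Finset.mem_range.1 hb).ne
      · exact Finset.sum_congr rfl fun b hb => hc b z w fun i hi =>
          hzw i (Finset.mem_biUnion.2 ⟨b, hb, hi⟩)
    have he : Measurable fun y : ℝ => ENNReal.ofReal (Real.exp (t * y)) := by fun_prop
    have := lintegral_mul_eq_lintegral_mul_lintegral_of_indepFun (he.comp hfm) (he.comp (hm k))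
      (hind.comp he he)
    have e : ∀ z, ENNReal.ofReal (Real.exp (t * ∑ b ∈ Finset.range (k + 1), sureError θ L b lam z))
        = ((fun y : ℝ => ENNReal.ofReal (Real.exp (t * y))) ∘ f *
          (fun y : ℝ => ENNReal.ofReal (Real.exp (t * y))) ∘ sureError θ L k lam) z := fun z => by
      rw [Finset.sum_range_succ, mul_add, Real.exp_add, ENNReal.ofReal_mul (Real.exp_pos _).le]
      rfl
    simp_rw [e]
    rw [this]
    refine (mul_le_mul' ih (h k)).trans ?_
    rw [← ENNReal.ofReal_mul (Real.exp_pos _).le, ← Real.exp_add]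
    push_cast
    rw [add_mul, one_mul]

/-- The sum of the risk estimation errors of all blocks. -/
noncomputable def totalError {d : ℕ} (θ : Fin d → ℝ) (L : ℕ) (lam : ℝ) (z : Fin d → ℝ) : ℝ :=
  ∑ b ∈ Finset.range (numBlocks d L), sureError θ L b lam z

theorem measurable_totalError {d : ℕ} (θ : Fin d → ℝ) (L : ℕ) (lam : ℝ) :
    Measurable (totalError θ L lam) := by
  have hm := fun b => measurable_sureError θ L b lam
  unfold totalError; fun_prop

theorem one_le_log {d : ℕ} (hd : 4 ≤ d) : 1 ≤ Real.log d := by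
  have h : (4 : ℝ) ≤ d := by exact_mod_cast hd
  rw [Real.le_log_iff_exp_le (by linarith)]
  linarith [Real.exp_one_lt_d9]

theorem one_le_sqrt_log {d : ℕ} (hd : 4 ≤ d) : 1 ≤ Real.sqrt (Real.log d) :=
  Real.one_le_sqrt.2 (one_le_log hd)

/-- AM-GM, with `√3 ≤ 9/5`. The constant 3 instead of 2 in the range of `lam` leaves room for
rounding thresholds up. -/
theorem sqrt_mul_sqrt_le {d L : ℕ} (hd : 4 ≤ d) {lam Q : ℝ} (hQ : 0 ≤ Q)
    (hlam : lam ≤ 3 * L * Real.log d) :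
    Real.sqrt lam * Real.sqrt Q ≤ Real.sqrt (Real.log d) * (L + Q) * (9 / 10) := by
  have h0 := one_le_log hd
  have h1 : Real.sqrt lam ≤ Real.sqrt 3 * Real.sqrt L * Real.sqrt (Real.log d) := by
    rw [← Real.sqrt_mul (by norm_num), ← Real.sqrt_mul (by positivity)]
    exact Real.sqrt_le_sqrt hlam
  have h3 : Real.sqrt 3 ≤ 9 / 5 := by
    rw [Real.sqrt_le_left (by norm_num)]; norm_num
  have h4 : Real.sqrt L * Real.sqrt Q ≤ (L + Q) / 2 := by
    nlinarith [sq_nonneg (Real.sqrt L - Real.sqrt Q), Real.sq_sqrt (Nat.cast_nonneg (α := ℝ) L),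
      Real.sq_sqrt hQ]
  calc _ ≤ Real.sqrt 3 * Real.sqrt L * Real.sqrt (Real.log d) * Real.sqrt Q := by gcongr
    _ = Real.sqrt 3 * Real.sqrt (Real.log d) * (Real.sqrt L * Real.sqrt Q) := by ring
    _ ≤ 9 / 5 * Real.sqrt (Real.log d) * ((L + Q) / 2) := by gcongr
    _ = _ := by ring

theorem abs_sureError_le_energy {d L : ℕ} (hd : 4 ≤ d) (hL : 1 ≤ L) (θ : Fin d → ℝ) (b : ℕ)
    {lam : ℝ} (h0 : 0 ≤ lam) (hlam : lam ≤ 3 * L * Real.log d) (z : Fin d → ℝ) :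
    |sureError θ L b lam z| ≤ 2 * Real.sqrt (Real.log d) * (L + energy z L b) := by
  have hn : ((block d L b).card : ℝ) ≤ L := by exact_mod_cast card_block_le hL b
  have h1 := sqrt_mul_sqrt_le hd (energy_nonneg z L b) hlam
  have h2 := one_le_sqrt_log hd
  have h3 := energy_nonneg z L b
  have := abs_sureError_le θ (L := L) (b := b) h0 z
  nlinarith [mul_nonneg (sub_nonneg.2 h2) (add_nonneg (Nat.cast_nonneg (α := ℝ) L) h3)]

/-- The scale `d ^ {3/4}` of the fluctuations of the unbiased risk estimate. -/
noncomputable def fluct (d : ℕ) : ℝ := (d : ℝ) ^ (3 / 4 : ℝ)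

theorem fluct_sq (d : ℕ) : fluct d ^ 2 = d * Real.sqrt d := by
  rcases Nat.eq_zero_or_pos d with rfl | h
  · norm_num [fluct, Real.zero_rpow]
  · have h' : (0 : ℝ) < d := by exact_mod_cast h
    rw [fluct, ← Real.rpow_natCast, ← Real.rpow_mul h'.le, Real.sqrt_eq_rpow]
    nth_rw 2 [← Real.rpow_one (d : ℝ)]
    rw [← Real.rpow_add h']
    norm_num

theorem sqrt_le_fluct {d : ℕ} (hd : 1 ≤ d) : Real.sqrt d ≤ fluct d := by
  have h' : (1 : ℝ) ≤ d := by exact_mod_cast hd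
  rw [fluct, Real.sqrt_eq_rpow]
  exact Real.rpow_le_rpow_of_exponent_le h' (by norm_num)

theorem fluct_pos {d : ℕ} (hd : 1 ≤ d) : 0 < fluct d :=
  Real.rpow_pos_of_pos (by exact_mod_cast hd) _

/-- About `d / L` blocks each contribute `L² log d` to a variance proxy, in total at most a multiple
of `d L log d ≤ d^{3/2} log d`; this dictates the rate. The sign of `t` is free, so both tails are
covered. -/
theorem lintegral_exp_totalError_le {d L : ℕ} (hd : 4 ≤ d) (hL : 1 ≤ L)
    (hLd : (L : ℝ) ≤ Real.sqrt d) (θ : Fin d → ℝ) {lam t : ℝ} (h0 : 0 < lam)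
    (hlam : lam ≤ 3 * L * Real.log d) (ht : |t| = (16 * fluct d * Real.sqrt (Real.log d))⁻¹) :
    ∫⁻ z, ENNReal.ofReal (Real.exp (t * totalError θ L lam z)) ∂(noise d) ≤
      ENNReal.ofReal (Real.exp 8) := by
  have hL' : (1 : ℝ) ≤ L := by exact_mod_cast hL
  have hd1 : 1 ≤ d := by omega
  have ha := fluct_pos hd1
  have hl := one_le_sqrt_log hd
  set s : ℝ := (8 * fluct d)⁻¹ with hs
  have hs0 : 0 < s := by positivity
  have hsL : s ≤ 1 / (8 * L) := by
    rw [hs, ← one_div]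
    exact one_div_le_one_div_of_le (by positivity) (by linarith [sqrt_le_fluct hd1])
  have hblock : ∀ b, ∫⁻ z, ENNReal.ofReal (Real.exp (t * sureError θ L b lam z)) ∂(noise d) ≤
      ENNReal.ofReal (Real.exp (256 * s ^ 2 * L ^ 2)) := fun b => by
    obtain ⟨i1, i2⟩ := integral_sureError θ L b h0
    refine lintegral_exp_le_of_dominated (b := b) hL hsL (i1.const_mul t) ?_ fun z => ?_
    · rw [integral_const_mul, i2, mul_zero]
    · have := abs_sureError_le_energy hd hL θ b h0.le hlam z
      rw [abs_mul, ht]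
      calc _ ≤ (16 * fluct d * Real.sqrt (Real.log d))⁻¹ *
            (2 * Real.sqrt (Real.log d) * (L + energy z L b)) := by gcongr
        _ = _ := by rw [hs]; field_simp; ring
  refine (lintegral_exp_sum_blocks_le θ lam t hblock (numBlocks d L)).trans
    (ENNReal.ofReal_le_ofReal (Real.exp_le_exp.2 ?_))
  have hLd2 : L ≤ d := by
    have : Real.sqrt d ≤ d := by
      rw [Real.sqrt_le_left (by positivity)]
      have : (1 : ℝ) ≤ d := by exact_mod_cast hd1
      nlinarith
    exact_mod_cast hLd.trans this
  have hk : (numBlocks d L : ℝ) * L ≤ 2 * d := by exact_mod_cast numBlocks_mul_le hL hLd2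
  have hs2 : s ^ 2 * (d * Real.sqrt d) = 1 / 64 := by
    rw [← fluct_sq, hs]; field_simp; norm_num
  calc (numBlocks d L : ℝ) * (256 * s ^ 2 * L ^ 2)
      = 256 * s ^ 2 * (L * (numBlocks d L * L)) := by ring
    _ ≤ 256 * s ^ 2 * (Real.sqrt d * (2 * d)) := by gcongr
    _ = 512 * (s ^ 2 * (d * Real.sqrt d)) := by ring
    _ = 8 := by rw [hs2]; norm_num

/-! ### Discretization of the search range and the uniform bound -/

theorem shrink_of_le {lam s : ℝ} (h0 : 0 < lam) (h : s ≤ lam) : shrink lam s = 1 := by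
  rw [shrink, max_eq_right h, div_self h0.ne']

theorem shrink_of_lt {lam s : ℝ} (h : lam < s) : shrink lam s = lam / s := by
  rw [shrink, max_eq_left h.le]

/-- Increasing the threshold slightly cannot decrease the risk estimation error by much: the jump
of the error at `lam = S²` is upwards. -/
theorem sureError_le_of_le {d : ℕ} (θ : Fin d → ℝ) (L b : ℕ) {lam lam' δ : ℝ} (h0 : 0 < lam)
    (hle : lam ≤ lam') (hδ : lam' - lam ≤ δ * lam) (z : Fin d → ℝ) :
    sureError θ L b lam z ≤ sureError θ L b lam' z +
      δ * (Real.sqrt lam' * Real.sqrt (energy z L b) + 2) := by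
  have hcr := abs_cross_le θ L b z
  have hv := le_abs_self (cross θ L b z)
  rw [sureError, sureError]
  set S := energy (θ + z) L b
  set v := cross θ L b z
  set n : ℝ := ((block d L b).card : ℝ)
  set q := Real.sqrt (energy z L b)
  have hq : 0 ≤ q := Real.sqrt_nonneg _
  have hn : 0 ≤ n := Nat.cast_nonneg _
  have hδ0 : 0 ≤ δ := by
    by_contra h
    nlinarith
  have hl' := Real.sqrt_nonneg lam'
  rcases le_or_gt S lam with h1 | h1
  · rw [shrink_of_le h0 h1, shrink_of_le (h0.trans_le hle) (h1.trans hle), if_neg h1.not_gt,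
      if_neg (h1.trans hle).not_gt]
    have : 0 ≤ δ * (Real.sqrt lam' * q + 2) := by positivity
    linarith
  have hS : 0 < S := h0.trans h1
  have hk1 : lam / S ≤ 1 := (div_le_one hS).2 h1.le
  have hk0 : 0 < lam / S := by positivity
  have e1 : lam * (n - 2) / S = lam / S * (n - 2) := by ring
  have hkv : lam / S * |v| ≤ Real.sqrt lam' * q := by
    have a := shrink_mul_le h0.le (Real.sqrt_nonneg S) (Real.sq_sqrt hS.le).le
    rw [shrink_of_lt h1] at a
    calc lam / S * |v| ≤ lam / S * (q * Real.sqrt S) := by gcongr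
      _ = (lam / S * Real.sqrt S) * q := by ring
      _ ≤ Real.sqrt lam * q := by gcongr
      _ ≤ _ := by gcongr
  -- If the threshold crosses `S`, the divergence part rises from `lam / S * (n - 2)` to `n`, which
  -- only helps; the cross term changes by at most `1 - lam / S ≤ δ * (lam / S)` times `|v|`.
  rcases le_or_gt S lam' with h2 | h2
  · rw [shrink_of_lt h1, shrink_of_le (h0.trans_le hle) h2, if_pos h1, if_neg h2.not_gt, e1]
    have hd : 1 - lam / S ≤ δ * (lam / S) := by
      have : (S - lam) / S ≤ δ * lam / S := by gcongr; linarith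
      rw [sub_div, div_self hS.ne'] at this
      rwa [← mul_div_assoc]
    have a1 : (1 - lam / S) * v ≤ δ * (Real.sqrt lam' * q) := by
      calc (1 - lam / S) * v ≤ (1 - lam / S) * |v| :=
            mul_le_mul_of_nonneg_left hv (by linarith)
        _ ≤ δ * (lam / S) * |v| := by gcongr
        _ = δ * (lam / S * |v|) := by ring
        _ ≤ _ := by gcongr
    nlinarith [mul_nonneg hn (sub_nonneg.2 hk1)]
  · rw [shrink_of_lt h1, shrink_of_lt h2, if_pos h1, if_pos h2, e1]
    have e2 : lam' * (n - 2) / S = lam' / S * (n - 2) := by ring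
    rw [e2]
    have hd0 : 0 ≤ lam' / S - lam / S := by rw [← sub_div]; exact div_nonneg (by linarith) hS.le
    have hd : lam' / S - lam / S ≤ δ * (lam / S) := by
      rw [← sub_div, ← mul_div_assoc]; gcongr
    have a1 : (lam' / S - lam / S) * v ≤ δ * (Real.sqrt lam' * q) := by
      calc (lam' / S - lam / S) * v ≤ (lam' / S - lam / S) * |v| :=
            mul_le_mul_of_nonneg_left hv hd0
        _ ≤ δ * (lam / S) * |v| := by gcongr
        _ = δ * (lam / S * |v|) := by ring
        _ ≤ _ := by gcongr
    have a2 : lam' / S - lam / S ≤ δ := hd.trans (mul_le_of_le_one_right hδ0 hk1)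
    nlinarith [mul_nonneg hn hd0]

/-- For tiny thresholds, the risk estimation error is small off an event of small probability. -/
theorem sureError_le_of_small {d : ℕ} (θ : Fin d → ℝ) {L b : ℕ} (hL1 : 1 ≤ L) (hL : L ≤ 2)
    {lam r : ℝ} (h0 : 0 ≤ lam) (hr : lam ≤ r) (z : Fin d → ℝ) :
    sureError θ L b lam z ≤ Real.sqrt lam * Real.sqrt (energy z L b) +
      ∑ i ∈ block d L b, if (θ i + z i) ^ 2 ≤ r then 1 else 0 := by
  have h1 : |shrink lam (energy (θ + z) L b) * cross θ L b z| ≤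
      Real.sqrt lam * Real.sqrt (energy z L b) := by
    rw [abs_mul, abs_of_nonneg (shrink_nonneg h0 _)]
    have h2 := shrink_mul_le h0 (Real.sqrt_nonneg (energy (θ + z) L b))
      (Real.sq_sqrt (energy_nonneg _ _ _)).le
    calc _ ≤ shrink lam (energy (θ + z) L b) *
          (Real.sqrt (energy z L b) * Real.sqrt (energy (θ + z) L b)) := by
          gcongr
          · exact shrink_nonneg h0 _
          · exact abs_cross_le θ L b z
      _ = (shrink lam (energy (θ + z) L b) * Real.sqrt (energy (θ + z) L b)) *
          Real.sqrt (energy z L b) := by ring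
      _ ≤ _ := by gcongr
  have hn : ((block d L b).card : ℝ) ≤ 2 := by exact_mod_cast (card_block_le hL1 b).trans hL
  have hI : (0 : ℝ) ≤ ∑ i ∈ block d L b, if (θ i + z i) ^ 2 ≤ r then 1 else 0 :=
    Finset.sum_nonneg fun i _ => by split_ifs <;> norm_num
  rw [sureError]
  refine add_le_add ((neg_le_abs _).trans h1) ?_
  -- Above the threshold, `n ≤ 2` makes the divergence nonpositive. Below it, every coordinate of
  -- the block is small, and `n` is exactly the sum of indicators.
  split_ifs with h
  · refine le_trans ?_ hI
    exact div_nonpos_of_nonpos_of_nonneg (mul_nonpos_of_nonneg_of_nonpos h0 (by linarith))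
      (energy_nonneg _ _ _)
  · refine le_of_eq ?_
    rw [Finset.sum_congr rfl fun i hi => if_pos (show (θ i + z i) ^ 2 ≤ r from
      ((sq_le_energy (θ + z) hi).trans (not_lt.1 h)).trans hr)]
    simp

/-- The finite set of block sizes and (rescaled) thresholds which approximates the search range. -/
noncomputable def searchGrid (d : ℕ) : Finset (ℕ × ℕ) := by
  classical
  exact (Finset.Icc 1 d ×ˢ Finset.Icc 1 (3 * d ^ 3)).filter fun j =>
    (j.1 : ℝ) ≤ Real.sqrt d ∧ (j.2 : ℝ) / d ≤ 3 * j.1 * Real.log d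

theorem mem_searchGrid {d : ℕ} {j : ℕ × ℕ} : j ∈ searchGrid d ↔
    (((1 ≤ j.1 ∧ j.1 ≤ d) ∧ 1 ≤ j.2 ∧ j.2 ≤ 3 * d ^ 3) ∧
      (j.1 : ℝ) ≤ Real.sqrt d ∧ (j.2 : ℝ) / d ≤ 3 * j.1 * Real.log d) := by
  simp [searchGrid]

theorem card_searchGrid_le (d : ℕ) : (searchGrid d).card ≤ 3 * d ^ 4 := by
  refine (Finset.card_filter_le _ _).trans ?_
  rw [Finset.card_product]
  simp only [Nat.card_Icc, Nat.add_sub_cancel]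
  exact le_of_eq (by ring)

/-- The inverse of the rate in the exponential moments of the total error. -/
noncomputable def scale (d : ℕ) : ℝ := 16 * fluct d * Real.sqrt (Real.log d)

theorem scale_pos {d : ℕ} (hd : 4 ≤ d) : 0 < scale d := by
  have := fluct_pos (d := d) (by omega)
  have := one_le_sqrt_log hd
  unfold scale; positivity

/-- An upper bound for the total error on the grid. -/
noncomputable def gridBound {d : ℕ} (θ z : Fin d → ℝ) : ℝ :=
  scale d * (5 * Real.log d + ((d : ℝ) ^ 5)⁻¹ * ∑ j ∈ searchGrid d,
    Real.exp ((scale d)⁻¹ * totalError θ j.1 (j.2 / d) z))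

/-- An upper bound for the discretization error. -/
noncomputable def slackBound {d : ℕ} (θ z : Fin d → ℝ) : ℝ :=
  (d : ℝ) ^ (-1 / 4 : ℝ) * Real.sqrt (Real.log d) * (4 * d + ∑ i, z i ^ 2) +
    ∑ i, if (θ i + z i) ^ 2 ≤ (Real.sqrt d)⁻¹ then 1 else 0

/-- A soft maximum: `y ≤ 5 log d + d^{-5} exp y`, and one exponential is at most their sum. The
power 5 beats the `3 d⁴` points of the grid. -/
theorem totalError_le_gridBound {d : ℕ} (hd : 4 ≤ d) (θ z : Fin d → ℝ) {j : ℕ × ℕ}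
    (hj : j ∈ searchGrid d) : totalError θ j.1 (j.2 / d) z ≤ gridBound θ z := by
  have hs := scale_pos hd
  have hd0 : (0 : ℝ) < d := by exact_mod_cast (show 0 < d by omega)
  set y := (scale d)⁻¹ * totalError θ j.1 (j.2 / d) z with hy
  have e : totalError θ j.1 (j.2 / d) z = scale d * y := by rw [hy]; field_simp
  rw [e, gridBound]
  refine mul_le_mul_of_nonneg_left ?_ hs.le
  have h1 : Real.exp y ≤ ∑ j ∈ searchGrid d,
      Real.exp ((scale d)⁻¹ * totalError θ j.1 (j.2 / d) z) :=
    Finset.single_le_sum (f := fun j : ℕ × ℕ =>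
      Real.exp ((scale d)⁻¹ * totalError θ j.1 (j.2 / d) z)) (fun _ _ => (Real.exp_pos _).le) hj
  have h2 : ((d : ℝ) ^ 5)⁻¹ = Real.exp (-(5 * Real.log d)) := by
    rw [Real.exp_neg, ← Real.exp_log (pow_pos hd0 5), Real.log_pow]
    norm_num
  calc y = 5 * Real.log d + (y - 5 * Real.log d) := by ring
    _ ≤ 5 * Real.log d + Real.exp (y - 5 * Real.log d) := by
        linarith [Real.add_one_le_exp (y - 5 * Real.log d)]
    _ = 5 * Real.log d + ((d : ℝ) ^ 5)⁻¹ * Real.exp y := by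
        rw [h2, ← Real.exp_add]; congr 2; ring
    _ ≤ _ := by gcongr

theorem gridBound_nonneg {d : ℕ} (hd : 4 ≤ d) (θ z : Fin d → ℝ) : 0 ≤ gridBound θ z := by
  have := scale_pos hd
  have := one_le_log hd
  have : 0 ≤ ∑ j ∈ searchGrid d, Real.exp ((scale d)⁻¹ * totalError θ j.1 (j.2 / d) z) :=
    Finset.sum_nonneg fun _ _ => (Real.exp_pos _).le
  unfold gridBound; positivity

theorem sum_indicator_nonneg {d : ℕ} (θ z : Fin d → ℝ) (r : ℝ) :
    (0 : ℝ) ≤ ∑ i, if (θ i + z i) ^ 2 ≤ r then 1 else 0 :=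
  Finset.sum_nonneg fun i _ => by split_ifs <;> norm_num

theorem slackBound_nonneg {d : ℕ} (θ z : Fin d → ℝ) : 0 ≤ slackBound θ z := by
  have := sum_indicator_nonneg θ z (Real.sqrt d)⁻¹
  have : 0 ≤ ∑ i, z i ^ 2 := Finset.sum_nonneg fun _ _ => sq_nonneg _
  unfold slackBound
  have : (0 : ℝ) ≤ (d : ℝ) ^ (-1 / 4 : ℝ) := by positivity
  positivity

theorem inv_sqrt_le_rpow {d : ℕ} (hd : 1 ≤ d) : (Real.sqrt d)⁻¹ ≤ (d : ℝ) ^ (-1 / 4 : ℝ) := by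
  have h' : (1 : ℝ) ≤ d := by exact_mod_cast hd
  rw [Real.sqrt_eq_rpow, ← Real.rpow_neg (by linarith)]
  exact Real.rpow_le_rpow_of_exponent_le h' (by norm_num)

/-- A uniform upper bound for the total error over the search range. -/
theorem totalError_le_of_mem_searchRange {d : ℕ} (hd : 4 ≤ d) (θ z : Fin d → ℝ) {q : ℝ × ℕ}
    (hq : q ∈ searchRange d) : totalError θ q.2 q.1 z ≤ gridBound θ z + slackBound θ z := by
  obtain ⟨lam, L⟩ := q
  obtain ⟨h1, h2, hL, hLd⟩ := hq
  simp only at h1 h2 hL hLd ⊢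
  have hlog := one_le_log hd
  have hl := one_le_sqrt_log hd
  have hdN : (4 : ℝ) ≤ d := by exact_mod_cast hd
  have hd0 : (0 : ℝ) < d := by linarith
  have hL' : (1 : ℝ) ≤ L := by exact_mod_cast hL
  have hsq : Real.sqrt d ^ 2 = d := Real.sq_sqrt hd0.le
  have hsd : 2 ≤ Real.sqrt d := Real.le_sqrt_of_sq_le (by linarith)
  have hsdd : Real.sqrt d ≤ d := by nlinarith
  have hLdN : L ≤ d := by exact_mod_cast hLd.trans hsdd
  have h0 : 0 ≤ lam := (le_max_right _ _).trans h1
  have hm : (numBlocks d L : ℝ) ≤ d := by exact_mod_cast numBlocks_le hL (by omega)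
  have hmL : (numBlocks d L : ℝ) * L ≤ 2 * d := by exact_mod_cast numBlocks_mul_le hL hLdN
  have hQ0 : 0 ≤ ∑ i, z i ^ 2 := Finset.sum_nonneg fun _ _ => sq_nonneg _
  have hw := inv_sqrt_le_rpow (d := d) (by omega)
  have hw0 : 0 < (Real.sqrt d)⁻¹ := by positivity
  -- Rounding to multiples of `1/d` is a relative error of at most `d^{-1/2}` only for `lam ≥
  -- d^{-1/2}`. Smaller thresholds, zero included, force `L ≤ 2` through `L - 2 ≤ lam`.
  rcases lt_or_ge lam (Real.sqrt d)⁻¹ with hlam | hlam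
  · have hlam1 : lam ≤ 1 / 2 := by
      refine hlam.le.trans ?_
      rw [← one_div]; exact one_div_le_one_div_of_le (by norm_num) hsd
    have hL2 : L ≤ 2 := by
      have : (L : ℝ) < 3 := by have := (le_max_left _ _).trans h1; linarith
      have : L < 3 := by exact_mod_cast this
      omega
    have hsl : Real.sqrt lam ≤ (d : ℝ) ^ (-1 / 4 : ℝ) := by
      refine (Real.sqrt_le_sqrt hlam.le).trans_eq ?_
      rw [Real.sqrt_eq_rpow, Real.sqrt_eq_rpow, ← Real.rpow_neg hd0.le, ← Real.rpow_mul hd0.le]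
      norm_num
    refine le_add_of_nonneg_of_le (gridBound_nonneg hd θ z) ?_
    calc totalError θ L lam z
        ≤ ∑ b ∈ Finset.range (numBlocks d L), (Real.sqrt lam * Real.sqrt (energy z L b) +
          ∑ i ∈ block d L b, if (θ i + z i) ^ 2 ≤ (Real.sqrt d)⁻¹ then 1 else 0) :=
          Finset.sum_le_sum fun b _ => sureError_le_of_small θ hL hL2 h0 hlam.le z
      _ ≤ ∑ b ∈ Finset.range (numBlocks d L), ((d : ℝ) ^ (-1 / 4 : ℝ) * (1 + energy z L b) +
          ∑ i ∈ block d L b, if (θ i + z i) ^ 2 ≤ (Real.sqrt d)⁻¹ then 1 else 0) := by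
          refine Finset.sum_le_sum fun b _ => ?_
          gcongr
          have := Real.sq_sqrt (energy_nonneg z L b)
          nlinarith [sq_nonneg (Real.sqrt (energy z L b) - 1), Real.sqrt_nonneg (energy z L b)]
      _ = (d : ℝ) ^ (-1 / 4 : ℝ) * (numBlocks d L + ∑ i, z i ^ 2) +
          ∑ i, if (θ i + z i) ^ 2 ≤ (Real.sqrt d)⁻¹ then 1 else 0 := by
          rw [Finset.sum_add_distrib, ← Finset.mul_sum, Finset.sum_add_distrib, sum_energy hL,
            sum_blocks hL]
          simp
      _ ≤ slackBound θ z := by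
          unfold slackBound
          gcongr ?_ + _
          rw [mul_assoc]
          refine mul_le_mul_of_nonneg_left ?_ (by positivity)
          nlinarith [mul_nonneg (sub_nonneg.2 hl) hQ0]
  · have hlam0 : 0 < lam := hw0.trans_le hlam
    -- The threshold is rounded up, the direction in which the error cannot drop much.
    set k := ⌈lam * d⌉₊ with hk
    have hk1 : lam * d ≤ k := Nat.le_ceil _
    have hk2 : (k : ℝ) < lam * d + 1 := Nat.ceil_lt_add_one (by positivity)
    have hle : lam ≤ k / d := by rw [le_div_iff₀ hd0]; exact hk1
    have hle2 : (k : ℝ) / d ≤ lam + 1 / d := by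
      rw [div_le_iff₀ hd0, add_mul, one_div, inv_mul_cancel₀ hd0.ne']; exact hk2.le
    have hδ : (k : ℝ) / d - lam ≤ (Real.sqrt d)⁻¹ * lam := by
      have : (1 : ℝ) / d = (Real.sqrt d)⁻¹ * (Real.sqrt d)⁻¹ := by
        rw [← mul_inv, ← pow_two, hsq, one_div]
      have := mul_le_mul_of_nonneg_left hlam hw0.le
      linarith
    have hk3 : (k : ℝ) / d ≤ 3 * L * Real.log d := by
      have h1d : (1 : ℝ) / d ≤ 1 := by rw [div_le_one hd0]; linarith
      have : 1 ≤ L * Real.log d := by nlinarith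
      linarith
    have hgrid : (L, k) ∈ searchGrid d := by
      rw [mem_searchGrid]
      refine ⟨⟨⟨hL, hLdN⟩, Nat.one_le_iff_ne_zero.2 ?_, ?_⟩, hLd, hk3⟩
      · rintro h0
        have h0 : k = 0 := h0
        rw [h0] at hle
        simp at hle
        linarith
      · have h5 : Real.log d ≤ d := (Real.log_le_sub_one_of_pos hd0).trans (by linarith)
        have h6 : (k : ℝ) ≤ 3 * d ^ 3 := by
          rw [div_le_iff₀ hd0] at hk3
          calc (k : ℝ) ≤ 3 * L * Real.log d * d := hk3
            _ ≤ 3 * d * d * d := by gcongr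
            _ = _ := by ring
        exact_mod_cast h6
    have hG := totalError_le_gridBound hd θ z hgrid
    simp only at hG
    calc totalError θ L lam z
        ≤ ∑ b ∈ Finset.range (numBlocks d L), (sureError θ L b (k / d) z + (Real.sqrt d)⁻¹ *
          (Real.sqrt (Real.log d) * (L + energy z L b) + 2)) := by
          refine Finset.sum_le_sum fun b _ => ?_
          refine (sureError_le_of_le θ L b hlam0 hle hδ z).trans ?_
          have hE := energy_nonneg z L b
          refine add_le_add le_rfl (mul_le_mul_of_nonneg_left (add_le_add ?_ le_rfl) hw0.le)
          refine (sqrt_mul_sqrt_le hd hE hk3).trans ?_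
          have : 0 ≤ Real.sqrt (Real.log d) * (L + energy z L b) := by positivity
          linarith
      _ = totalError θ L (k / d) z + (Real.sqrt d)⁻¹ * (Real.sqrt (Real.log d) *
          (numBlocks d L * L + ∑ i, z i ^ 2) + numBlocks d L * 2) := by
          rw [Finset.sum_add_distrib, ← Finset.mul_sum, Finset.sum_add_distrib, ← Finset.mul_sum,
            Finset.sum_add_distrib, sum_energy hL, totalError]
          simp
      _ ≤ _ := by
          refine add_le_add hG ?_
          unfold slackBound
          refine le_add_of_le_of_nonneg ?_ (sum_indicator_nonneg θ z _)
          rw [mul_assoc]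
          refine mul_le_mul hw ?_ ?_ (by positivity)
          · nlinarith
          · positivity

/-! ### Expectations of the grid and slack bounds -/

theorem lintegral_sum_sq_noise (d : ℕ) :
    ∫⁻ z, ENNReal.ofReal (∑ i, z i ^ 2) ∂(noise d) = d := by
  simp_rw [ENNReal.ofReal_sum_of_nonneg fun _ _ => sq_nonneg _]
  rw [lintegral_finsetSum _ fun i _ => by fun_prop]
  have : ∀ i : Fin d, ∫⁻ z : Fin d → ℝ, ENNReal.ofReal (z i ^ 2) ∂(noise d) = 1 := fun i => by
    rw [lintegral_comp_apply_noise i (f := fun u => ENNReal.ofReal (u ^ 2)) (by fun_prop),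
      ← ofReal_integral_eq_lintegral_ofReal integrable_sq_gaussian
        (ae_of_all _ fun _ => sq_nonneg _), integral_sq_gaussian, ENNReal.ofReal_one]
  simp [this]

/-- The small ball estimate for a Gaussian observation. -/
theorem lintegral_small_ball_le (θ : ℝ) {r : ℝ} (hr : 0 ≤ r) :
    ∫⁻ z, ENNReal.ofReal (if (θ + z) ^ 2 ≤ r ^ 2 then 1 else 0) ∂(gaussianReal 0 1) ≤
      ENNReal.ofReal (2 * r) := by
  have e : ∀ z : ℝ, ENNReal.ofReal (if (θ + z) ^ 2 ≤ r ^ 2 then 1 else 0) =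
      (Set.Icc (-θ - r) (-θ + r)).indicator 1 z := fun z => by
    by_cases h : z ∈ Set.Icc (-θ - r) (-θ + r)
    · rw [Set.indicator_of_mem h, if_pos (by
        rw [Set.mem_Icc] at h; exact sq_le_sq' (by linarith) (by linarith))]
      simp
    · rw [Set.indicator_of_notMem h, if_neg fun h' => h (by
        have := abs_le.1 (abs_le_of_sq_le_sq h' hr)
        exact ⟨by linarith, by linarith⟩)]
      simp
  simp_rw [e]
  rw [lintegral_indicator_one measurableSet_Icc, gaussianReal_apply 0 one_ne_zero]
  -- The density is at most 1, so the length of the interval bounds its mass.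
  calc _ ≤ ∫⁻ _ in Set.Icc (-θ - r) (-θ + r), 1 := by
        refine lintegral_mono fun x => ?_
        rw [gaussianPDF, ENNReal.ofReal_le_one]
        exact gaussianPDFReal_std_le_one x
    _ = _ := by
        rw [setLIntegral_one, Real.volume_Icc]; congr 1; ring

theorem lintegral_slackBound_le {d : ℕ} (hd : 4 ≤ d) (θ : Fin d → ℝ) :
    ∫⁻ z, ENNReal.ofReal (slackBound θ z) ∂(noise d) ≤
      ENNReal.ofReal (7 * fluct d * Real.sqrt (Real.log d)) := by
  have hd0 : (0 : ℝ) < d := by exact_mod_cast (show 0 < d by omega)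
  have hl := one_le_sqrt_log hd
  set w : ℝ := (d : ℝ) ^ (-1 / 4 : ℝ) with hw
  have hw0 : 0 < w := by positivity
  have hwd : w * d = fluct d := by
    rw [hw, fluct]; nth_rw 2 [← Real.rpow_one (d : ℝ)]; rw [← Real.rpow_add hd0]; norm_num
  have hw2 : w ^ 2 = (Real.sqrt d)⁻¹ := by
    rw [hw, ← Real.rpow_natCast, ← Real.rpow_mul hd0.le, Real.sqrt_eq_rpow,
      ← Real.rpow_neg hd0.le]
    norm_num
  have e : ∀ z : Fin d → ℝ, ENNReal.ofReal (slackBound θ z) =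
      ENNReal.ofReal (w * Real.sqrt (Real.log d)) * (ENNReal.ofReal (4 * d) +
        ENNReal.ofReal (∑ i, z i ^ 2)) +
      ∑ i, ENNReal.ofReal (if (θ i + z i) ^ 2 ≤ w ^ 2 then 1 else 0) := fun z => by
    have hQ0 : 0 ≤ ∑ i, z i ^ 2 := Finset.sum_nonneg fun _ _ => sq_nonneg _
    rw [slackBound, ENNReal.ofReal_add (by positivity) (sum_indicator_nonneg θ z _),
      ENNReal.ofReal_mul (by positivity), ENNReal.ofReal_add (by positivity) hQ0, hw2]
    congr 1
    exact ENNReal.ofReal_sum_of_nonneg fun i _ => by split_ifs <;> norm_num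
  simp_rw [e]
  have hmi : ∀ i, Measurable fun z : Fin d → ℝ =>
      ENNReal.ofReal (if (θ i + z i) ^ 2 ≤ w ^ 2 then 1 else 0) := fun i =>
    ENNReal.measurable_ofReal.comp (Measurable.ite (measurableSet_le (by fun_prop) (by fun_prop))
      measurable_const measurable_const)
  rw [lintegral_add_right _ (Finset.measurable_sum _ fun i _ => hmi i),
    lintegral_const_mul _ (by fun_prop), lintegral_add_left measurable_const,
    lintegral_sum_sq_noise, lintegral_finsetSum _ fun i _ => hmi i]
  have h1 : ∀ i, ∫⁻ z : Fin d → ℝ, ENNReal.ofReal (if (θ i + z i) ^ 2 ≤ w ^ 2 then 1 else 0)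
      ∂(noise d) ≤ ENNReal.ofReal (2 * w) := fun i => by
    refine (lintegral_comp_apply_noise i (f := fun u =>
      ENNReal.ofReal (if (θ i + u) ^ 2 ≤ w ^ 2 then 1 else 0)) ?_).trans_le
      (lintegral_small_ball_le (θ i) hw0.le)
    exact ENNReal.measurable_ofReal.comp (Measurable.ite
      (measurableSet_le (by fun_prop) (by fun_prop)) measurable_const measurable_const)
  calc _ ≤ ENNReal.ofReal (w * Real.sqrt (Real.log d)) * (ENNReal.ofReal (4 * d) +
        ENNReal.ofReal d) + ∑ _i : Fin d, ENNReal.ofReal (2 * w) := by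
        simp only [lintegral_const, measure_univ, mul_one, ENNReal.ofReal_natCast]
        gcongr with i
        exact h1 i
    _ = ENNReal.ofReal (w * Real.sqrt (Real.log d) * (4 * d + d) + d * (2 * w)) := by
        rw [← ENNReal.ofReal_add (by positivity) hd0.le, ← ENNReal.ofReal_mul (by positivity),
          ENNReal.ofReal_add (by positivity) (by positivity)]
        congr 1
        rw [Finset.sum_const, nsmul_eq_mul, Finset.card_univ, Fintype.card_fin,
          ENNReal.ofReal_mul hd0.le, ENNReal.ofReal_natCast]
    _ ≤ _ := by
        refine ENNReal.ofReal_le_ofReal ?_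
        have := fluct_pos (d := d) (by omega)
        calc _ = 5 * (w * d) * Real.sqrt (Real.log d) + 2 * (w * d) := by ring
          _ ≤ _ := by rw [hwd]; nlinarith

/-- Each of the at most `3 d⁴` exponentials has mean at most `exp 8`; the weight `d^{-5}` absorbs
their number. -/
theorem lintegral_gridBound_le {d : ℕ} (hd : 4 ≤ d) (θ : Fin d → ℝ) :
    ∫⁻ z, ENNReal.ofReal (gridBound θ z) ∂(noise d) ≤
      ENNReal.ofReal (scale d * (5 * Real.log d + 3 * Real.exp 8)) := by
  have hd1 : (1 : ℝ) ≤ d := by exact_mod_cast (show 1 ≤ d by omega)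
  have hs := scale_pos hd
  have hlog := one_le_log hd
  have hm : ∀ j : ℕ × ℕ, Measurable fun z : Fin d → ℝ =>
      ENNReal.ofReal (Real.exp ((scale d)⁻¹ * totalError θ j.1 (j.2 / d) z)) := fun j => by
    have := measurable_totalError θ j.1 (j.2 / d)
    fun_prop
  have e : ∀ z, ENNReal.ofReal (gridBound θ z) =
      ENNReal.ofReal (scale d) * (ENNReal.ofReal (5 * Real.log d) + ENNReal.ofReal ((d : ℝ) ^ 5)⁻¹ *
      ∑ j ∈ searchGrid d, ENNReal.ofReal
        (Real.exp ((scale d)⁻¹ * totalError θ j.1 (j.2 / d) z))) := fun z => by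
    have : 0 ≤ ∑ j ∈ searchGrid d, Real.exp ((scale d)⁻¹ * totalError θ j.1 (j.2 / d) z) :=
      Finset.sum_nonneg fun _ _ => (Real.exp_pos _).le
    rw [gridBound, ENNReal.ofReal_mul hs.le, ENNReal.ofReal_add (by positivity) (by positivity),
      ENNReal.ofReal_mul (p := ((d : ℝ) ^ 5)⁻¹) (by positivity),
      ENNReal.ofReal_sum_of_nonneg fun _ _ => (Real.exp_pos _).le]
  simp_rw [e]
  rw [lintegral_const_mul' _ _ ENNReal.ofReal_ne_top, lintegral_add_left measurable_const,
    lintegral_const_mul' _ _ ENNReal.ofReal_ne_top, lintegral_finsetSum _ fun j _ => hm j]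
  have h1 : ∀ j ∈ searchGrid d, ∫⁻ z, ENNReal.ofReal (Real.exp ((scale d)⁻¹ *
      totalError θ j.1 (j.2 / d) z)) ∂(noise d) ≤ ENNReal.ofReal (Real.exp 8) := fun j hj => by
    rw [mem_searchGrid] at hj
    obtain ⟨⟨⟨a1, -⟩, a2, -⟩, a3, a4⟩ := hj
    have : (0 : ℝ) < j.2 := by exact_mod_cast a2
    exact lintegral_exp_totalError_le hd a1 a3 θ (by positivity) a4
      (abs_of_pos (inv_pos.2 hs))
  calc _ ≤ ENNReal.ofReal (scale d) * (ENNReal.ofReal (5 * Real.log d) +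
        ENNReal.ofReal ((d : ℝ) ^ 5)⁻¹ * ∑ _j ∈ searchGrid d, ENNReal.ofReal (Real.exp 8)) := by
        simp only [lintegral_const, measure_univ, mul_one]
        gcongr with j hj
        exact h1 j hj
    _ = ENNReal.ofReal (scale d * (5 * Real.log d + ((d : ℝ) ^ 5)⁻¹ *
        ((searchGrid d).card * Real.exp 8))) := by
        rw [ENNReal.ofReal_mul hs.le, ENNReal.ofReal_add (by positivity) (by positivity),
          ENNReal.ofReal_mul (p := ((d : ℝ) ^ 5)⁻¹) (by positivity), Finset.sum_const, nsmul_eq_mul,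
          ENNReal.ofReal_mul (Nat.cast_nonneg _), ENNReal.ofReal_natCast]
    _ ≤ _ := by
        refine ENNReal.ofReal_le_ofReal (mul_le_mul_of_nonneg_left (add_le_add le_rfl ?_) hs.le)
        have hc : ((searchGrid d).card : ℝ) ≤ 3 * d ^ 4 := by exact_mod_cast card_searchGrid_le d
        calc ((d : ℝ) ^ 5)⁻¹ * ((searchGrid d).card * Real.exp 8)
            ≤ ((d : ℝ) ^ 5)⁻¹ * (3 * d ^ 5 * Real.exp 8) := by
              gcongr
              exact hc.trans (by gcongr; norm_num)
          _ = _ := by field_simp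

/-! ### The loss identity and the oracle inequality -/

theorem blockJS_eq_sub_shrink {d L b : ℕ} {lam : ℝ} (x : Fin d → ℝ) {i : Fin d}
    (hi : i ∈ block d L b) : blockJS lam L x i = x i - shrink lam (energy x L b) * x i := by
  have hE := sq_le_energy x hi
  rw [blockJS, mem_block.1 hi]
  rcases (energy_nonneg x L b).eq_or_lt with h | h
  · have : x i = 0 := by
      rw [← h] at hE
      exact pow_eq_zero_iff two_ne_zero |>.1 (le_antisymm hE (sq_nonneg _))
    simp [this]
  · rcases le_or_gt (energy x L b) lam with h1 | h1
    · rw [shrink_of_le (h.trans_le h1) h1, max_eq_right (by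
        rw [sub_nonpos, one_le_div h]; exact h1)]
      ring
    · rw [shrink_of_lt h1, max_eq_left (by rw [sub_nonneg, div_le_one h]; exact h1.le)]
      ring

theorem loss_block_eq {d L b : ℕ} {lam : ℝ} (h0 : 0 ≤ lam) (θ z : Fin d → ℝ) :
    ∑ i ∈ block d L b, (blockJS lam L (θ + z) i - θ i) ^ 2 =
      sureTerm (block d L b).card (energy (θ + z) L b) lam +
        (energy z L b - (block d L b).card) + 2 * sureError θ L b lam z := by
  set k := shrink lam (energy (θ + z) L b) with hk
  have e : ∑ i ∈ block d L b, (blockJS lam L (θ + z) i - θ i) ^ 2 =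
      energy z L b - 2 * k * cross θ L b z + k ^ 2 * energy (θ + z) L b := by
    rw [energy, cross, energy, Finset.mul_sum, Finset.mul_sum, ← Finset.sum_sub_distrib,
      ← Finset.sum_add_distrib]
    refine Finset.sum_congr rfl fun i hi => ?_
    rw [blockJS_eq_sub_shrink _ hi, ← hk, Pi.add_apply]
    ring
  rw [e, sureError, ← hk, sureTerm]
  rcases lt_or_ge lam (energy (θ + z) L b) with h | h
  · rw [if_pos h, if_pos h, if_neg h.not_ge, hk, shrink_of_lt h]
    have : 0 < energy (θ + z) L b := h0.trans_lt h
    field_simp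
    ring
  · rw [if_neg h.not_gt, if_neg h.not_gt, if_pos h]
    -- For `lam = 0` the factor `shrink` has the default value 0 instead of 1; harmless, because
    -- then the block energy and the cross term vanish.
    rcases h0.eq_or_lt with h1 | h1
    · have hS : energy (θ + z) L b = 0 := le_antisymm (h1 ▸ h) (energy_nonneg _ _ _)
      have hc := abs_cross_le θ L b z
      rw [hS, Real.sqrt_zero, mul_zero] at hc
      rw [abs_nonpos_iff.1 hc, hS]
      ring
    · rw [hk, shrink_of_le h1 h]
      ring

/-- The quadratic loss. -/
noncomputable def loss {d : ℕ} (est : (Fin d → ℝ) → Fin d → ℝ) (θ z : Fin d → ℝ) : ℝ :=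
  ∑ i, (est (θ + z) i - θ i) ^ 2

theorem loss_nonneg {d : ℕ} (est : (Fin d → ℝ) → Fin d → ℝ) (θ z : Fin d → ℝ) :
    0 ≤ loss est θ z := Finset.sum_nonneg fun _ _ => sq_nonneg _

theorem loss_blockJS_eq {d L : ℕ} (hL : 1 ≤ L) {lam : ℝ} (h0 : 0 ≤ lam) (θ z : Fin d → ℝ) :
    loss (blockJS lam L) θ z = sure (θ + z) lam L + (∑ i, z i ^ 2 - d) +
      2 * totalError θ L lam z := by
  have hc : ∑ b ∈ Finset.range (numBlocks d L), ((block d L b).card : ℝ) = d := by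
    have := sum_blocks (d := d) (L := L) hL (fun _ => (1 : ℝ))
    simpa using this
  rw [loss, ← sum_blocks hL, Finset.sum_congr rfl fun b _ => loss_block_eq h0 θ z,
    Finset.sum_add_distrib, Finset.sum_add_distrib, Finset.sum_sub_distrib, sum_energy hL, hc,
    ← Finset.mul_sum, sure, totalError]

/-- A pointwise oracle inequality for the estimator in the dense case. -/
theorem loss_dense_le {d : ℕ} (hd : 4 ≤ d) {est : (Fin d → ℝ) → Fin d → ℝ} (he : IsSureBlock est)
    {lam : ℝ} {L : ℕ} (hq : (lam, L) ∈ searchRange d) (θ z : Fin d → ℝ)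
    (h : gammaLevel d < energyStat (θ + z)) :
    loss est θ z ≤ loss (blockJS lam L) θ z + (2 * (gridBound θ z + slackBound θ z) +
      2 * (scale d * Real.exp (-(scale d)⁻¹ * totalError θ L lam z))) := by
  obtain ⟨q, hqs, hmin, hest⟩ := he.dense _ h
  have hmin' : sure (θ + z) q.1 q.2 ≤ sure (θ + z) lam L := isMinOn_iff.1 hmin (lam, L) hq
  have e1 : loss est θ z = loss (blockJS q.1 q.2) θ z := by rw [loss, hest, loss]
  have h1 : 0 ≤ q.1 := (le_max_right _ _).trans hqs.1
  have h2 : 0 ≤ lam := (le_max_right _ _).trans hq.1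
  have hs := scale_pos hd
  -- At the fixed comparator no maximum is taken, so `y ≤ exp y` and one exponential moment of
  -- opposite sign suffice.
  have e2 : -totalError θ L lam z ≤
      scale d * Real.exp (-(scale d)⁻¹ * totalError θ L lam z) := by
    have := Real.add_one_le_exp (-(scale d)⁻¹ * totalError θ L lam z)
    have h3 := mul_le_mul_of_nonneg_left this hs.le
    have h4 : scale d * (-(scale d)⁻¹ * totalError θ L lam z + 1) =
        -totalError θ L lam z + scale d := by field_simp
    linarith
  have h3 := totalError_le_of_mem_searchRange hd θ z hqs
  rw [e1, loss_blockJS_eq hqs.2.2.1 h1, loss_blockJS_eq hq.2.2.1 h2]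
  linarith

/-- The size `d ^ {3/4} (log d) ^ {5/2}` of the error term (before averaging). -/
noncomputable def errTerm (d : ℕ) : ℝ := fluct d * Real.log d ^ (5 / 2 : ℝ)

theorem log_rpow_eq {d : ℕ} (hd : 4 ≤ d) :
    Real.log d ^ (5 / 2 : ℝ) = Real.sqrt (Real.log d) ^ 5 := by
  have := one_le_log hd
  rw [Real.sqrt_eq_rpow, ← Real.rpow_natCast, ← Real.rpow_mul (by linarith)]
  norm_num

/-- Converts powers of `√(log d)` into the stated error. The estimates use `k ≤ 3` only, leaving a
spare factor `log d`. -/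
theorem fluct_mul_pow_le {d : ℕ} (hd : 4 ≤ d) {k : ℕ} (hk : k ≤ 5) :
    fluct d * Real.sqrt (Real.log d) ^ k ≤ errTerm d := by
  have := fluct_pos (d := d) (by omega)
  rw [errTerm, log_rpow_eq hd]
  exact mul_le_mul_of_nonneg_left (pow_le_pow_right₀ (one_le_sqrt_log hd) hk) this.le

theorem sqrt_le_errTerm {d : ℕ} (hd : 4 ≤ d) : Real.sqrt d ≤ errTerm d := by
  have := fluct_mul_pow_le hd (k := 0) (by norm_num)
  have h2 := sqrt_le_fluct (d := d) (by omega)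
  simp at this
  linarith

theorem one_le_errTerm {d : ℕ} (hd : 4 ≤ d) : 1 ≤ errTerm d := by
  refine le_trans ?_ (sqrt_le_errTerm hd)
  rw [Real.one_le_sqrt]
  exact_mod_cast (show 1 ≤ d by omega)

theorem measurable_garrote {d : ℕ} : Measurable (garrote (d := d)) := by
  unfold garrote
  fun_prop

theorem measurable_energyStat {d : ℕ} (θ : Fin d → ℝ) :
    Measurable fun z => energyStat (θ + z) := by
  unfold energyStat
  simp only [Pi.add_apply]
  fun_prop

theorem measurable_loss {d : ℕ} {est : (Fin d → ℝ) → Fin d → ℝ} (he : Measurable est)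
    (θ : Fin d → ℝ) : Measurable (loss est θ) := by
  unfold loss
  fun_prop

/-- The loss of the garrote on the event that it is used. -/
noncomputable def sparseLoss {d : ℕ} (θ z : Fin d → ℝ) : ℝ :=
  if energyStat (θ + z) ≤ gammaLevel d then loss garrote θ z else 0

theorem measurable_sparseLoss {d : ℕ} (θ : Fin d → ℝ) : Measurable (sparseLoss θ) :=
  Measurable.ite (measurableSet_le (measurable_energyStat θ) measurable_const)
    (measurable_loss measurable_garrote θ) measurable_const

theorem measurable_gridBound {d : ℕ} (θ : Fin d → ℝ) : Measurable (gridBound θ) := by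
  have := fun j : ℕ × ℕ => measurable_totalError θ j.1 (j.2 / d)
  unfold gridBound
  fun_prop

theorem measurable_slackBound {d : ℕ} (θ : Fin d → ℝ) : Measurable (slackBound θ) := by
  unfold slackBound
  refine Measurable.add (by fun_prop) (Finset.measurable_sum _ fun i _ => ?_)
  exact Measurable.ite (measurableSet_le (by fun_prop) (by fun_prop))
      measurable_const measurable_const

/-- `loss_dense_le` holds on the dense event; adding the garrote loss on the other event makes it
hold everywhere. The comparator needs `0 < lam` for the centring of its error. -/
theorem lintegral_loss_le {d : ℕ} (hd : 4 ≤ d) {est : (Fin d → ℝ) → Fin d → ℝ}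
    (he : IsSureBlock est) {lam : ℝ} {L : ℕ} (hq : (lam, L) ∈ searchRange d) (hlam : 0 < lam)
    (θ : Fin d → ℝ) :
    ∫⁻ z, ENNReal.ofReal (loss est θ z) ∂(noise d) ≤
      ∫⁻ z, ENNReal.ofReal (loss (blockJS lam L) θ z) ∂(noise d) +
        ENNReal.ofReal ((200 + 200 * Real.exp 8) * errTerm d) +
        ∫⁻ z, ENNReal.ofReal (sparseLoss θ z) ∂(noise d) := by
  have hs := scale_pos hd
  have hlog := one_le_log hd
  have hf := fluct_pos (d := d) (by omega)
  have hp : ∀ z, ENNReal.ofReal (loss est θ z) ≤ ENNReal.ofReal (loss (blockJS lam L) θ z) +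
      (2 * (ENNReal.ofReal (gridBound θ z) + ENNReal.ofReal (slackBound θ z)) +
        ENNReal.ofReal (2 * scale d) *
          ENNReal.ofReal (Real.exp (-(scale d)⁻¹ * totalError θ L lam z))) +
      ENNReal.ofReal (sparseLoss θ z) := fun z => by
    have a1 := gridBound_nonneg hd θ z
    have a2 := slackBound_nonneg θ z
    have a3 := loss_nonneg (blockJS lam L) θ z
    have a4 : 0 ≤ sparseLoss θ z := by
      unfold sparseLoss; split_ifs
      exacts [loss_nonneg _ _ _, le_rfl]
    have e2 : (2 : ℝ≥0∞) = ENNReal.ofReal 2 := by simp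
    rw [e2, ← ENNReal.ofReal_add a1 a2, ← ENNReal.ofReal_mul (by norm_num),
      ← ENNReal.ofReal_mul (by positivity), ← ENNReal.ofReal_add (by positivity) (by positivity),
      ← ENNReal.ofReal_add (by positivity) (by positivity),
      ← ENNReal.ofReal_add (by positivity) (by positivity)]
    refine ENNReal.ofReal_le_ofReal ?_
    rcases le_or_gt (energyStat (θ + z)) (gammaLevel d) with h | h
    · have : loss est θ z = sparseLoss θ z := by
        rw [sparseLoss, if_pos h, loss, he.sparse _ h, loss]
      rw [this]
      have : 0 ≤ loss (blockJS lam L) θ z + (2 * (gridBound θ z + slackBound θ z) +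
          2 * scale d * Real.exp (-(scale d)⁻¹ * totalError θ L lam z)) := by positivity
      linarith
    · have := loss_dense_le hd he hq θ z h
      rw [mul_assoc 2 (scale d)]
      linarith
  have hmt := measurable_totalError θ L lam
  have hmg := measurable_gridBound θ
  have hms := measurable_slackBound θ
  have hmp := measurable_sparseLoss θ
  refine (lintegral_mono hp).trans ?_
  rw [lintegral_add_right _ (by fun_prop), lintegral_add_right _ (by fun_prop),
    lintegral_add_right _ (by fun_prop), lintegral_const_mul _ (by fun_prop),
    lintegral_const_mul _ (by fun_prop), lintegral_add_right _ (by fun_prop)]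
  refine add_le_add (add_le_add le_rfl ?_) le_rfl
  have hexp := lintegral_exp_totalError_le hd hq.2.2.1 hq.2.2.2 θ (t := -(scale d)⁻¹) hlam
    (hq.2.1.trans (by have := hq.2.2.1; gcongr; norm_num)) (by
      rw [abs_neg, abs_of_pos (inv_pos.2 hs)]; rfl)
  have h1 := lintegral_gridBound_le hd θ
  have h2 := lintegral_slackBound_le hd θ
  have e2 : (2 : ℝ≥0∞) = ENNReal.ofReal 2 := by simp
  calc _ ≤ 2 * (ENNReal.ofReal (scale d * (5 * Real.log d + 3 * Real.exp 8)) +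
        ENNReal.ofReal (7 * fluct d * Real.sqrt (Real.log d))) +
        ENNReal.ofReal (2 * scale d) * ENNReal.ofReal (Real.exp 8) := by gcongr
    _ = ENNReal.ofReal (2 * (scale d * (5 * Real.log d + 3 * Real.exp 8) +
        7 * fluct d * Real.sqrt (Real.log d)) + 2 * scale d * Real.exp 8) := by
        rw [e2, ← ENNReal.ofReal_add (by positivity) (by positivity),
          ← ENNReal.ofReal_mul (by norm_num), ← ENNReal.ofReal_mul (by positivity),
          ← ENNReal.ofReal_add (by positivity) (by positivity)]
    _ ≤ _ := by
        refine ENNReal.ofReal_le_ofReal ?_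
        have b1 := fluct_mul_pow_le hd (k := 1) (by norm_num)
        have b3 := fluct_mul_pow_le hd (k := 3) (by norm_num)
        have hl2 : Real.sqrt (Real.log d) ^ 2 = Real.log d := Real.sq_sqrt (by linarith)
        have hE := Real.exp_pos 8
        rw [pow_one] at b1
        rw [pow_succ, hl2] at b3
        have b1' := mul_le_mul_of_nonneg_left b1 hE.le
        have e0 := one_le_errTerm hd
        unfold scale
        nlinarith

/-! ### The pretest: cost of each branch -/

theorem log_two_bounds : 1 / 2 ≤ Real.log 2 ∧ Real.log 2 ≤ 1 :=
  ⟨by linarith [Real.log_two_gt_d9], by linarith [Real.log_two_lt_d9]⟩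

theorem log_le_logb {d : ℕ} (hd : 4 ≤ d) : Real.log d ≤ Real.logb 2 d := by
  have := one_le_log hd
  rw [Real.logb, le_div_iff₀ (by linarith [log_two_bounds.1])]
  nlinarith [log_two_bounds.2]

theorem logb_le_log {d : ℕ} (hd : 4 ≤ d) : Real.logb 2 d ≤ 2 * Real.log d := by
  have := one_le_log hd
  rw [Real.logb, div_le_iff₀ (by linarith [log_two_bounds.1])]
  nlinarith [log_two_bounds.1]

theorem mul_gammaLevel {d : ℕ} (hd : 4 ≤ d) :
    d * gammaLevel d = Real.sqrt d * Real.sqrt (Real.logb 2 d) ^ 3 := by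
  have hd0 : (0 : ℝ) < d := by exact_mod_cast (show 0 < d by omega)
  have hb : 0 ≤ Real.logb 2 d := by linarith [log_le_logb hd, one_le_log hd]
  rw [gammaLevel, ← mul_assoc]
  congr 1
  · nth_rw 1 [← Real.rpow_one (d : ℝ)]
    rw [← Real.rpow_add hd0, Real.sqrt_eq_rpow]; norm_num
  · rw [Real.sqrt_eq_rpow, ← Real.rpow_natCast, ← Real.rpow_mul hb]; norm_num

theorem mul_gammaLevel_le {d : ℕ} (hd : 4 ≤ d) : d * gammaLevel d ≤ 3 * errTerm d := by
  rw [mul_gammaLevel hd]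
  have hlog := one_le_log hd
  have h1 : Real.sqrt (Real.logb 2 d) ≤ Real.sqrt 2 * Real.sqrt (Real.log d) := by
    rw [← Real.sqrt_mul (by norm_num)]; exact Real.sqrt_le_sqrt (logb_le_log hd)
  have h2 : Real.sqrt 2 ≤ 1.43 := by rw [Real.sqrt_le_left (by norm_num)]; norm_num
  have h3 := fluct_mul_pow_le hd (k := 3) (by norm_num)
  have h4 : Real.sqrt 2 ^ 3 ≤ 3 := by
    calc _ ≤ (1.43 : ℝ) ^ 3 := by gcongr
      _ ≤ 3 := by norm_num
  calc _ ≤ fluct d * (Real.sqrt 2 * Real.sqrt (Real.log d)) ^ 3 := by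
        have := sqrt_le_fluct (d := d) (by omega)
        have := (fluct_pos (d := d) (by omega)).le
        gcongr
    _ = Real.sqrt 2 ^ 3 * (fluct d * Real.sqrt (Real.log d) ^ 3) := by ring
    _ ≤ 3 * errTerm d := by
        have := (fluct_pos (d := d) (by omega)).le
        gcongr

/-- The observed energy minus `d`. -/
theorem mul_energyStat {d : ℕ} (hd : 4 ≤ d) (x : Fin d → ℝ) :
    d * energyStat x = ∑ i, (x i ^ 2 - 1) := by
  have hd0 : (d : ℝ) ≠ 0 := by exact_mod_cast (show d ≠ 0 by omega)
  rw [energyStat, mul_inv_cancel_left₀ hd0]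

theorem loss_le_of_abs_le {d : ℕ} (hd : 4 ≤ d) {est : (Fin d → ℝ) → Fin d → ℝ} {θ z : Fin d → ℝ}
    (h : ∀ i, |est (θ + z) i| ≤ |(θ + z) i|) :
    loss est θ z ≤ 2 * (d * energyStat (θ + z) + d) + 2 * ∑ i, θ i ^ 2 := by
  have e : d * energyStat (θ + z) + d = ∑ i, (θ + z) i ^ 2 := by
    rw [mul_energyStat hd, Finset.sum_sub_distrib]; simp
  rw [e, Finset.mul_sum, Finset.mul_sum, ← Finset.sum_add_distrib]
  refine Finset.sum_le_sum fun i _ => ?_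
  have := sq_le_sq.2 (h i)
  nlinarith [sq_nonneg (est (θ + z) i + θ i)]

theorem abs_max_mul_le {t : ℝ} (ht : 0 ≤ t) (x : ℝ) : |max (1 - t) 0 * x| ≤ |x| := by
  rw [abs_mul, abs_of_nonneg (le_max_right _ _)]
  exact mul_le_of_le_one_left (abs_nonneg _) (max_le (by linarith) zero_le_one)

theorem abs_garrote_le {d : ℕ} (x : Fin d → ℝ) (i : Fin d) : |garrote x i| ≤ |x i| := by
  refine abs_max_mul_le ?_ _
  have : 0 ≤ Real.log d := Real.log_natCast_nonneg d
  positivity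

theorem abs_blockJS_le {d : ℕ} {lam : ℝ} (h : 0 ≤ lam) (L : ℕ) (x : Fin d → ℝ) (i : Fin d) :
    |blockJS lam L x i| ≤ |x i| :=
  abs_max_mul_le (div_nonneg h (energy_nonneg _ _ _)) _

theorem lintegral_loss_garrote1 {d : ℕ} {lam : ℝ} (hlam : 0 ≤ lam) (θ : Fin d → ℝ) :
    ∫⁻ z, ENNReal.ofReal (loss (fun x i => garrote1 lam (x i)) θ z) ∂(noise d) =
      ENNReal.ofReal (∑ i, garroteRisk lam (θ i)) := by
  have hm := measurable_garrote1 lam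
  simp_rw [loss, garroteRisk]
  rw [ENNReal.ofReal_sum_of_nonneg fun i _ => integral_nonneg fun _ => sq_nonneg _]
  simp_rw [fun z => ENNReal.ofReal_sum_of_nonneg (s := Finset.univ)
    (f := fun i => (garrote1 lam ((θ + z) i) - θ i) ^ 2) fun _ _ => sq_nonneg _, Pi.add_apply]
  rw [lintegral_finsetSum _ fun i _ => by fun_prop]
  refine Finset.sum_congr rfl fun i _ => ?_
  rw [lintegral_comp_apply_noise i (f := fun u =>
    ENNReal.ofReal ((garrote1 lam (θ i + u) - θ i) ^ 2)) (by fun_prop),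
    ofReal_integral_eq_lintegral_ofReal _ (ae_of_all _ fun _ => sq_nonneg _)]
  have := integrable_garrote1_loss (Real.sqrt_nonneg lam) (θ i)
  rwa [Real.sq_sqrt hlam] at this

theorem lintegral_loss_garrote {d : ℕ} (θ : Fin d → ℝ) :
    ∫⁻ z, ENNReal.ofReal (loss garrote θ z) ∂(noise d) =
      ENNReal.ofReal (∑ i, garroteRisk (2 * Real.log d) (θ i)) :=
  lintegral_loss_garrote1 (mul_nonneg zero_le_two (Real.log_natCast_nonneg d)) θ

theorem exp_neg_sqrt_two_log {d : ℕ} (hd : 1 ≤ d) :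
    Real.exp (-Real.sqrt (2 * Real.log d) ^ 2 / 2) = (d : ℝ)⁻¹ := by
  have hd0 : (0 : ℝ) < d := by exact_mod_cast hd
  have hlog : 0 ≤ Real.log d := Real.log_natCast_nonneg d
  rw [Real.sq_sqrt (by positivity), show -(2 * Real.log d) / 2 = -Real.log d by ring, Real.exp_neg,
    Real.exp_log hd0]

theorem sum_garroteRisk_le {d : ℕ} (hd : 4 ≤ d) (θ : Fin d → ℝ) :
    ∑ i, garroteRisk (2 * Real.log d) (θ i) ≤ 18 * ∑ i, θ i ^ 2 + 128 := by
  have hd0 : (0 : ℝ) < d := by exact_mod_cast (show 0 < d by omega)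
  have hlog := one_le_log hd
  have hs : Real.sqrt (2 * Real.log d) ^ 2 = 2 * Real.log d := Real.sq_sqrt (by positivity)
  calc _ ≤ ∑ i, (18 * θ i ^ 2 + 128 * (d : ℝ)⁻¹) := Finset.sum_le_sum fun i _ => by
        have := garroteRisk_le_sq_add (Real.sqrt_nonneg (2 * Real.log d)) (θ i)
        rwa [exp_neg_sqrt_two_log (by omega), hs] at this
    _ = _ := by
        rw [Finset.sum_add_distrib, ← Finset.mul_sum, Finset.sum_const, nsmul_eq_mul]
        simp only [Finset.card_univ, Fintype.card_fin]
        field_simp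

/-- The contribution of the garrote to the risk is always small. -/
theorem lintegral_sparseLoss_le {d : ℕ} (hd : 4 ≤ d) (θ : Fin d → ℝ) :
    ∫⁻ z, ENNReal.ofReal (sparseLoss θ z) ∂(noise d) ≤ ENNReal.ofReal (300 * errTerm d) := by
  have hdN : (4 : ℝ) ≤ d := by exact_mod_cast hd
  have hd0 : (0 : ℝ) < d := by linarith
  have hgam := mul_gammaLevel_le hd
  have hge := mul_gammaLevel hd
  have herr := one_le_errTerm hd
  have hserr := sqrt_le_errTerm hd
  have hlog := one_le_log hd
  have hl := one_le_sqrt_log hd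
  set q := ∑ i, θ i ^ 2 with hq
  have hq0 : 0 ≤ q := Finset.sum_nonneg fun _ _ => sq_nonneg _
  -- Weak signals: the garrote risk `18 q + 128` is itself below the error term. Strong signals: the
  -- pretest rarely selects the garrote.
  rcases lt_or_ge q (3 * (d * gammaLevel d)) with h | h
  · calc _ ≤ ∫⁻ z, ENNReal.ofReal (loss garrote θ z) ∂(noise d) := by
          refine lintegral_mono fun z => ENNReal.ofReal_le_ofReal ?_
          rw [sparseLoss]; split_ifs
          exacts [le_rfl, loss_nonneg _ _ _]
      _ ≤ _ := by
          rw [lintegral_loss_garrote]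
          refine ENNReal.ofReal_le_ofReal ((sum_garroteRisk_le hd θ).trans ?_)
          linarith
  · have hr0 : 0 < Real.sqrt d := Real.sqrt_pos.2 hd0
    have hr2 : Real.sqrt d ^ 2 = d := Real.sq_sqrt hd0.le
    have hr : 2 ≤ Real.sqrt d := Real.le_sqrt_of_sq_le (by linarith)
    set r := Real.sqrt d
    -- Chernoff rate for the lower tail: the variance term `2 s² d` is the constant `1/2`. Since `d
    -- γ_d ≤ q / 3` while the drift is at least `2/3 s q`, the exponent is at most `1/2 - s q / 3`.
    set s : ℝ := 1 / (2 * r) with hs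
    have hs0 : 0 < s := by positivity
    have hs4 : s ≤ 1 / 4 := one_div_le_one_div_of_le (by norm_num) (by linarith)
    have hp : ∀ z, sparseLoss θ z ≤ (2 * d + 3 * q) * Real.exp (s * (d * gammaLevel d)) *
        Real.exp (-s * ∑ i, ((θ i + z i) ^ 2 - 1)) := fun z => by
      rw [sparseLoss]
      split_ifs with hz
      · have h1 := loss_le_of_abs_le hd (est := garrote) (θ := θ) (z := z)
          fun i => abs_garrote_le _ i
        have h2 : d * energyStat (θ + z) ≤ d * gammaLevel d := by gcongr
        rw [mul_assoc, ← Real.exp_add]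
        have e1 : ∑ i, ((θ i + z i) ^ 2 - 1) = d * energyStat (θ + z) := by
          rw [mul_energyStat hd]; rfl
        have h3 : 1 ≤ Real.exp (s * (d * gammaLevel d) + -s * ∑ i, ((θ i + z i) ^ 2 - 1)) := by
          rw [Real.one_le_exp_iff, e1]; nlinarith
        have h4 : loss garrote θ z ≤ 2 * d + 3 * q := by linarith
        nlinarith
      · positivity
    have hexp := lintegral_exp_sum_sq_le θ Finset.univ (s := -s)
      (by rw [abs_neg, abs_of_pos hs0]; exact hs4)
    refine (lintegral_mono fun z => ENNReal.ofReal_le_ofReal (hp z)).trans ?_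
    simp_rw [fun z : Fin d → ℝ => ENNReal.ofReal_mul (q := Real.exp (-s * ∑ i, ((θ i + z i) ^ 2 - 1)))
      (show 0 ≤ (2 * d + 3 * q) * Real.exp (s * (d * gammaLevel d)) by positivity)]
    rw [lintegral_const_mul' _ _ ENNReal.ofReal_ne_top]
    refine (mul_le_mul_right hexp _).trans ?_
    rw [← ENNReal.ofReal_mul (by positivity), mul_assoc, ← Real.exp_add]
    refine ENNReal.ofReal_le_ofReal ?_
    have e1 : ∑ i, (2 * (-s) ^ 2 + -s * θ i ^ 2 / (1 - 2 * -s)) =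
        2 * s ^ 2 * d - s / (1 + 2 * s) * q := by
      have e2 : ∀ i, 2 * (-s) ^ 2 + -s * θ i ^ 2 / (1 - 2 * -s) =
          2 * s ^ 2 - s / (1 + 2 * s) * θ i ^ 2 := fun i => by
        rw [show 1 - 2 * -s = 1 + 2 * s by ring]; ring
      rw [Finset.sum_congr rfl fun i _ => e2 i, Finset.sum_sub_distrib, hq, Finset.mul_sum,
        Finset.sum_const, nsmul_eq_mul]
      simp only [Finset.card_univ, Fintype.card_fin]
      ring
    rw [e1]
    have h2 : 2 * s ^ 2 * d = 1 / 2 := by rw [hs, ← hr2]; field_simp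
    have h3 : 2 / 3 * s ≤ s / (1 + 2 * s) := by
      rw [le_div_iff₀ (by positivity)]; nlinarith
    set y := q / r with hy
    have hqy : q = r * y := by rw [hy]; field_simp
    have hsq : s * q = y / 2 := by rw [hqy, hs]; field_simp
    have hy0 : 0 ≤ y := by positivity
    have hyl : 3 * Real.log d ≤ y := by
      rw [hy, le_div_iff₀ hr0]
      have h5 : Real.log d ≤ Real.sqrt (Real.logb 2 d) ^ 3 := by
        have h6 : Real.sqrt (Real.log d) ≤ Real.sqrt (Real.logb 2 d) :=
          Real.sqrt_le_sqrt (log_le_logb hd)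
        calc Real.log d = Real.sqrt (Real.log d) ^ 2 := (Real.sq_sqrt (by linarith)).symm
          _ ≤ Real.sqrt (Real.log d) ^ 3 := pow_le_pow_right₀ hl (by norm_num)
          _ ≤ _ := by gcongr
      nlinarith
    have h4 : s * (d * gammaLevel d) + (2 * s ^ 2 * d - s / (1 + 2 * s) * q) ≤ 1 / 2 - y / 6 := by
      have a1 : s * (3 * (d * gammaLevel d)) ≤ s * q := by gcongr
      have a2 := mul_le_mul_of_nonneg_right h3 hq0
      rw [h2]
      linarith
    have h5 : Real.exp (1 / 2 - y / 6) ≤ 2 * Real.exp (-(y / 6)) := by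
      rw [sub_eq_add_neg, Real.exp_add]
      have := Real.exp_bound_div_one_sub_of_interval (x := 1 / 2) (by norm_num) (by norm_num)
      norm_num at this
      gcongr
    have h6 : y * Real.exp (-(y / 6)) ≤ 6 := by
      have a := Real.add_one_le_exp (y / 6)
      have b : Real.exp (y / 6) * Real.exp (-(y / 6)) = 1 := by rw [← Real.exp_add]; simp
      nlinarith [Real.exp_pos (-(y / 6))]
    have h7 : r * Real.exp (-(y / 6)) ≤ 1 := by
      have a : r = Real.exp (Real.log d / 2) := by
        rw [Real.exp_half, Real.exp_log hd0]
      rw [a, ← Real.exp_add, Real.exp_le_one_iff]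
      linarith
    calc _ ≤ (2 * d + 3 * q) * (2 * Real.exp (-(y / 6))) := by
          refine mul_le_mul_of_nonneg_left ((Real.exp_le_exp.2 h4).trans h5) (by positivity)
      _ = 4 * r * (r * Real.exp (-(y / 6))) + 6 * r * (y * Real.exp (-(y / 6))) := by
          rw [hqy, ← hr2]; ring
      _ ≤ 4 * r * 1 + 6 * r * 6 := by gcongr
      _ ≤ _ := by linarith

theorem abs_est_le {d : ℕ} {est : (Fin d → ℝ) → Fin d → ℝ} (he : IsSureBlock est)
    (x : Fin d → ℝ) (i : Fin d) : |est x i| ≤ |x i| := by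
  rcases le_or_gt (energyStat x) (gammaLevel d) with h | h
  · rw [he.sparse x h]; exact abs_garrote_le x i
  · obtain ⟨q, hq, -, e⟩ := he.dense x h
    rw [e]; exact abs_blockJS_le ((le_max_right _ _).trans hq.1) _ x i

theorem sqrt_logb_pow_le {d : ℕ} (hd : 4 ≤ d) :
    Real.sqrt (Real.logb 2 d) ^ 3 ≤ 7 * Real.sqrt d := by
  have hlog := one_le_log hd
  have hd0 : (0 : ℝ) < d := by exact_mod_cast (show 0 < d by omega)
  have hb := logb_le_log hd
  have hb0 : 0 ≤ Real.logb 2 d := by linarith [log_le_logb hd]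
  have h1 : Real.log d ^ 3 ≤ 6 * d := by
    have := Real.pow_div_factorial_le_exp (Real.log d) (by linarith) 3
    rw [Real.exp_log hd0, div_le_iff₀ (by positivity)] at this
    norm_num [Nat.factorial] at this
    linarith
  refine le_of_pow_le_pow_left₀ two_ne_zero (by positivity) ?_
  calc (Real.sqrt (Real.logb 2 d) ^ 3) ^ 2 = (Real.sqrt (Real.logb 2 d) ^ 2) ^ 3 := by ring
    _ = Real.logb 2 d ^ 3 := by rw [Real.sq_sqrt hb0]
    _ ≤ (2 * Real.log d) ^ 3 := by gcongr
    _ = 8 * Real.log d ^ 3 := by ring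
    _ ≤ 49 * d := by linarith
    _ = (7 * Real.sqrt d) ^ 2 := by rw [mul_pow, Real.sq_sqrt hd0.le]; norm_num

/-- The loss grows linearly with the observed energy, so a probability bound is not enough. A part
`1/d` of the Chernoff rate `s` absorbs this growth, the rest pays for exceeding the level. -/
theorem loss_le_of_dense {d : ℕ} (hd : 4 ≤ d) {est : (Fin d → ℝ) → Fin d → ℝ}
    (he : IsSureBlock est) (θ z : Fin d → ℝ) {s : ℝ} (hsd : 0 ≤ s - 1 / d)
    (hz : gammaLevel d < energyStat (θ + z)) :
    loss est θ z ≤ 2 * (d + ∑ i, θ i ^ 2) * Real.exp (-(s - 1 / d) * (d * gammaLevel d)) *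
        Real.exp (s * ∑ i, ((θ i + z i) ^ 2 - 1)) := by
  have hd0 : (0 : ℝ) < d := by exact_mod_cast (show 0 < d by omega)
  set q := ∑ i, θ i ^ 2 with hq
  have hq0 : 0 ≤ q := Finset.sum_nonneg fun _ _ => sq_nonneg _
  have h1 := loss_le_of_abs_le hd (est := est) (θ := θ) (z := z) fun i => abs_est_le he _ i
  have e1 : ∑ i, ((θ i + z i) ^ 2 - 1) = d * energyStat (θ + z) := by
    rw [mul_energyStat hd]; rfl
  have h2 : d * gammaLevel d ≤ d * energyStat (θ + z) := by gcongr
  have hg : 0 ≤ d * gammaLevel d := by rw [mul_gammaLevel hd]; positivity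
  rw [e1]
  set X := d * energyStat (θ + z)
  have hX : 0 ≤ X := hg.trans h2
  have h3 : d + q + X ≤ (d + q) * Real.exp (1 / d * X) := by
    have h4 : (d + q) * (1 / d * X + 1) = d + q + X + q * (1 / d * X) := by field_simp; ring
    have h5 : 0 ≤ q * (1 / d * X) := by positivity
    have h6 := mul_le_mul_of_nonneg_left (Real.add_one_le_exp (1 / d * X))
      (show 0 ≤ d + q by positivity)
    linarith
  have h6 : Real.exp (1 / d * X) ≤
      Real.exp (-(s - 1 / d) * (d * gammaLevel d)) * Real.exp (s * X) := by
    rw [← Real.exp_add]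
    refine Real.exp_le_exp.2 ?_
    have := mul_le_mul_of_nonneg_left h2 hsd
    have e : s * X = (s - 1 / d) * X + 1 / d * X := by ring
    linarith
  calc loss est θ z ≤ 2 * (d + q + X) := by linarith
    _ ≤ 2 * ((d + q) * Real.exp (1 / d * X)) := by linarith
    _ ≤ 2 * ((d + q) * (Real.exp (-(s - 1 / d) * (d * gammaLevel d)) * Real.exp (s * X))) := by
        gcongr
    _ = _ := by ring

theorem exponent_le {d r w s q : ℝ} (hd : 0 < d) (hr : 0 < r) (hr2 : r ^ 2 = d) (hw : 0 ≤ w)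
    (hw7 : w ^ 3 ≤ 7 * r) (hs0 : 0 < s) (hs4 : s ≤ 1 / 4) (hsr : s * r = 1 / 2) (hq0 : 0 ≤ q)
    (hq : q ≤ r * w ^ 3 / 3) :
    q ≤ 7 / 3 * d ∧
      -(s - 1 / d) * (r * w ^ 3) + (2 * s ^ 2 * d + s * q / (1 - 2 * s)) ≤ 21 - 2 * w ^ 2 := by
  have hrw : r * w ^ 3 ≤ 7 * d := by
    calc r * w ^ 3 ≤ r * (7 * r) := by gcongr
      _ = 7 * d := by rw [← hr2]; ring
  have hs2d : 4 * s ^ 2 * d = 1 := by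
    calc 4 * s ^ 2 * d = 4 * (s * r) ^ 2 := by rw [← hr2]; ring
      _ = 1 := by rw [hsr]; norm_num
  have hqd : q ≤ 7 / 3 * d := by linarith
  refine ⟨hqd, ?_⟩
  have h1 : s * q / (1 - 2 * s) ≤ s * q * (1 + 4 * s) := by
    rw [div_le_iff₀ (by linarith)]
    have : 0 ≤ s * q * (s * (2 - 8 * s)) :=
      mul_nonneg (mul_nonneg hs0.le hq0) (mul_nonneg hs0.le (by linarith))
    linarith [show s * q * (1 + 4 * s) * (1 - 2 * s) = s * q + s * q * (s * (2 - 8 * s)) by ring]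
  have h2 : s * q ≤ w ^ 3 / 6 := by
    calc s * q ≤ s * (r * w ^ 3 / 3) := by gcongr
      _ = s * r * w ^ 3 / 3 := by ring
      _ = _ := by rw [hsr]; ring
  have h3 : 4 * s ^ 2 * q ≤ 7 / 3 := by
    calc 4 * s ^ 2 * q ≤ 4 * s ^ 2 * (7 / 3 * d) := by gcongr
      _ = 7 / 3 * (4 * s ^ 2 * d) := by ring
      _ = _ := by rw [hs2d]; norm_num
  have h4 : 1 / d * (r * w ^ 3) ≤ 7 := by
    rw [one_div, inv_mul_le_iff₀ hd]; linarith
  have h5 : s * (r * w ^ 3) = w ^ 3 / 2 := by rw [← mul_assoc, hsr]; ring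
  -- The drift gives `-w³/2 + w³/6 = -w³/3`. Here `w² = log₂ d` in the application, so a tangent at
  -- `w = 4` turns this into `-2 log₂ d` plus a constant: the exponent `3/2` of the pretest level is
  -- what beats `log d`.
  have h6 : 6 * w ^ 2 - 32 ≤ w ^ 3 := by
    have := mul_nonneg (sq_nonneg (w - 4)) (show 0 ≤ w + 2 by linarith)
    linarith [show (w - 4) ^ 2 * (w + 2) = w ^ 3 - 6 * w ^ 2 + 32 by ring]
  have e1 : -(s - 1 / d) * (r * w ^ 3) = -(s * (r * w ^ 3)) + 1 / d * (r * w ^ 3) := by ring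
  have e2 : s * q * (1 + 4 * s) = s * q + 4 * s ^ 2 * q := by ring
  rw [e1, h5]
  linarith

/-- For very sparse signals, the dense branch contributes little to the risk. -/
theorem lintegral_denseLoss_le {d : ℕ} (hd : 4 ≤ d) {est : (Fin d → ℝ) → Fin d → ℝ}
    (he : IsSureBlock est) {θ : Fin d → ℝ} (hθ : ∑ i, θ i ^ 2 ≤ d * gammaLevel d / 3) :
    ∫⁻ z, ENNReal.ofReal (if gammaLevel d < energyStat (θ + z) then loss est θ z else 0)
      ∂(noise d) ≤ ENNReal.ofReal (8 * Real.exp 21 * (d : ℝ)⁻¹) := by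
  have hdN : (4 : ℝ) ≤ d := by exact_mod_cast hd
  have hd0 : (0 : ℝ) < d := by linarith
  have hlogb := log_le_logb hd
  have hw2 : Real.sqrt (Real.logb 2 d) ^ 2 = Real.logb 2 d :=
    Real.sq_sqrt (by linarith [one_le_log hd])
  set q := ∑ i, θ i ^ 2 with hq
  have hq0 : 0 ≤ q := Finset.sum_nonneg fun _ _ => sq_nonneg _
  have hr0 : 0 < Real.sqrt d := Real.sqrt_pos.2 hd0
  have hr2 : Real.sqrt d ^ 2 = d := Real.sq_sqrt hd0.le
  have hr : 2 ≤ Real.sqrt d := Real.le_sqrt_of_sq_le (by linarith)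
  set s : ℝ := 1 / (2 * Real.sqrt d) with hs
  have hs0 : 0 < s := by positivity
  have hs4 : s ≤ 1 / 4 := one_div_le_one_div_of_le (by norm_num) (by linarith)
  have hsr : s * Real.sqrt d = 1 / 2 := by rw [hs]; field_simp
  have hsd : 0 ≤ s - 1 / d := by
    rw [sub_nonneg, hs]
    refine one_div_le_one_div_of_le (by positivity) ?_
    calc 2 * Real.sqrt d ≤ Real.sqrt d * Real.sqrt d := by gcongr
      _ = d := Real.mul_self_sqrt hd0.le
  obtain ⟨hqd, h7⟩ := exponent_le hd0 hr0 hr2 (Real.sqrt_nonneg _) (sqrt_logb_pow_le hd) hs0 hs4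
    hsr hq0 (mul_gammaLevel hd ▸ hθ)
  rw [← mul_gammaLevel hd, hw2] at h7
  set A := -(s - 1 / d) * (d * gammaLevel d) with hA
  have hp : ∀ z, (if gammaLevel d < energyStat (θ + z) then loss est θ z else 0) ≤
      2 * (d + q) * Real.exp A * Real.exp (s * ∑ i, ((θ i + z i) ^ 2 - 1)) := fun z => by
    split_ifs with hz
    · exact loss_le_of_dense hd he θ z hsd hz
    · positivity
  have hexp := lintegral_exp_sum_sq_le θ Finset.univ (s := s) (by rw [abs_of_pos hs0]; exact hs4)
  have e1 : ∑ i, (2 * s ^ 2 + s * θ i ^ 2 / (1 - 2 * s)) =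
      2 * s ^ 2 * d + s * q / (1 - 2 * s) := by
    rw [Finset.sum_add_distrib, Finset.sum_const, ← Finset.sum_div, hq, Finset.mul_sum]
    simp only [Finset.card_univ, Fintype.card_fin, nsmul_eq_mul]
    ring
  rw [e1] at hexp
  refine (lintegral_mono fun z => ENNReal.ofReal_le_ofReal (hp z)).trans ?_
  simp_rw [fun z : Fin d → ℝ => ENNReal.ofReal_mul (q := Real.exp (s * ∑ i, ((θ i + z i) ^ 2 - 1)))
    (show 0 ≤ 2 * (d + q) * Real.exp A by positivity)]
  rw [lintegral_const_mul' _ _ ENNReal.ofReal_ne_top]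
  refine (mul_le_mul_right hexp _).trans ?_
  rw [← ENNReal.ofReal_mul (by positivity), mul_assoc, ← Real.exp_add]
  refine ENNReal.ofReal_le_ofReal ?_
  have h8 : Real.exp (21 - 2 * Real.log d) = Real.exp 21 * ((d : ℝ) ^ 2)⁻¹ := by
    rw [sub_eq_add_neg, Real.exp_add, Real.exp_neg, two_mul, Real.exp_add, Real.exp_log hd0, pow_two]
  calc _ ≤ 2 * (4 * d) * Real.exp (21 - 2 * Real.log d) := by
        gcongr
        · linarith
        · linarith
    _ = _ := by rw [h8]; field_simp; ring

/-! ### Risk, `ℓ_p` balls, and very sparse signals -/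

/-- The sharp bound needs `√(2 log d) ≥ 6`. Otherwise `d ≤ exp 18`, and the constant is large enough
to dominate the trivial bound 49. -/
theorem garroteRisk_two_log_le {d : ℕ} (hd : 4 ≤ d) (θ : ℝ) :
    garroteRisk (2 * Real.log d) θ ≤
      θ ^ 2 + (100000 + 300 * Real.exp 18) * (d : ℝ)⁻¹ / Real.sqrt (Real.log d) := by
  have hd0 : (0 : ℝ) < d := by exact_mod_cast (show 0 < d by omega)
  have hlog := one_le_log hd
  have hl := one_le_sqrt_log hd
  have hs2 : Real.sqrt (2 * Real.log d) ^ 2 = 2 * Real.log d := Real.sq_sqrt (by positivity)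
  have hE := exp_neg_sqrt_two_log (d := d) (by omega)
  have hsl : Real.sqrt (Real.log d) ≤ Real.sqrt (2 * Real.log d) :=
    Real.sqrt_le_sqrt (by linarith)
  set s := Real.sqrt (2 * Real.log d)
  have hs0 : 0 < s := by linarith
  rw [← hs2]
  rcases le_or_gt 6 s with h | h
  · refine (garroteRisk_le_sharp h θ).trans ?_
    rw [hE]
    gcongr
    linarith [Real.exp_pos 18]
  · refine (garroteRisk_le hs0.le θ).trans ?_
    have h1 : (d : ℝ) ≤ Real.exp 18 := by
      rw [← Real.log_le_iff_le_exp hd0]; nlinarith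
    have h2 : 50 ≤ (100000 + 300 * Real.exp 18) * (d : ℝ)⁻¹ / Real.sqrt (Real.log d) := by
      rw [le_div_iff₀ (by linarith), ← div_eq_mul_inv, le_div_iff₀ hd0]
      have : Real.sqrt (Real.log d) ≤ 6 := by linarith
      have := mul_le_mul this h1 hd0.le (by norm_num)
      linarith
    nlinarith [sq_nonneg θ]

theorem risk_eq_lintegral_loss {d : ℕ} {est : (Fin d → ℝ) → Fin d → ℝ} (he : Measurable est)
    (θ : Fin d → ℝ) :
    risk est θ = (d : ℝ≥0∞)⁻¹ * ∫⁻ z, ENNReal.ofReal (loss est θ z) ∂(noise d) := by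
  rw [risk, ← lintegral_finsetSum _ fun i _ => by fun_prop]
  congr 2
  ext z
  rw [loss, ENNReal.ofReal_sum_of_nonneg fun _ _ => sq_nonneg _]

theorem risk_le_of_lintegral_loss_le {d : ℕ} (hd : 4 ≤ d) {est : (Fin d → ℝ) → Fin d → ℝ}
    (he : Measurable est) {θ : Fin d → ℝ} {B : ℝ}
    (h : ∫⁻ z, ENNReal.ofReal (loss est θ z) ∂(noise d) ≤ ENNReal.ofReal B) :
    risk est θ ≤ ENNReal.ofReal ((d : ℝ)⁻¹ * B) := by
  have hd0 : (0 : ℝ) < d := by exact_mod_cast (show 0 < d by omega)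
  rw [risk_eq_lintegral_loss he, ENNReal.ofReal_mul (by positivity), ENNReal.ofReal_inv_of_pos hd0,
    ENNReal.ofReal_natCast]
  gcongr

theorem sum_rpow_le_of_mem_lpBall {d : ℕ} {p τ : ℝ} (hp : 0 < p) {θ : Fin d → ℝ}
    (h : θ ∈ lpBall d (ENNReal.ofReal p) τ) : ∑ i, |θ i| ^ p ≤ τ ^ p := by
  have hp' : 0 < (ENNReal.ofReal p).toReal := by rwa [ENNReal.toReal_ofReal hp.le]
  have h1 : ‖WithLp.toLp (ENNReal.ofReal p) θ‖ ≤ τ := h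
  rw [PiLp.norm_eq_sum hp', ENNReal.toReal_ofReal hp.le] at h1
  simp only [Real.norm_eq_abs] at h1
  have h0 : 0 ≤ ∑ i, |θ i| ^ p := Finset.sum_nonneg fun _ _ => by positivity
  have := Real.rpow_le_rpow (by positivity) h1 hp.le
  rwa [← Real.rpow_mul h0, one_div, inv_mul_cancel₀ hp.ne', Real.rpow_one] at this

/-- Every `|θ i| ≤ τ`, hence `θ i ^ 2 ≤ |θ i|^p τ^{2-p}`; this works for quasinorms as well. -/
theorem sum_sq_le_of_mem_lpBall {d : ℕ} {p τ : ℝ} (hp : 0 < p) (hp2 : p ≤ 2) (hτ : 0 ≤ τ)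
    {θ : Fin d → ℝ} (h : θ ∈ lpBall d (ENNReal.ofReal p) τ) : ∑ i, θ i ^ 2 ≤ τ ^ 2 := by
  have h1 := sum_rpow_le_of_mem_lpBall hp h
  have h2 : ∀ i, |θ i| ≤ τ := fun i => by
    have : |θ i| ^ p ≤ τ ^ p :=
      (Finset.single_le_sum (f := fun i => |θ i| ^ p) (fun _ _ => by positivity)
        (Finset.mem_univ i)).trans h1
    exact (Real.rpow_le_rpow_iff (abs_nonneg _) hτ hp).1 this
  have e : ∀ x : ℝ, 0 ≤ x → x ^ p * x ^ (2 - p) = x ^ 2 := fun x hx => by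
    rw [← Real.rpow_add_of_nonneg hx hp.le (by linarith), ← Real.rpow_natCast]
    norm_num
  calc ∑ i, θ i ^ 2 = ∑ i, |θ i| ^ p * |θ i| ^ (2 - p) :=
        Finset.sum_congr rfl fun i _ => by rw [e _ (abs_nonneg _), sq_abs]
    _ ≤ ∑ i, |θ i| ^ p * τ ^ (2 - p) := by
        exact Finset.sum_le_sum fun i _ => mul_le_mul_of_nonneg_left
          (Real.rpow_le_rpow (abs_nonneg _) (h2 i) (by linarith)) (by positivity)
    _ = (∑ i, |θ i| ^ p) * τ ^ (2 - p) := by rw [Finset.sum_mul]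
    _ ≤ τ ^ p * τ ^ (2 - p) := by gcongr
    _ = τ ^ 2 := e τ hτ

/-- The power mean inequality with exponent `p / 2` on the squares; for `p = ∞` the factor `d^{2/p}`
is 1 and the coordinatewise bound is summed. -/
theorem sum_sq_mul_le_of_mem_lpBall {d : ℕ} (hd : 1 ≤ d) {p : ℝ≥0∞} {τ : ℝ} (hp : 2 ≤ p)
    (hτ : 0 ≤ τ) {θ : Fin d → ℝ} (h : θ ∈ lpBall d p τ) :
    (∑ i, θ i ^ 2) * (d : ℝ) ^ (2 / p).toReal ≤ d * τ ^ 2 := by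
  have hd0 : (0 : ℝ) < d := by exact_mod_cast hd
  rcases eq_or_ne p ⊤ with rfl | hpt
  · have h2 : ∀ i, |θ i| ≤ τ := fun i =>
      (PiLp.norm_apply_le (WithLp.toLp ⊤ θ) i).trans h
    have : ∑ i, θ i ^ 2 ≤ ∑ _i : Fin d, τ ^ 2 := Finset.sum_le_sum fun i _ => by
      rw [← sq_abs]; exact pow_le_pow_left₀ (abs_nonneg _) (h2 i) 2
    simpa using this
  · obtain ⟨P, hP0, rfl⟩ : ∃ P : ℝ, 0 ≤ P ∧ p = ENNReal.ofReal P :=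
      ⟨p.toReal, ENNReal.toReal_nonneg, (ENNReal.ofReal_toReal hpt).symm⟩
    have hP : 2 ≤ P := by
      have := ENNReal.toReal_mono hpt hp
      rwa [ENNReal.toReal_ofReal hP0] at this
    have hPpos : 0 < P := by linarith
    rw [ENNReal.toReal_div, ENNReal.toReal_ofReal hP0, ENNReal.toReal_ofNat]
    have h1 := sum_rpow_le_of_mem_lpBall hPpos h
    have h2 := Real.rpow_sum_le_const_mul_sum_rpow (s := Finset.univ) (f := fun i => θ i ^ 2)
      (p := P / 2) (by linarith)
    simp only [Finset.card_univ, Fintype.card_fin] at h2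
    have e : ∀ i, |θ i ^ 2| ^ (P / 2) = |θ i| ^ P := fun i => by
      rw [abs_pow, ← Real.rpow_natCast, ← Real.rpow_mul (abs_nonneg _)]
      congr 1; push_cast; ring
    simp_rw [e] at h2
    have hq : ∑ i, |θ i ^ 2| = ∑ i, θ i ^ 2 :=
      Finset.sum_congr rfl fun i _ => abs_of_nonneg (sq_nonneg _)
    rw [hq] at h2
    set q := ∑ i, θ i ^ 2 with hqdef
    have hq0 : 0 ≤ q := Finset.sum_nonneg fun _ _ => sq_nonneg _
    refine (Real.rpow_le_rpow_iff (z := P / 2) (by positivity) (by positivity) (by linarith)).1 ?_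
    have e1 : (τ ^ 2 : ℝ) ^ (P / 2) = τ ^ P := by
      rw [← Real.rpow_natCast, ← Real.rpow_mul hτ]; congr 1; push_cast; ring
    have e2 : ((d : ℝ) ^ (2 / P)) ^ (P / 2) = d := by
      rw [← Real.rpow_mul hd0.le]
      rw [show 2 / P * (P / 2) = 1 by field_simp, Real.rpow_one]
    rw [Real.mul_rpow hq0 (by positivity), Real.mul_rpow hd0.le (by positivity), e1, e2]
    calc q ^ (P / 2) * d ≤ (d : ℝ) ^ (P / 2 - 1) * τ ^ P * d := by
          gcongr
          exact h2.trans (by gcongr)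
      _ = (d : ℝ) ^ (P / 2 - 1) * (d : ℝ) ^ (1 : ℝ) * τ ^ P := by rw [Real.rpow_one]; ring
      _ = _ := by rw [← Real.rpow_add hd0]; congr 2; ring

/-- The risk bound for very sparse signals. -/
theorem risk_le_of_very_sparse {d : ℕ} (hd : 4 ≤ d) {est : (Fin d → ℝ) → Fin d → ℝ}
    (he : IsSureBlock est) {p τ : ℝ} (hp : 0 < p) (hp2 : p ≤ 2) (hτ : 0 ≤ τ)
    (hτd : τ < 1 / Real.sqrt 3 * (d : ℝ) ^ (1 / 4 : ℝ) * Real.logb 2 d ^ (3 / 4 : ℝ))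
    {θ : Fin d → ℝ} (h : θ ∈ lpBall d (ENNReal.ofReal p) τ) :
    risk est θ ≤ ENNReal.ofReal ((d : ℝ)⁻¹ * τ ^ 2 +
      (100000 + 300 * Real.exp 18 + 8 * Real.exp 21) * (d : ℝ)⁻¹ *
        Real.log d ^ (-1 / 2 : ℝ)) := by
  have hdN : (4 : ℝ) ≤ d := by exact_mod_cast hd
  have hd0 : (0 : ℝ) < d := by linarith
  have hlog := one_le_log hd
  have hl := one_le_sqrt_log hd
  have hb0 : 0 ≤ Real.logb 2 d := by linarith [log_le_logb hd]
  have hq := sum_sq_le_of_mem_lpBall hp hp2 hτ h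
  have hq3 : ∑ i, θ i ^ 2 ≤ d * gammaLevel d / 3 := by
    refine hq.trans ?_
    calc τ ^ 2 ≤ (1 / Real.sqrt 3 * (d : ℝ) ^ (1 / 4 : ℝ) * Real.logb 2 d ^ (3 / 4 : ℝ)) ^ 2 := by
          gcongr
      _ = _ := by
          rw [mul_gammaLevel hd, mul_pow, mul_pow, div_pow, Real.sq_sqrt (by norm_num), one_pow,
            ← Real.rpow_natCast ((d : ℝ) ^ (1 / 4 : ℝ)), ← Real.rpow_mul hd0.le, ← Real.rpow_natCast (Real.logb 2 d ^ _),
            ← Real.rpow_mul hb0, Real.sqrt_eq_rpow, Real.sqrt_eq_rpow,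
            ← Real.rpow_natCast (Real.logb 2 d ^ _), ← Real.rpow_mul hb0]
          norm_num
          ring
  have hm := measurable_loss he.measurable θ
  have hp : ∀ z, ENNReal.ofReal (loss est θ z) ≤ ENNReal.ofReal (loss garrote θ z) +
      ENNReal.ofReal (if gammaLevel d < energyStat (θ + z) then loss est θ z else 0) := fun z => by
    rcases le_or_gt (energyStat (θ + z)) (gammaLevel d) with h | h
    · have : loss est θ z = loss garrote θ z := by rw [loss, he.sparse _ h, loss]
      rw [this]; exact le_self_add
    · rw [if_pos h]; exact le_add_self
  have hsum : ∑ i, garroteRisk (2 * Real.log d) (θ i) ≤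
      τ ^ 2 + (100000 + 300 * Real.exp 18) / Real.sqrt (Real.log d) := by
    calc _ ≤ ∑ i, (θ i ^ 2 + (100000 + 300 * Real.exp 18) * (d : ℝ)⁻¹ / Real.sqrt (Real.log d)) :=
          Finset.sum_le_sum fun i _ => garroteRisk_two_log_le hd (θ i)
      _ = ∑ i, θ i ^ 2 + (100000 + 300 * Real.exp 18) / Real.sqrt (Real.log d) := by
          rw [Finset.sum_add_distrib, Finset.sum_const, nsmul_eq_mul]
          simp only [Finset.card_univ, Fintype.card_fin]
          field_simp
      _ ≤ _ := by gcongr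
  have hinv : (d : ℝ)⁻¹ ≤ 1 / Real.sqrt (Real.log d) := by
    rw [← one_div]
    refine one_div_le_one_div_of_le (by linarith) ?_
    have := Real.log_le_sub_one_of_pos hd0
    have := Real.sq_sqrt (show 0 ≤ Real.log d by linarith)
    nlinarith
  have htot : ∫⁻ z, ENNReal.ofReal (loss est θ z) ∂(noise d) ≤ ENNReal.ofReal (τ ^ 2 +
      (100000 + 300 * Real.exp 18 + 8 * Real.exp 21) * (1 / Real.sqrt (Real.log d))) := by
    calc _ ≤ _ := lintegral_mono hp
      _ ≤ ENNReal.ofReal (τ ^ 2 + (100000 + 300 * Real.exp 18) / Real.sqrt (Real.log d)) +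
          ENNReal.ofReal (8 * Real.exp 21 * (d : ℝ)⁻¹) := by
          rw [lintegral_add_left
            ((measurable_loss measurable_garrote θ).ennreal_ofReal), lintegral_loss_garrote]
          exact add_le_add (ENNReal.ofReal_le_ofReal hsum) (lintegral_denseLoss_le hd he hq3)
      _ ≤ _ := by
          rw [← ENNReal.ofReal_add (by positivity) (by positivity)]
          refine ENNReal.ofReal_le_ofReal ?_
          have := mul_le_mul_of_nonneg_left hinv (show 0 ≤ 8 * Real.exp 21 by positivity)
          rw [div_eq_mul_one_div]
          linarith
  refine (risk_le_of_lintegral_loss_le hd he.measurable htot).trans_eq ?_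
  congr 1
  have : Real.log d ^ (-1 / 2 : ℝ) = 1 / Real.sqrt (Real.log d) := by
    rw [Real.sqrt_eq_rpow, one_div, ← Real.rpow_neg (by linarith)]; norm_num
  rw [this]
  ring

/-! ### Dense signals: comparison with the best linear estimator -/

/-- The deterministic oracle bound for a block, with the observed energy linearized. -/
theorem sureTerm_le {n : ℕ} {lam s a : ℝ} (hlam : 0 < lam) (hn : lam = n - 2) (ha : (n : ℝ) ≤ a) :
    sureTerm n s lam ≤ n - lam ^ 2 * (2 / a - s / a ^ 2) := by
  have ha0 : 0 < a := by linarith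
  rw [sureTerm]
  rcases lt_or_ge lam s with h | h
  · rw [if_pos h, if_neg h.not_ge]
    have hs : 0 < s := hlam.trans h
    -- For `s > lam` the term is `n - lam² / s`, and `1 / s` lies above its tangent at `a`.
    -- Linearizing here replaces Jensen's inequality later.
    have e : n - lam ^ 2 * (2 / a - s / a ^ 2) -
        (n + (lam ^ 2 - 2 * lam * ((n : ℝ) - 2)) / s + 0) = lam ^ 2 / s * (1 - s / a) ^ 2 := by
      rw [← hn]; field_simp; ring
    have : 0 ≤ lam ^ 2 / s * (1 - s / a) ^ 2 := by positivity
    linarith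
  · rw [if_neg h.not_gt, if_pos h]
    have h1 : lam / a ≤ 1 := by rw [div_le_one ha0]; linarith
    have h2 : lam ^ 2 * (2 / a - s / a ^ 2) = 2 * lam * (lam / a) - s * (lam / a) ^ 2 := by
      field_simp
    have h3 : 0 ≤ lam * (1 - lam / a) := mul_nonneg hlam.le (by linarith)
    have h4 : 0 ≤ lam / a := by positivity
    have h5 : 0 ≤ (lam - s) * (1 - (lam / a) ^ 2) :=
      mul_nonneg (by linarith) (by rw [sub_nonneg]; exact pow_le_one₀ h4 h1)
    have h6 : 0 ≤ lam * (1 - lam / a) ^ 2 := by positivity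
    rw [h2]
    linarith [show lam * (1 - lam / a) ^ 2 + (lam - s) * (1 - (lam / a) ^ 2) =
      -s + 2 * lam - (2 * lam * (lam / a) - s * (lam / a) ^ 2) by ring]

/-- A crude bound free of `θ`, for the incomplete last block and for small `d`. -/
theorem loss_block_le {d L b : ℕ} {lam : ℝ} (h0 : 0 ≤ lam) (θ z : Fin d → ℝ) :
    ∑ i ∈ block d L b, (blockJS lam L (θ + z) i - θ i) ^ 2 ≤ 2 * energy z L b + 2 * lam := by
  set k := shrink lam (energy (θ + z) L b) with hk
  have h1 : k ^ 2 * energy (θ + z) L b ≤ lam := by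
    have hE := energy_nonneg (θ + z) L b
    have := shrink_mul_le h0 (Real.sqrt_nonneg _) (Real.sq_sqrt hE).le
    have h2 := pow_le_pow_left₀ (mul_nonneg (shrink_nonneg h0 _) (Real.sqrt_nonneg _)) this 2
    rwa [mul_pow, Real.sq_sqrt hE, Real.sq_sqrt h0] at h2
  calc _ ≤ ∑ i ∈ block d L b, (2 * z i ^ 2 + 2 * (k ^ 2 * (θ + z) i ^ 2)) :=
        Finset.sum_le_sum fun i hi => by
          rw [blockJS_eq_sub_shrink _ hi, ← hk, Pi.add_apply]
          nlinarith [sq_nonneg (z i + k * (θ i + z i))]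
    _ = 2 * energy z L b + 2 * (k ^ 2 * energy (θ + z) L b) := by
        rw [Finset.sum_add_distrib, energy, energy, Finset.mul_sum, Finset.mul_sum, Finset.mul_sum]
    _ ≤ _ := by linarith

theorem integral_energy_add {d : ℕ} (θ : Fin d → ℝ) (L b : ℕ) :
    Integrable (fun z => energy (θ + z) L b) (noise d) ∧
      ∫ z, energy (θ + z) L b ∂(noise d) = energy θ L b + (block d L b).card := by
  have i1 : Integrable (fun u : ℝ => u) (gaussianReal 0 1) :=
    (integrable_const 1).add integrable_sq_gaussian |>.mono' (by fun_prop)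
      (ae_of_all _ fun u => by
        rw [Real.norm_eq_abs, Pi.add_apply, ← sq_abs u]
        nlinarith [sq_nonneg (|u| - 1), abs_nonneg u])
  have e : ∀ (t u : ℝ), (t + u) ^ 2 = t ^ 2 + 2 * t * u + u ^ 2 := fun t u => by ring
  have i2 : ∀ t : ℝ, Integrable (fun u : ℝ => t ^ 2 + 2 * t * u) (gaussianReal 0 1) := fun t =>
    (integrable_const (t ^ 2)).add (i1.const_mul _)
  have i3 : ∀ t : ℝ, Integrable (fun u : ℝ => (t + u) ^ 2) (gaussianReal 0 1) := fun t => by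
    simp_rw [e]
    exact (i2 t).add integrable_sq_gaussian
  have h3 : ∀ t : ℝ, ∫ u, (t + u) ^ 2 ∂(gaussianReal 0 1) = t ^ 2 + 1 := fun t => by
    simp_rw [e]
    rw [integral_add (i2 t) integrable_sq_gaussian,
      integral_add (integrable_const _) (i1.const_mul _), integral_const_mul,
      integral_sq_gaussian, integral_id_gaussianReal]
    simp
  have hi : ∀ i : Fin d, Integrable (fun z : Fin d → ℝ => (θ i + z i) ^ 2) (noise d) := fun i =>
    integrable_comp_apply_noise i (i3 (θ i))
  unfold energy
  simp only [Pi.add_apply]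
  refine ⟨integrable_finsetSum _ fun i _ => hi i, ?_⟩
  rw [integral_finsetSum _ fun i _ => hi i, Finset.cast_card, ← Finset.sum_add_distrib]
  refine Finset.sum_congr rfl fun i _ => ?_
  rw [integral_comp_apply_noise i (i3 (θ i)).aestronglyMeasurable, h3]

theorem integral_energy {d : ℕ} (L b : ℕ) :
    Integrable (fun z : Fin d → ℝ => energy z L b) (noise d) ∧
      ∫ z, energy z L b ∂(noise d) = (block d L b).card := by
  simpa [energy] using integral_energy_add (0 : Fin d → ℝ) L b

/-- The expected loss of the James–Stein estimator on the blocks of full length. -/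
theorem lintegral_loss_blockJS_le {d L : ℕ} (hL : 3 ≤ L) (θ : Fin d → ℝ) :
    ∫⁻ z, ENNReal.ofReal (loss (blockJS ((L : ℝ) - 2) L) θ z) ∂(noise d) ≤
      ENNReal.ofReal (∑ b ∈ Finset.range (d / L),
        (L - ((L : ℝ) - 2) ^ 2 / (L + energy θ L b)) + 4 * L) := by
  have hLR : (3 : ℝ) ≤ L := by exact_mod_cast hL
  set lam : ℝ := (L : ℝ) - 2 with hlam
  have hlam0 : 0 < lam := by linarith
  set m := d / L with hm
  -- The tangent is taken at the mean `L + ‖θ_b‖²` of the observed energy, so `F b` has mean `L -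
  -- lam² / (L + ‖θ_b‖²)`.
  set F : ℕ → (Fin d → ℝ) → ℝ := fun b z =>
    (L - lam ^ 2 * (2 / (L + energy θ L b) - energy (θ + z) L b / (L + energy θ L b) ^ 2)) +
      (energy z L b - L) + 2 * sureError θ L b lam z with hF
  have hcard : ∀ b < m, (block d L b).card = L := fun b hb =>
    card_block_eq (by omega) ((Nat.mul_le_mul_right L hb).trans (Nat.div_mul_le_self d L))
  have hfull : ∀ b < m, ∀ z,
      ∑ i ∈ block d L b, (blockJS lam L (θ + z) i - θ i) ^ 2 ≤ F b z := fun b hb z => by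
    rw [loss_block_eq hlam0.le, hcard b hb]
    have := sureTerm_le (s := energy (θ + z) L b) (a := L + energy θ L b) hlam0 hlam
      (by linarith [energy_nonneg θ L b])
    simp only [hF]
    linarith
  have hnum : numBlocks d L ≤ m + 1 := by
    rw [numBlocks, hm, ← Nat.add_div_right _ (by omega)]
    exact Nat.div_le_div_right (by omega)
  have hG : ∀ z, loss (blockJS lam L) θ z ≤
      ∑ b ∈ Finset.range m, F b z + (2 * energy z L m + 2 * lam) := fun z => by
    rw [loss, ← sum_blocks (L := L) (by omega)]
    calc _ ≤ ∑ b ∈ Finset.range (m + 1),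
          ∑ i ∈ block d L b, (blockJS lam L (θ + z) i - θ i) ^ 2 :=
          Finset.sum_le_sum_of_subset_of_nonneg (Finset.range_mono hnum)
            fun _ _ _ => Finset.sum_nonneg fun _ _ => sq_nonneg _
      _ ≤ _ := by
          rw [Finset.sum_range_succ]
          exact add_le_add (Finset.sum_le_sum fun b hb => hfull b (Finset.mem_range.1 hb) z)
            (loss_block_le hlam0.le θ z)
  have hFi : ∀ b < m, Integrable (F b) (noise d) ∧
      ∫ z, F b z ∂(noise d) = L - lam ^ 2 / (L + energy θ L b) := fun b hb => by
    obtain ⟨i1, e1⟩ := integral_energy_add θ L b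
    obtain ⟨i2, e2⟩ := integral_energy (d := d) L b
    obtain ⟨i3, e3⟩ := integral_sureError θ L b hlam0
    rw [hcard b hb] at e1 e2
    have ha : 0 < L + energy θ L b := by linarith [energy_nonneg θ L b]
    have j1 : Integrable (fun z => lam ^ 2 * (2 / (L + energy θ L b) -
        energy (θ + z) L b / (L + energy θ L b) ^ 2)) (noise d) :=
      ((integrable_const _).sub (i1.div_const _)).const_mul _
    have j2 : Integrable (fun z => L - lam ^ 2 * (2 / (L + energy θ L b) -
        energy (θ + z) L b / (L + energy θ L b) ^ 2)) (noise d) := (integrable_const _).sub j1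
    have j3 : Integrable (fun z : Fin d → ℝ => energy z L b - L) (noise d) :=
      i2.sub (integrable_const _)
    refine ⟨(j2.add j3).add (i3.const_mul 2), ?_⟩
    rw [hF, integral_add (by exact j2.add j3) (i3.const_mul 2), integral_const_mul, e3,
      integral_add j2 j3, integral_sub (integrable_const _) j1, integral_const_mul,
      integral_sub (integrable_const _) (i1.div_const _), integral_div, integral_div, e1,
      integral_sub i2 (integrable_const _), e2]
    simp only [integral_const, probReal_univ, smul_eq_mul, one_mul]
    field_simp
    ring
  obtain ⟨i4, e4⟩ := integral_energy (d := d) L m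
  have k1 : Integrable (fun z => ∑ b ∈ Finset.range m, F b z) (noise d) :=
    integrable_finsetSum _ fun b hb => (hFi b (Finset.mem_range.1 hb)).1
  have k2 : Integrable (fun z : Fin d → ℝ => 2 * energy z L m + 2 * lam) (noise d) :=
    (i4.const_mul 2).add (integrable_const _)
  refine (lintegral_mono fun z => ENNReal.ofReal_le_ofReal (hG z)).trans ?_
  rw [← ofReal_integral_eq_lintegral_ofReal (by exact k1.add k2)
    (ae_of_all _ fun z => (loss_nonneg _ θ z).trans (hG z))]
  refine ENNReal.ofReal_le_ofReal ?_
  rw [integral_add k1 k2, integral_finsetSum _ fun b hb => (hFi b (Finset.mem_range.1 hb)).1,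
    Finset.sum_congr rfl fun b hb => (hFi b (Finset.mem_range.1 hb)).2,
    integral_add (i4.const_mul 2) (integrable_const _), integral_const_mul, e4]
  have : ((block d L m).card : ℝ) ≤ L := by exact_mod_cast card_block_le (by omega) m
  simp only [integral_const, probReal_univ, smul_eq_mul, one_mul]
  linarith

/-- Some James–Stein estimator in the search range is nearly as good as the best linear one. -/
theorem exists_lintegral_loss_blockJS_le {d : ℕ} (hd : 4 ≤ d) (θ : Fin d → ℝ) :
    ∃ (lam : ℝ) (L : ℕ), (lam, L) ∈ searchRange d ∧ 0 < lam ∧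
      ∫⁻ z, ENNReal.ofReal (loss (blockJS lam L) θ z) ∂(noise d) ≤
        ENNReal.ofReal (d * (∑ i, θ i ^ 2) / (d + ∑ i, θ i ^ 2) + 300 * errTerm d) := by
  have hdN : (4 : ℝ) ≤ d := by exact_mod_cast hd
  have hd0 : (0 : ℝ) < d := by linarith
  have hlog := one_le_log hd
  have herr := one_le_errTerm hd
  have hserr := sqrt_le_errTerm hd
  have hr : 2 ≤ Real.sqrt d := Real.le_sqrt_of_sq_le (by linarith)
  set q := ∑ i, θ i ^ 2 with hq
  have hq0 : 0 ≤ q := Finset.sum_nonneg fun _ _ => sq_nonneg _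
  have hdq : 0 ≤ d * q / (d + q) := by positivity
  -- For `d < 9`, `⌊√d⌋ = 2` and `L - 2` would not be positive; there any admissible pair will do,
  -- as the error term dominates.
  rcases lt_or_ge d 9 with h9 | h9
  · have h0 : (0 : ℝ) < 2 * Real.log d := by linarith
    refine ⟨2 * Real.log d, 1, ⟨max_le (by push_cast; linarith) h0.le,
      by push_cast; linarith, le_rfl, by push_cast; linarith⟩, h0, ?_⟩
    have h8 : (d : ℝ) ≤ 8 := by exact_mod_cast (show d ≤ 8 by omega)
    have hl8 : Real.log d ≤ 7 := by linarith [Real.log_le_sub_one_of_pos hd0]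
    have hp : ∀ z, loss (blockJS (2 * Real.log d) 1) θ z ≤ 2 * ∑ i, z i ^ 2 + 224 := fun z => by
      rw [loss, ← sum_blocks (L := 1) le_rfl]
      calc _ ≤ ∑ b ∈ Finset.range (numBlocks d 1), (2 * energy z 1 b + 2 * (2 * Real.log d)) :=
            Finset.sum_le_sum fun b _ => loss_block_le h0.le θ z
        _ = 2 * ∑ i, z i ^ 2 + numBlocks d 1 * (2 * (2 * Real.log d)) := by
            rw [Finset.sum_add_distrib, ← Finset.mul_sum, sum_energy le_rfl, Finset.sum_const,
              Finset.card_range, nsmul_eq_mul]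
        _ ≤ 2 * ∑ i, z i ^ 2 + 8 * (2 * (2 * 7)) := by
            have : (numBlocks d 1 : ℝ) ≤ 8 :=
              le_trans (by exact_mod_cast numBlocks_le le_rfl (by omega)) h8
            gcongr
        _ = _ := by norm_num
    refine (lintegral_mono fun z => ENNReal.ofReal_le_ofReal (hp z)).trans ?_
    simp_rw [fun z : Fin d → ℝ => ENNReal.ofReal_add (p := 2 * ∑ i, z i ^ 2) (q := 224)
      (mul_nonneg zero_le_two (Finset.sum_nonneg fun _ _ => sq_nonneg _)) (by norm_num),
      ENNReal.ofReal_mul zero_le_two]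
    rw [lintegral_add_right _ measurable_const, lintegral_const_mul' _ _ ENNReal.ofReal_ne_top,
      lintegral_sum_sq_noise, lintegral_const, measure_univ, mul_one, ← ENNReal.ofReal_natCast d,
      ← ENNReal.ofReal_mul zero_le_two, ← ENNReal.ofReal_add (by positivity) (by norm_num)]
    refine ENNReal.ofReal_le_ofReal ?_
    linarith
  · set L := Nat.sqrt d with hLdef
    have hL : 3 ≤ L := Nat.le_sqrt.2 (by omega)
    have hLR : (3 : ℝ) ≤ L := by exact_mod_cast hL
    have hLs : (L : ℝ) ≤ Real.sqrt d := Real.nat_sqrt_le_real_sqrt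
    refine ⟨(L : ℝ) - 2, L, ⟨max_le le_rfl (by simpa using by linarith), ?_, by omega, hLs⟩,
      by linarith, (lintegral_loss_blockJS_le hL θ).trans (ENNReal.ofReal_le_ofReal ?_)⟩
    · show (L : ℝ) - 2 ≤ 2 * L * Real.log d
      nlinarith
    set m := d / L with hm
    have hmL : (m : ℝ) * L ≤ d := by exact_mod_cast Nat.div_mul_le_self d L
    have hmL2 : (m : ℝ) ≤ L + 2 := by
      have h1 : d < (L + 1) * (L + 1) := Nat.lt_succ_sqrt d
      have h2 : m < L + 3 := by
        rw [hm, Nat.div_lt_iff_lt_mul (by omega)]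
        nlinarith
      exact_mod_cast (show m ≤ L + 2 by omega)
    have hsum : ∑ b ∈ Finset.range m, energy θ L b ≤ q := by
      rw [hq, ← sum_energy (L := L) (by omega)]
      refine Finset.sum_le_sum_of_subset_of_nonneg (Finset.range_mono ?_)
        fun _ _ _ => energy_nonneg _ _ _
      rw [hm, numBlocks]
      exact Nat.div_le_div_right (by omega)
    -- The oracle linear weight, the same for all blocks. On each block James–Stein is within 4 of
    -- the linear risk `u² L + (1 - u)² ‖θ_b‖²`, and these sum to at most `d q / (d + q)`.
    set u := q / (d + q) with hu
    have hterm : ∀ b, L - ((L : ℝ) - 2) ^ 2 / (L + energy θ L b) ≤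
        u ^ 2 * L + (1 - u) ^ 2 * energy θ L b + 4 := fun b => by
      have he := energy_nonneg θ L b
      rw [sub_le_iff_le_add, ← sub_le_iff_le_add', le_div_iff₀ (by linarith)]
      nlinarith [sq_nonneg (u * L - (1 - u) * energy θ L b)]
    have hsq : d * q / (d + q) = u ^ 2 * d + (1 - u) ^ 2 * q := by
      rw [hu]; field_simp; ring
    calc _ ≤ ∑ b ∈ Finset.range m, (u ^ 2 * L + (1 - u) ^ 2 * energy θ L b + 4) + 4 * (L : ℝ) := by
          gcongr with b
          exact hterm b
      _ = u ^ 2 * (m * L) + (1 - u) ^ 2 * ∑ b ∈ Finset.range m, energy θ L b + 4 * m + 4 * L := by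
          rw [Finset.sum_add_distrib, Finset.sum_add_distrib, Finset.mul_sum]
          simp only [Finset.sum_const, Finset.card_range, nsmul_eq_mul]
          ring
      _ ≤ u ^ 2 * d + (1 - u) ^ 2 * q + 4 * (L + 2) + 4 * L := by gcongr
      _ ≤ _ := by rw [hsq]; linarith

theorem risk_le_of_lintegral_loss_blockJS_le {d : ℕ} (hd : 4 ≤ d)
    {est : (Fin d → ℝ) → Fin d → ℝ} (he : IsSureBlock est) {lam : ℝ} {L : ℕ}
    (hq : (lam, L) ∈ searchRange d) (hlam : 0 < lam) {θ : Fin d → ℝ} {A : ℝ} (hA : 0 ≤ A)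
    (h : ∫⁻ z, ENNReal.ofReal (loss (blockJS lam L) θ z) ∂(noise d) ≤ ENNReal.ofReal A) :
    risk est θ ≤ ENNReal.ofReal ((d : ℝ)⁻¹ * (A + (500 + 200 * Real.exp 8) * errTerm d)) := by
  have herr := one_le_errTerm hd
  refine risk_le_of_lintegral_loss_le hd he.measurable ((lintegral_loss_le hd he hq hlam θ).trans
    ((add_le_add (add_le_add h le_rfl) (lintegral_sparseLoss_le hd θ)).trans_eq ?_))
  rw [← ENNReal.ofReal_add hA (by positivity), ← ENNReal.ofReal_add (by positivity) (by positivity)]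
  congr 1
  ring

theorem inv_mul_errTerm {d : ℕ} (hd : 1 ≤ d) :
    (d : ℝ)⁻¹ * errTerm d = (d : ℝ) ^ (-1 / 4 : ℝ) * Real.log d ^ (5 / 2 : ℝ) := by
  have hd0 : (0 : ℝ) < d := by exact_mod_cast hd
  rw [errTerm, fluct, ← mul_assoc, ← Real.rpow_neg_one, ← Real.rpow_add hd0]
  norm_num

/-- The risk is close to that of the best linear estimator. -/
theorem risk_le_linear {d : ℕ} (hd : 4 ≤ d) {est : (Fin d → ℝ) → Fin d → ℝ}
    (he : IsSureBlock est) (θ : Fin d → ℝ) :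
    risk est θ ≤ ENNReal.ofReal ((∑ i, θ i ^ 2) / (d + ∑ i, θ i ^ 2) +
      (800 + 200 * Real.exp 8) * (d : ℝ) ^ (-1 / 4 : ℝ) * Real.log d ^ (5 / 2 : ℝ)) := by
  have hd0 : (0 : ℝ) < d := by exact_mod_cast (show 0 < d by omega)
  obtain ⟨lam, L, hq, hlam, h⟩ := exists_lintegral_loss_blockJS_le hd θ
  have hq0 : 0 ≤ ∑ i, θ i ^ 2 := Finset.sum_nonneg fun _ _ => sq_nonneg _
  have herr := one_le_errTerm hd
  refine (risk_le_of_lintegral_loss_blockJS_le hd he hq hlam (by positivity) h).trans_eq ?_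
  rw [mul_assoc (800 + 200 * Real.exp 8), ← inv_mul_errTerm (by omega)]
  congr 1
  field_simp
  ring

theorem risk_le_of_dense {d : ℕ} (hd : 4 ≤ d) {est : (Fin d → ℝ) → Fin d → ℝ}
    (he : IsSureBlock est) {p : ℝ≥0∞} (hp : 2 ≤ p) {τ : ℝ} (hτ : 0 ≤ τ) {θ : Fin d → ℝ}
    (h : θ ∈ lpBall d p τ) :
    risk est θ ≤ ENNReal.ofReal (τ ^ 2 / (τ ^ 2 + (d : ℝ) ^ (2 / p).toReal) +
      (800 + 200 * Real.exp 8) * (d : ℝ) ^ (-1 / 4 : ℝ) * Real.log d ^ (5 / 2 : ℝ)) := by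
  have hd0 : (0 : ℝ) < d := by exact_mod_cast (show 0 < d by omega)
  refine (risk_le_linear hd he θ).trans (ENNReal.ofReal_le_ofReal ?_)
  have h1 := sum_sq_mul_le_of_mem_lpBall (by omega) hp hτ h
  have hq0 : 0 ≤ ∑ i, θ i ^ 2 := Finset.sum_nonneg fun _ _ => sq_nonneg _
  gcongr ?_ + _
  rw [div_le_div_iff₀ (by positivity) (by positivity)]
  linarith

/-! ### Moderately sparse signals -/

/-- The risk is of order `min (θ²) (1 + lam)` up to the tail, and this minimum is at most `|θ|^p (1
+ lam)^{1 - p/2}`. -/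
theorem garroteRisk_le_rpow {lam p : ℝ} (hlam : 0 ≤ lam) (hp : 0 < p) (hp2 : p ≤ 2) (θ : ℝ) :
    garroteRisk lam θ ≤
      18 * (|θ| ^ p * (1 + lam) ^ (1 - p / 2)) + 128 * Real.exp (-lam / 2) := by
  have hs := Real.sq_sqrt hlam
  have key : ∀ x : ℝ, 0 ≤ x → x ^ 2 = x ^ p * (x ^ 2) ^ (1 - p / 2) := fun x hx => by
    rw [← Real.rpow_natCast, ← Real.rpow_mul hx, ← Real.rpow_add_of_nonneg hx hp.le
      (by push_cast; linarith)]
    congr 1; push_cast; ring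
  have hE := Real.exp_pos (-lam / 2)
  rcases le_or_gt (θ ^ 2) (1 + lam) with h | h
  · have h1 := garroteRisk_le_sq_add (Real.sqrt_nonneg lam) θ
    rw [hs] at h1
    refine h1.trans ?_
    gcongr
    rw [← sq_abs, key _ (abs_nonneg θ)]
    rw [← sq_abs] at h
    gcongr
    linarith
  · have h1 := garroteRisk_le (Real.sqrt_nonneg lam) θ
    rw [hs] at h1
    have h2 : (1 + Real.sqrt lam) ^ 2 ≤ 2 * (1 + lam) := by
      nlinarith [sq_nonneg (1 - Real.sqrt lam)]
    have h3 : 1 + lam ≤ |θ| ^ p * (1 + lam) ^ (1 - p / 2) := by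
      have h4 : Real.sqrt (1 + lam) ≤ |θ| := Real.sqrt_le_iff.2
        ⟨abs_nonneg _, by rw [sq_abs]; exact h.le⟩
      calc 1 + lam = Real.sqrt (1 + lam) ^ 2 := (Real.sq_sqrt (by linarith)).symm
        _ = Real.sqrt (1 + lam) ^ p * (Real.sqrt (1 + lam) ^ 2) ^ (1 - p / 2) :=
            key _ (Real.sqrt_nonneg _)
        _ = Real.sqrt (1 + lam) ^ p * (1 + lam) ^ (1 - p / 2) := by
            rw [Real.sq_sqrt (by linarith)]
        _ ≤ _ := by gcongr
    linarith

theorem blockJS_one {d : ℕ} (lam : ℝ) :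
    blockJS (d := d) lam 1 = fun x i => garrote1 lam (x i) := by
  funext x i
  have : block d 1 ((i : ℕ) / 1) = {i} := by
    ext j
    rw [mem_block, Finset.mem_singleton, Nat.div_one, Nat.div_one, Fin.ext_iff]
  rw [blockJS, energy, this, Finset.sum_singleton, garrote1]

/-- The oracle has `L = 1`, `lam = 2l` with `l = log (d τ^{-p})`, which makes the summed tails
exactly a multiple of `τ^p`. The condition `τ > 1` keeps `lam ≤ 2 log d`; `η < 1` keeps `l` away
from zero, so `1 + 2l` is comparable to `l`. -/
theorem risk_le_of_moderately_sparse {d : ℕ} (hd : 4 ≤ d) {est : (Fin d → ℝ) → Fin d → ℝ}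
    (he : IsSureBlock est) {η : ℝ} (hη : 0 < η) (hη1 : η < 1) {p τ : ℝ} (hp : 0 < p) (hp2 : p ≤ 2)
    (hτ : 1 < τ) (hτd : τ ^ p ≤ η * d) {θ : Fin d → ℝ} (h : θ ∈ lpBall d (ENNReal.ofReal p) τ) :
    risk est θ ≤ ENNReal.ofReal (146 * (1 / Real.log (1 / η) + 2) * (d : ℝ)⁻¹ * τ ^ p *
        Real.log (d * τ ^ (-p)) ^ (1 - p / 2) +
      (500 + 200 * Real.exp 8) * (d : ℝ) ^ (-1 / 4 : ℝ) * Real.log d ^ (5 / 2 : ℝ)) := by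
  have hdN : (4 : ℝ) ≤ d := by exact_mod_cast hd
  have hd0 : (0 : ℝ) < d := by linarith
  have hτ0 : 0 < τ := by linarith
  have ht : 0 < τ ^ p := by positivity
  have hr : 2 ≤ Real.sqrt d := Real.le_sqrt_of_sq_le (by linarith)
  have hk : 0 < Real.log (1 / η) := Real.log_pos (by rw [lt_div_iff₀ hη]; linarith)
  have hd1 : 1 / η ≤ d * τ ^ (-p) := by
    rw [Real.rpow_neg hτ0.le, ← div_eq_mul_inv, div_le_div_iff₀ hη ht]; linarith
  have hd2 : d * τ ^ (-p) ≤ d :=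
    mul_le_of_le_one_right hd0.le (Real.rpow_le_one_of_one_le_of_nonpos hτ.le (by linarith))
  set l := Real.log (d * τ ^ (-p)) with hl
  have hkl : Real.log (1 / η) ≤ l := Real.log_le_log (by positivity) hd1
  have hld : l ≤ Real.log d := Real.log_le_log (by positivity) hd2
  set k := Real.log (1 / η)
  have hl0 : 0 < l := hk.trans_le hkl
  have hexp : Real.exp (-(2 * l) / 2) = τ ^ p / d := by
    rw [show -(2 * l) / 2 = -l by ring, Real.exp_neg, hl, Real.exp_log (by positivity),
      Real.rpow_neg hτ0.le]
    field_simp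
  have hA : ∑ i, garroteRisk (2 * l) (θ i) ≤ 146 * (1 / k + 2) * (τ ^ p * l ^ (1 - p / 2)) := by
    have h1 := sum_rpow_le_of_mem_lpBall hp h
    have hK : 1 + 2 * l ≤ (1 / k + 2) * l := by
      have : 1 ≤ 1 / k * l := by rw [one_div, inv_mul_eq_div, one_le_div hk]; exact hkl
      linarith
    have hK1 : 1 ≤ 1 / k + 2 := by linarith [show 0 < 1 / k by positivity]
    have hKe : (1 + 2 * l) ^ (1 - p / 2) ≤ (1 / k + 2) * l ^ (1 - p / 2) := by
      calc (1 + 2 * l) ^ (1 - p / 2) ≤ ((1 / k + 2) * l) ^ (1 - p / 2) := by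
            gcongr; linarith
        _ = (1 / k + 2) ^ (1 - p / 2) * l ^ (1 - p / 2) := Real.mul_rpow (by positivity) hl0.le
        _ ≤ (1 / k + 2) ^ (1 : ℝ) * l ^ (1 - p / 2) := by
            gcongr
            linarith
        _ = _ := by rw [Real.rpow_one]
    have h2 : 1 ≤ (1 + 2 * l) ^ (1 - p / 2) := Real.one_le_rpow (by linarith) (by linarith)
    calc _ ≤ ∑ i, (18 * (|θ i| ^ p * (1 + 2 * l) ^ (1 - p / 2)) +
          128 * Real.exp (-(2 * l) / 2)) :=
          Finset.sum_le_sum fun i _ => garroteRisk_le_rpow (by linarith) hp hp2 (θ i)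
      _ = 18 * ((∑ i, |θ i| ^ p) * (1 + 2 * l) ^ (1 - p / 2)) + 128 * (τ ^ p * 1) := by
          rw [Finset.sum_add_distrib, ← Finset.mul_sum, ← Finset.sum_mul, hexp]
          simp only [Finset.sum_const, Finset.card_univ, Fintype.card_fin, nsmul_eq_mul]
          field_simp
      _ ≤ 18 * (τ ^ p * (1 + 2 * l) ^ (1 - p / 2)) + 128 * (τ ^ p * (1 + 2 * l) ^ (1 - p / 2)) := by
          gcongr
      _ = 146 * (τ ^ p * (1 + 2 * l) ^ (1 - p / 2)) := by ring
      _ ≤ 146 * (τ ^ p * ((1 / k + 2) * l ^ (1 - p / 2))) := by gcongr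
      _ = _ := by ring
  have hq : (2 * l, 1) ∈ searchRange d :=
    ⟨max_le (by push_cast; linarith) (by linarith), by push_cast; linarith, le_rfl,
      by push_cast; linarith⟩
  refine (risk_le_of_lintegral_loss_blockJS_le hd he hq (by linarith) (θ := θ) (by positivity)
    (A := 146 * (1 / k + 2) * (τ ^ p * l ^ (1 - p / 2))) ?_).trans_eq ?_
  · rw [blockJS_one, lintegral_loss_garrote1 (by linarith)]
    exact ENNReal.ofReal_le_ofReal hA
  · rw [mul_assoc (500 + 200 * Real.exp 8), ← inv_mul_errTerm (by omega)]
    congr 1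
    ring

/-- The risk bound of order `τ²`, which covers the boundary cases of the sparse regime. -/
theorem risk_le_sq {d : ℕ} (hd : 4 ≤ d) {est : (Fin d → ℝ) → Fin d → ℝ}
    (he : IsSureBlock est) {p τ : ℝ} (hp : 0 < p) (hp2 : p ≤ 2) (hτ : 0 ≤ τ) {θ : Fin d → ℝ}
    (h : θ ∈ lpBall d (ENNReal.ofReal p) τ) :
    risk est θ ≤ ENNReal.ofReal ((d : ℝ)⁻¹ * τ ^ 2 +
      (800 + 200 * Real.exp 8) * (d : ℝ) ^ (-1 / 4 : ℝ) * Real.log d ^ (5 / 2 : ℝ)) := by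
  have hd0 : (0 : ℝ) < d := by exact_mod_cast (show 0 < d by omega)
  refine (risk_le_linear hd he θ).trans (ENNReal.ofReal_le_ofReal ?_)
  have hq := sum_sq_le_of_mem_lpBall hp hp2 hτ h
  have hq0 : 0 ≤ ∑ i, θ i ^ 2 := Finset.sum_nonneg fun _ _ => sq_nonneg _
  gcongr ?_ + _
  calc _ ≤ (∑ i, θ i ^ 2) / d := by gcongr; linarith
    _ ≤ _ := by rw [div_eq_inv_mul]; gcongr

end SureBlock

/-! ### Assembly of the three regimes -/

theorem theorem2 :
    -- (a) dense signals
    (∃ c : ℝ, 0 < c ∧ ∀ d : ℕ, 4 ≤ d →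
      ∀ est : (Fin d → ℝ) → Fin d → ℝ, SureBlock.IsSureBlock est →
      ∀ p : ℝ≥0∞, 2 ≤ p → ∀ τ : ℝ, 0 ≤ τ →
        (⨆ θ ∈ SureBlock.lpBall d p τ, SureBlock.risk est θ) ≤
          ENNReal.ofReal (τ ^ 2 / (τ ^ 2 + (d : ℝ) ^ (2 / p).toReal)
            + c * (d : ℝ) ^ (-1 / 4 : ℝ) * Real.log d ^ (5 / 2 : ℝ))) ∧
    -- (b) moderately sparse signals
    (∀ η : ℝ, 0 < η → η < 1 → ∃ c : ℝ, 0 < c ∧ ∀ d : ℕ, 4 ≤ d →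
      ∀ est : (Fin d → ℝ) → Fin d → ℝ, SureBlock.IsSureBlock est →
      ∀ p : ℝ, 1 ≤ p → p ≤ 2 → ∀ τ : ℝ, 0 < τ → (p = 2 ∨ τ ^ p ≤ η * d) →
        (⨆ θ ∈ SureBlock.lpBall d (ENNReal.ofReal p) τ, SureBlock.risk est θ) ≤
          ENNReal.ofReal (c * (d : ℝ)⁻¹ * τ ^ p * Real.log (d * τ ^ (-p)) ^ (1 - p / 2)
            + c * (d : ℝ) ^ (-1 / 4 : ℝ) * Real.log d ^ (5 / 2 : ℝ))) ∧
    -- (c) very sparse signals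
    (∃ c : ℝ, 0 < c ∧ ∀ d : ℕ, 4 ≤ d →
      ∀ est : (Fin d → ℝ) → Fin d → ℝ, SureBlock.IsSureBlock est →
      ∀ p : ℝ, 0 < p → p ≤ 2 →
      ∀ τ : ℝ, 0 ≤ τ →
        τ < 1 / Real.sqrt 3 * (d : ℝ) ^ (1 / 4 : ℝ) * Real.logb 2 d ^ (3 / 4 : ℝ) →
        (⨆ θ ∈ SureBlock.lpBall d (ENNReal.ofReal p) τ, SureBlock.risk est θ) ≤
          ENNReal.ofReal ((d : ℝ)⁻¹ * τ ^ 2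
            + c * (d : ℝ)⁻¹ * Real.log d ^ (-1 / 2 : ℝ))) := by
  refine ⟨⟨800 + 200 * Real.exp 8, by positivity, fun d hd est he p hp τ hτ =>
      iSup₂_le fun θ hθ => SureBlock.risk_le_of_dense hd he hp hτ hθ⟩,
    fun η hη hη1 => ?_,
    ⟨100000 + 300 * Real.exp 18 + 8 * Real.exp 21, by positivity,
      fun d hd est he p hp hp2 τ hτ hτd => iSup₂_le fun θ hθ =>
        SureBlock.risk_le_of_very_sparse hd he hp hp2 hτ hτd hθ⟩⟩
  have hk : 0 < Real.log (1 / η) := Real.log_pos (by rw [lt_div_iff₀ hη]; linarith)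
  have hK : 0 < 1 / Real.log (1 / η) := by positivity
  have hE := Real.exp_pos 8
  -- 801 is the 800 of `risk_le_sq` plus 1, which absorbs `τ² / d ≤ 1 / d` when `τ ≤ 1`.
  refine ⟨146 * (1 / Real.log (1 / η) + 2) + (801 + 200 * Real.exp 8), by positivity,
    fun d hd est he p hp1 hp2 τ hτ hor => iSup₂_le fun θ hθ => ?_⟩
  have hd0 : (0 : ℝ) < d := by exact_mod_cast (show 0 < d by omega)
  have hlog := SureBlock.one_le_log hd
  have herr : (d : ℝ)⁻¹ ≤ (d : ℝ) ^ (-1 / 4 : ℝ) * Real.log d ^ (5 / 2 : ℝ) := by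
    rw [← SureBlock.inv_mul_errTerm (by omega)]
    exact le_mul_of_one_le_right (by positivity) (SureBlock.one_le_errTerm hd)
  set E := (d : ℝ) ^ (-1 / 4 : ℝ) * Real.log d ^ (5 / 2 : ℝ) with hEdef
  have hE0 : 0 ≤ E := by positivity
  have hsq := SureBlock.risk_le_sq hd he (by linarith) hp2 hτ.le hθ
  rw [mul_assoc _ ((d : ℝ) ^ (-1 / 4 : ℝ)), ← hEdef] at hsq ⊢
  rcases eq_or_ne p 2 with rfl | hp
  · refine hsq.trans (ENNReal.ofReal_le_ofReal ?_)
    rw [div_self two_ne_zero, sub_self, Real.rpow_zero, mul_one, Real.rpow_two, mul_assoc]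
    refine add_le_add (le_mul_of_one_le_left (by positivity) (by linarith)) ?_
    exact mul_le_mul_of_nonneg_right (by linarith) hE0
  · have hτd := hor.resolve_left hp
    have hl : 0 ≤ Real.log (d * τ ^ (-p)) := by
      refine Real.log_nonneg ?_
      rw [Real.rpow_neg hτ.le, ← div_eq_mul_inv, one_le_div (by positivity)]
      nlinarith
    -- For `τ ≤ 1` the oracle threshold could leave the search range, but then `τ² / d` is below the
    -- error term.
    rcases le_or_gt τ 1 with h1 | h1
    · refine hsq.trans (ENNReal.ofReal_le_ofReal ?_)
      have h2 : (d : ℝ)⁻¹ * τ ^ 2 ≤ E :=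
        (mul_le_of_le_one_right (by positivity) (pow_le_one₀ hτ.le h1)).trans herr
      have h3 : 0 ≤ (146 * (1 / Real.log (1 / η) + 2) + (801 + 200 * Real.exp 8)) * (d : ℝ)⁻¹ *
        τ ^ p * Real.log (d * τ ^ (-p)) ^ (1 - p / 2) := by positivity
      have h4 : 0 ≤ 146 * (1 / Real.log (1 / η) + 2) * E := by positivity
      linarith
    · have := SureBlock.risk_le_of_moderately_sparse hd he hη hη1 (by linarith) hp2 h1 hτd hθ
      rw [mul_assoc _ ((d : ℝ) ^ (-1 / 4 : ℝ)), ← hEdef] at this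
      refine this.trans (ENNReal.ofReal_le_ofReal ?_)
      refine add_le_add ?_ (mul_le_mul_of_nonneg_right (by linarith) hE0)
      gcongr
      linarith
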